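/- Let $m\ge 1$, $J_1,\dots,J_m>0$, and $0\le\lambda_i\le\frac12$ for $1\le i\le m$, with $\lambda_i$ not all zero. Put $\underline J=(J_1,\dots,J_m)$, $\underline\lambda=(\lambda_1,\dots,\lambda_m)$, and let $\boldsymbol\Lambda$ be the diagonal matrix with entries $\lambda_1,\dots,\lambda_m$. Choose $R_i>\lambda_i/(1-\lambda_i)$, let $D=\{z\in\mathbb C^m: |z_i|<R_i,\ 1\le i\le m\}$, and let $\mathcal B(D)$ be the space of continuous functions on $\overline D$ that are holomorphic on $D$. For $\beta\in\mathbb R$ let $\mathcal L_\beta$ be the Ruelle operator $$(\mathcal L_\beta f)(z)=e^{\beta \underline J\cdot z}f(\boldsymbol\Lambda z+\underline\lambda)+e^{-\beta \underline J\cdot z}f(\boldsymbol\Lambda z-\underline\lambda)$$ on $\mathcal B(D)$. It commutes with $(Pf)(z)=f(-z)$; its even (odd) eigenvalues are its eigenvalues on the functions with $Pf=f$ (with $Pf=-f$), counted with algebraic multiplicity. For $\alpha\in\mathbb N_0^m$ write $|\alpha|=\sum_i\alpha_i$ and $\underline\lambda^\alpha=\prod_i\lambda_i^{\alpha_i}$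 (with $0^0=1$). For every real $\beta$ the nonzero even eigenvalues of $\mathcal L_\beta$ are real and can be labelled, with multiplicity, by multi-indices $\alpha\in\mathbb N_0^m$ as $\rho^{+}_\alpha(\beta)$, and the nonzero odd ones as $\rho^{-}_\alpha(\beta)$ (unused labels are given the value $0$), such that the following holds. For every $N\ge1$, if $\beta$ is sufficiently large (and likewise if $-\beta$ is), there are $N$ multi-indices at which $\underline\lambda^\alpha$ takes its $N$ largest values and which label $N$ leading (that is, largest in modulus) even eigenvalues; and the same is true of the odd ones. Moreover, for every $\alpha$ (where $f\sim g$ means $f/g\to1$ if $\underline\lambda^\alpha\ne0$, and $f=0$ eventually if $\underline\lambda^\alpha=0$): (i) $\rho^{+}_\alpha(\beta)\sim\underline\lambda^{\alpha}\exp\bigl(\beta\,\underline J\cdot(1-\boldsymbol\Lambda)^{-1}\underline\lambda\bigr)$ as $\beta\to+\infty$, and $\rho^{+}_\alpha(\beta)\sim(-1)^{|\alpha|}\underline\lambda^{\alpha}\exp\bigl(-\beta\,\underline J\cdot(1+\boldsymbol\Lambda)^{-1}\underline\lambda\bigr)$ as $\beta\to-\infty$; (ii) $\rho^{-}_\alpha(\beta)\sim\underline\lambda^{\alpha}\exp\bigl(\beta\,\underline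 J\cdot(1-\boldsymbol\Lambda)^{-1}\underline\lambda\bigr)$ as $\beta\to+\infty$, and $\rho^{-}_\alpha(\beta)\sim(-1)^{|\alpha|+1}\underline\lambda^{\alpha}\exp\bigl(-\beta\,\underline J\cdot(1+\boldsymbol\Lambda)^{-1}\underline\lambda\bigr)$ as $\beta\to-\infty$. Consequently, both as $\beta\to+\infty$ and as $\beta\to-\infty$, infinitely many even and infinitely many odd eigenvalues of $\mathcal L_\beta$ tend to $+\infty$. -/

import Mathlib

open Filter Topology Asymptotics

namespace KacBaker

variable {m : ℕ}

/-- The open polydisc `{z ∈ ℂ^m : |z_l| < R_l}`. -/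
def polydisc (R : Fin m → ℝ) : Set (Fin m → ℂ) := {z | ∀ l, ‖z l‖ < R l}

/-- The closed polydisc `{z ∈ ℂ^m : |z_l| ≤ R_l}`; for positive radii it is the closure of
`polydisc R`. -/
def closedPolydisc (R : Fin m → ℝ) : Set (Fin m → ℂ) := {z | ∀ l, ‖z l‖ ≤ R l}

/-- The continuous functions on the closed polydisc that are holomorphic on the open one, as a
subspace of the space of all continuous functions. -/
def holoSubmodule (R : Fin m → ℝ) : Submodule ℂ C(closedPolydisc R, ℂ) where
  carrier := {f | ∃ g : (Fin m → ℂ) → ℂ, DifferentiableOn ℂ g (polydisc R) ∧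
    ∀ z : closedPolydisc R, (z : Fin m → ℂ) ∈ polydisc R → g z = f z}
  add_mem' := by
    rintro f₁ f₂ ⟨g₁, h₁, e₁⟩ ⟨g₂, h₂, e₂⟩
    exact ⟨g₁ + g₂, h₁.add h₂, fun z hz => by simp [e₁ z hz, e₂ z hz]⟩
  zero_mem' := ⟨0, differentiableOn_const 0, fun z _ => rfl⟩
  smul_mem' := by
    rintro c f ⟨g, h, e⟩
    exact ⟨c • g, h.const_smul c, fun z hz => by simp [e z hz]⟩

/-- The space `B(D)` of the continuous functions on the closed polydisc that are holomorphic on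
the open one. -/
def HoloSpace (R : Fin m → ℝ) : Type := ↥(holoSubmodule R)

noncomputable instance instAddCommGroup (R : Fin m → ℝ) : AddCommGroup (HoloSpace R) :=
  (holoSubmodule R).addCommGroup

noncomputable instance instModule (R : Fin m → ℝ) : Module ℂ (HoloSpace R) :=
  (holoSubmodule R).module

/-- Decay rates `0 ≤ λ_l < 1` and radii `R_l > λ_l / (1 - λ_l)`. -/
structure Admissible (lam R : Fin m → ℝ) : Prop where
  nonneg : ∀ l, 0 ≤ lam l
  lt_one : ∀ l, lam l < 1
  radius : ∀ l, lam l / (1 - lam l) < R l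

/-- The affine map `z ↦ Λ z + s λ`, where `Λ` is the diagonal matrix with entries `λ_l`. -/
def affine (lam : Fin m → ℝ) (s : ℝ) (z : Fin m → ℂ) : Fin m → ℂ :=
  fun l => (lam l : ℂ) * z l + (s : ℂ) * (lam l : ℂ)

theorem affine_mem {lam R : Fin m → ℝ} (h : Admissible lam R) {s : ℝ} (hs : |s| ≤ 1)
    {z : Fin m → ℂ} (hz : z ∈ closedPolydisc R) : affine lam s z ∈ polydisc R := by
  intro l
  have h0 := h.nonneg l
  have h1 := h.lt_one l
  have hr := h.radius l
  rw [div_lt_iff₀ (by linarith)] at hr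
  have hzl := hz l
  calc ‖affine lam s z l‖ ≤ ‖(lam l : ℂ) * z l‖ + ‖(s : ℂ) * (lam l : ℂ)‖ := norm_add_le _ _
    _ = lam l * ‖z l‖ + |s| * lam l := by
        simp [abs_of_nonneg h0]
    _ ≤ lam l * R l + 1 * lam l := by gcongr
    _ < R l := by linarith

theorem polydisc_subset (R : Fin m → ℝ) : polydisc R ⊆ closedPolydisc R :=
  fun _ hz l => (hz l).le

theorem continuous_affine (lam : Fin m → ℝ) (s : ℝ) : Continuous (affine lam s) := by
  unfold affine; fun_prop

theorem differentiable_affine (lam : Fin m → ℝ) (s : ℝ) : Differentiable ℂ (affine lam s) := by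
  unfold affine; fun_prop

/-- `z ↦ Λ z + s λ` as a map of the closed polydisc into itself, for `|s| ≤ 1`. -/
def branch {lam R : Fin m → ℝ} (h : Admissible lam R) (s : ℝ) (hs : |s| ≤ 1) :
    C(closedPolydisc R, closedPolydisc R) where
  toFun z := ⟨affine lam s z, polydisc_subset R (affine_mem h hs z.2)⟩
  continuous_toFun :=
    ((continuous_affine lam s).comp continuous_subtype_val).subtype_mk _

/-- The weight `exp (c J·z)`. -/
noncomputable def weight (J : Fin m → ℝ) (c : ℂ) (z : Fin m → ℂ) : ℂ :=
  Complex.exp (c * ∑ l, (J l : ℂ) * z l)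

theorem continuous_weight (J : Fin m → ℝ) (c : ℂ) : Continuous (weight J c) := by
  unfold weight; fun_prop

theorem differentiable_weight (J : Fin m → ℝ) (c : ℂ) : Differentiable ℂ (weight J c) := by
  unfold weight; fun_prop

/-- The weighted composition operator `f ↦ exp (c J·z) f (Λ z + s λ)` on `B(D)`. -/
noncomputable def weightedComp {lam R : Fin m → ℝ} (J : Fin m → ℝ) (h : Admissible lam R)
    (c : ℂ) (s : ℝ) (hs : |s| ≤ 1) : Module.End ℂ (HoloSpace R) where
  toFun f := ⟨⟨fun z => weight J c z * f.1 (branch h s hs z),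
      ((continuous_weight J c).comp continuous_subtype_val).mul
        (f.1.continuous.comp (branch h s hs).continuous)⟩, by
    obtain ⟨f, g, hg, e⟩ := f
    refine ⟨fun z => weight J c z * g (affine lam s z),
      (differentiable_weight J c).differentiableOn.mul
        (hg.comp (differentiable_affine lam s).differentiableOn
          fun z hz => affine_mem h hs (polydisc_subset R hz)), fun z hz => ?_⟩
    have := e (branch h s hs z) (affine_mem h hs z.2)
    change weight J c z * g (affine lam s z) = weight J c z * f (branch h s hs z)
    rw [← this]; rfl⟩
  map_add' f₁ f₂ := Subtype.ext (ContinuousMap.ext fun _ => mul_add _ _ _)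
  map_smul' a f := Subtype.ext (ContinuousMap.ext fun _ => mul_left_comm _ _ _)

/-- The Ruelle transfer operator
`(L_β f)(z) = exp (β J·z) f (Λ z + λ) + exp (-β J·z) f (Λ z - λ)` on `B(D)`. -/
noncomputable def ruelle {lam R : Fin m → ℝ} (J : Fin m → ℝ) (h : Admissible lam R) (β : ℂ) :
    Module.End ℂ (HoloSpace R) :=
  weightedComp J h β 1 (by simp) + weightedComp J h (-β) (-1) (by simp)

/-- The map `z ↦ -z` of the closed polydisc. -/
def negMap (R : Fin m → ℝ) : C(closedPolydisc R, closedPolydisc R) where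
  toFun z := ⟨-z, fun l => by simpa using z.2 l⟩
  continuous_toFun := (continuous_subtype_val.neg).subtype_mk _

/-- The reflection `(P f)(z) = f (-z)` on `B(D)`. -/
noncomputable def reflection (R : Fin m → ℝ) : Module.End ℂ (HoloSpace R) where
  toFun f := ⟨f.1.comp (negMap R), by
    obtain ⟨f, g, hg, e⟩ := f
    have hn : ∀ z ∈ polydisc R, -z ∈ polydisc R := fun z hz l => by simpa using hz l
    refine ⟨fun z => g (-z),
      hg.comp (differentiable_id.neg : Differentiable ℂ fun z : Fin m → ℂ => -z).differentiableOn hn,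
      fun z hz => ?_⟩
    exact e (negMap R z) (hn z hz)⟩
  map_add' _ _ := rfl
  map_smul' _ _ := rfl

/-- The functions in `B(D)` with `P f = ε f`: the even ones for `ε = 1`, the odd ones for
`ε = -1`. -/
noncomputable def paritySpace (R : Fin m → ℝ) (ε : ℂ) : Submodule ℂ (HoloSpace R) :=
  Module.End.eigenspace (reflection R) ε

/-- The algebraic multiplicity of `μ` as an eigenvalue of `L_β` on the functions of parity `ε`:
the dimension of the space of generalized eigenfunctions `f` with `P f = ε f`. -/
noncomputable def parityMultiplicity {lam R : Fin m → ℝ} (J : Fin m → ℝ) (h : Admissible lam R)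
    (β ε μ : ℂ) : Cardinal :=
  Module.rank ℂ
    ↥(Module.End.maxGenEigenspace (ruelle J h β) μ ⊓
      paritySpace R ε)

/-- For every real `β` the numbers `ρ_α(β)`, `α ∈ ℕ^m`, that are different from `0` are precisely
the nonzero eigenvalues of `L_β` of parity `ε`, each listed as often as its algebraic
multiplicity says. -/
def ListsEigenvalues {lam R : Fin m → ℝ} (J : Fin m → ℝ) (h : Admissible lam R) (ε : ℂ)
    (ρ : (Fin m → ℕ) → ℝ → ℝ) : Prop :=
  ∀ (β : ℝ) (μ : ℂ), μ ≠ 0 →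
    Cardinal.mk {α : Fin m → ℕ // (ρ α β : ℂ) = μ} = parityMultiplicity J h (β : ℂ) ε μ

/-- The monomial `λ^α`. -/
def monomial (lam : Fin m → ℝ) (α : Fin m → ℕ) : ℝ := ∏ l, lam l ^ α l

/-- The length `|α|` of a multi-index. -/
def degree (α : Fin m → ℕ) : ℕ := ∑ l, α l

/-- For every `N`, eventually along `F`, some `N` multi-indices with the largest values of `λ^α`
label `N` leading (that is, largest in modulus) members of the list `ρ_α(β)`. -/
def LabelsLeading (lam : Fin m → ℝ) (ρ : (Fin m → ℕ) → ℝ → ℝ) (F : Filter ℝ) : Prop :=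
  ∀ N : ℕ, ∀ᶠ β in F, ∃ A : Finset (Fin m → ℕ), A.card = N ∧
    ∀ α ∈ A, ∀ α' ∉ A, monomial lam α' ≤ monomial lam α ∧ |ρ α' β| ≤ |ρ α β|

/-- `J·(1 - Λ)⁻¹ λ`. -/
noncomputable def ferroExponent (J lam : Fin m → ℝ) : ℝ := ∑ l, J l * (lam l / (1 - lam l))

/-- `J·(1 + Λ)⁻¹ λ`. -/
noncomputable def antiferroExponent (J lam : Fin m → ℝ) : ℝ :=
  ∑ l, J l * (lam l / (1 + lam l))

end KacBaker

namespace KacBaker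

/-! ### Spectral theory of the operators `∑ dᵢ |xᵢ⟩⟨xᵢ|`. -/

section

section Spectral

variable {H : Type} [NormedAddCommGroup H] [InnerProductSpace ℂ H] [CompleteSpace H] {I : Type}

open InnerProductSpace

/-- A compact symmetric operator has a Hilbert basis of eigenvectors. -/
theorem exists_eigenbasis {T : H →L[ℂ] H} (hc : IsCompactOperator T)
    (hs : (T : H →ₗ[ℂ] H).IsSymmetric) :
    ∃ (K : Type) (b : HilbertBasis K ℂ H) (μ : K → ℝ), ∀ k, T (b k) = (μ k : ℂ) • b k := by
  classical
  have hcl : ∀ μ : ℂ, CompleteSpace (Module.End.eigenspace (T : H →ₗ[ℂ] H) μ) := by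
    intro μ
    have : IsClosed ((Module.End.eigenspace (T : H →ₗ[ℂ] H) μ : Submodule ℂ H) : Set H) := by
      have : ((Module.End.eigenspace (T : H →ₗ[ℂ] H) μ : Submodule ℂ H) : Set H)
          = {y | T y = μ • y} := by
        ext y; simp
      rw [this]
      exact isClosed_eq T.continuous (continuous_const_smul μ)
    exact this.completeSpace_coe
  choose w b hb using fun μ : ℂ =>
    exists_hilbertBasis ℂ (Module.End.eigenspace (T : H →ₗ[ℂ] H) μ)
  have horth := hs.orthogonalFamily_eigenspaces.orthonormal_sigma_orthonormal
    (v_family := fun μ => (b μ : w μ → _)) (fun μ => (b μ).orthonormal)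
  set v : (Σ μ : ℂ, w μ) → H := fun a =>
    ((b a.1 a.2 : Module.End.eigenspace (T : H →ₗ[ℂ] H) a.1) : H)
    with hv
  have horth' : Orthonormal ℂ v := horth
  -- A vector orthogonal to the chosen bases is orthogonal to every eigenspace, by expansion there;
  -- eigenspaces of a compact symmetric operator have trivial joint orthogonal complement.
  have hbot : (Submodule.span ℂ (Set.range v))ᗮ = ⊥ := by
    rw [eq_bot_iff, ← ContinuousLinearMap.orthogonalComplement_iSup_eigenspaces_eq_bot hc hs]
    intro y hy
    rw [Submodule.mem_orthogonal] at hy ⊢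
    intro u hu
    induction hu using Submodule.iSup_induction' with
    | mem μ u hu =>
      have h1 := ((b μ).hasSum_repr ⟨u, hu⟩).mapL
        ((Module.End.eigenspace (T : H →ₗ[ℂ] H) μ).subtypeL)
      have h2 := h1.mapL (innerSL ℂ y)
      have h3 : ∀ k, (innerSL ℂ y) ((Module.End.eigenspace (T : H →ₗ[ℂ] H) μ).subtypeL
          ((b μ).repr ⟨u, hu⟩ k • b μ k)) = 0 := by
        intro k
        have := hy (v ⟨μ, k⟩) (Submodule.subset_span ⟨_, rfl⟩)
        simp only [map_smul, Submodule.subtypeL_apply, innerSL_apply_apply, smul_eq_mul]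
        rw [inner_eq_zero_symm.1 this, mul_zero]
      simp only [h3] at h2
      have := h2.unique hasSum_zero
      exact inner_eq_zero_symm.1 this
    | zero => simp
    | add a b _ _ ha hb => rw [inner_add_left, ha, hb, add_zero]
  refine ⟨_, HilbertBasis.mkOfOrthogonalEqBot horth' hbot, fun a => a.1.re, fun a => ?_⟩
  have hmem := (b a.1 a.2).2
  rw [Module.End.mem_eigenspace_iff] at hmem
  have hne : ((b a.1 a.2 : Module.End.eigenspace (T : H →ₗ[ℂ] H) a.1) : H) ≠ 0 :=
    horth.ne_zero a
  have hreal := hs.conj_eigenvalue_eq_self (Module.End.hasEigenvalue_of_hasEigenvector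
    ⟨(b a.1 a.2).2, hne⟩)
  have hre : ((a.1.re : ℝ) : ℂ) = a.1 := Complex.conj_eq_iff_re.1 hreal
  rw [HilbertBasis.coe_mkOfOrthogonalEqBot, hre]
  exact hmem

/-- The operator `∑ dᵢ |xᵢ⟩⟨xᵢ|`. -/
noncomputable def frameOp (d : I → ℝ) (x : I → H) : H →L[ℂ] H :=
  ∑' i, (d i : ℂ) • rankOne ℂ (x i) (x i)

variable {d : I → ℝ} {x : I → H}

theorem summable_frameOp (hd : Summable fun i => |d i|) (hx : ∀ i, ‖x i‖ ≤ 2) :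
    Summable fun i => (d i : ℂ) • rankOne ℂ (x i) (x i) := by
  refine Summable.of_norm_bounded (hd.mul_left 4) fun i => ?_
  have := hx i
  have h0 := norm_nonneg (x i)
  rw [norm_smul, norm_rankOne, Complex.norm_real, Real.norm_eq_abs]
  have : ‖x i‖ * ‖x i‖ ≤ 4 := by nlinarith
  nlinarith [abs_nonneg (d i)]

theorem hasSum_frameOp (hd : Summable fun i => |d i|) (hx : ∀ i, ‖x i‖ ≤ 2) (y : H) :
    HasSum (fun i => ((d i : ℂ) * inner ℂ (x i) y) • x i) (frameOp d x y) := by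
  have := (summable_frameOp hd hx).hasSum.mapL (ContinuousLinearMap.apply ℂ H y)
  simpa [mul_smul, frameOp] using this

theorem isCompactOperator_frameOp (hd : Summable fun i => |d i|) (hx : ∀ i, ‖x i‖ ≤ 2) :
    IsCompactOperator (frameOp d x) := by
  refine isCompactOperator_of_tendsto (l := atTop) (summable_frameOp hd hx).hasSum
    (Eventually.of_forall fun s => ?_)
  induction s using Finset.cons_induction with
  | empty => simpa using isCompactOperator_zero
  | cons a s ha ih =>
    rw [Finset.sum_cons]
    refine IsCompactOperator.add ?_ ih
    refine IsCompactOperator.smul (f := (rankOne ℂ (x a) (x a) : H → H)) ?_ (d a : ℂ)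
    have : (rankOne ℂ (x a) (x a) : H → H) =
        (ContinuousLinearMap.toSpanSingleton ℂ (x a)) ∘ (innerSL ℂ (x a)) := by
      ext y; simp
    rw [this]
    exact (isCompactOperator_of_locallyCompactSpace_dom
      (innerSL ℂ (x a))).clm_comp (ContinuousLinearMap.toSpanSingleton ℂ (x a))

theorem isSymmetric_frameOp (hd : Summable fun i => |d i|) (hx : ∀ i, ‖x i‖ ≤ 2) :
    ((frameOp d x : H →L[ℂ] H) : H →ₗ[ℂ] H).IsSymmetric := by
  intro y z
  have h1 := (hasSum_frameOp hd hx z).mapL (innerSL ℂ y)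
  have h2 := (hasSum_frameOp hd hx y).mapL (innerSL ℂ z)
  have h3 := Complex.hasSum_conj'.2 h2
  simp only [innerSL_apply_apply, inner_smul_right, map_mul, inner_conj_symm,
      Complex.conj_ofReal] at h1 h3
  change inner ℂ (frameOp d x y) z = inner ℂ y (frameOp d x z)
  have e : (fun i => (d i : ℂ) * inner ℂ (x i) z * inner ℂ y (x i)) =
      fun i => (d i : ℂ) * inner ℂ y (x i) * inner ℂ (x i) z := by
    funext i; ring
  rw [e] at h1
  exact h3.unique h1

variable {K : Type}

theorem hasSum_norm_inner_sq {H : Type} [NormedAddCommGroup H] [InnerProductSpace ℂ H]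
    (b : HilbertBasis K ℂ H) (y : H) :
    HasSum (fun k => ‖inner ℂ (b k) y‖ ^ 2) (‖y‖ ^ 2) := by
  have h := Complex.hasSum_re (b.hasSum_inner_mul_inner y y)
  have e : (inner ℂ y y : ℂ).re = ‖y‖ ^ 2 := by
    rw [inner_self_eq_norm_sq_to_K]; norm_cast
  rw [e] at h
  convert h using 1
  funext k
  rw [← inner_conj_symm y (b k), mul_comm, Complex.mul_conj, Complex.normSq_eq_norm_sq,
    Complex.ofReal_re]

/-- Parseval reduces a norm comparison to coordinates. It serves to bound the part of an approximate
eigenvector that lies outside a spectral window. -/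
theorem norm_le_of_inner_le {H : Type} [NormedAddCommGroup H] [InnerProductSpace ℂ H]
    (b : HilbertBasis K ℂ H) {y z : H} {a : ℝ} (ha : 0 ≤ a)
    (h : ∀ k, a * ‖inner ℂ (b k) y‖ ≤ ‖inner ℂ (b k) z‖) : a * ‖y‖ ≤ ‖z‖ := by
  have h1 := hasSum_le (fun k => by
    have := pow_le_pow_left₀ (by positivity) (h k) 2
    rwa [mul_pow] at this) ((hasSum_norm_inner_sq b y).mul_left (a ^ 2)) (hasSum_norm_inner_sq b z)
  rw [← mul_pow] at h1
  exact le_of_sq_le_sq h1 (norm_nonneg z)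

/-- A trace bound: `μ k = ⟨b k, T b k⟩ = ∑ᵢ dᵢ |⟨b k, xᵢ⟩|²`; exchange the two sums and apply
Bessel's inequality to each `xᵢ`. -/
theorem sum_abs_eigenvalue_le (hd : Summable fun i => |d i|) (hx : ∀ i, ‖x i‖ ≤ 2) {b : K → H}
    (hb : Orthonormal ℂ b) {μ : K → ℝ} (hT : ∀ k, frameOp d x (b k) = (μ k : ℂ) • b k)
    (F : Finset K) : ∑ k ∈ F, |μ k| ≤ ∑' i, |d i| * ‖x i‖ ^ 2 := by
  have hsx : Summable fun i => |d i| * ‖x i‖ ^ 2 := by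
    refine Summable.of_nonneg_of_le (fun i => by positivity) (fun i => ?_) (hd.mul_right 4)
    have := hx i
    have h0 := norm_nonneg (x i)
    gcongr
    nlinarith
  have key : ∀ k, HasSum (fun i => d i * ‖inner ℂ (b k) (x i)‖ ^ 2) (μ k) := by
    intro k
    have h1 := Complex.hasSum_re ((hasSum_frameOp hd hx (b k)).mapL (innerSL ℂ (b k)))
    rw [hT k] at h1
    simp only [innerSL_apply_apply, inner_smul_right, inner_self_eq_norm_sq_to_K, hb.1 k] at h1
    convert h1 using 1
    · funext i
      rw [mul_assoc, ← inner_conj_symm (x i), mul_comm ((starRingEnd ℂ) _), Complex.mul_conj,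
        Complex.normSq_eq_norm_sq]
      norm_cast
    · simp
  have hle : ∀ i k, |d i| * ‖inner ℂ (b k) (x i)‖ ^ 2 ≤ |d i| * ‖x i‖ ^ 2 := by
    intro i k
    gcongr
    calc _ ≤ ‖b k‖ * ‖x i‖ := norm_inner_le_norm _ _
      _ = ‖x i‖ := by rw [hb.1 k, one_mul]
  have hs : ∀ k, Summable fun i => |d i| * ‖inner ℂ (b k) (x i)‖ ^ 2 := fun k =>
    Summable.of_nonneg_of_le (fun i => by positivity) (fun i => hle i k) hsx
  calc ∑ k ∈ F, |μ k| ≤ ∑ k ∈ F, ∑' i, |d i| * ‖inner ℂ (b k) (x i)‖ ^ 2 := by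
        refine Finset.sum_le_sum fun k _ => ?_
        rw [← (key k).tsum_eq]
        have e : ∀ i, |d i| * ‖inner ℂ (b k) (x i)‖ ^ 2 = ‖d i * ‖inner ℂ (b k) (x i)‖ ^ 2‖ := by
          intro i
          rw [Real.norm_eq_abs, abs_mul, abs_of_nonneg (sq_nonneg ‖_‖)]
        simp only [e]
        exact norm_tsum_le_tsum_norm (by simpa only [e] using hs k)
    _ = ∑' i, ∑ k ∈ F, |d i| * ‖inner ℂ (b k) (x i)‖ ^ 2 :=
        (Summable.tsum_finsetSum fun k _ => hs k).symm
    _ ≤ ∑' i, |d i| * ‖x i‖ ^ 2 := by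
        refine Summable.tsum_le_tsum (fun i => ?_) (summable_sum fun k _ => hs k) hsx
        rw [← Finset.mul_sum]
        gcongr
        exact hb.sum_inner_products_le (x i)

/-- For a nonzero value, the dimension of the eigenspace counts the members of the eigenbasis. -/
theorem rank_eigenspace_eq {H : Type} [NormedAddCommGroup H] [InnerProductSpace ℂ H]
    {T : H →L[ℂ] H} (hs : (T : H →ₗ[ℂ] H).IsSymmetric)
    (b : HilbertBasis K ℂ H) {μ : K → ℝ} (hT : ∀ k, T (b k) = (μ k : ℂ) • b k)
    (hμ : Summable fun k => |μ k|) {c : ℂ} (hc : c ≠ 0) :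
    Module.rank ℂ (Module.End.eigenspace (T : H →ₗ[ℂ] H) c) = Cardinal.mk {k // (μ k : ℂ) = c} := by
  classical
  have hfin : {k | (μ k : ℂ) = c}.Finite := by
    have h0 : ∀ᶠ k in cofinite, |μ k| < ‖c‖ :=
      hμ.tendsto_cofinite_zero.eventually_lt_const (norm_pos_iff.2 hc)
    refine (eventually_cofinite.1 h0).subset fun k hk => ?_
    have hk : (μ k : ℂ) = c := hk
    change ¬ _
    rw [← hk, Complex.norm_real, Real.norm_eq_abs]
    exact lt_irrefl _
  -- By symmetry an eigenvector for `c` has no component along `b k` when `μ k ≠ c`, and only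
  -- finitely many `k` remain.
  have hE : Module.End.eigenspace (T : H →ₗ[ℂ] H) c =
      Submodule.span ℂ (Set.range fun k : {k // (μ k : ℂ) = c} => b k) := by
    apply le_antisymm
    · intro y hy
      rw [Module.End.mem_eigenspace_iff] at hy
      have h0 : ∀ k, (μ k : ℂ) ≠ c → inner ℂ (b k) y = 0 := by
        intro k hk
        have h1 := hs (b k) y
        rw [hy] at h1
        change inner ℂ (T (b k)) y = _ at h1
        rw [hT k, inner_smul_left, inner_smul_right, Complex.conj_ofReal] at h1
        have : ((μ k : ℂ) - c) * inner ℂ (b k) y = 0 := by rw [sub_mul, h1, sub_self]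
        exact (mul_eq_zero.1 this).resolve_left (sub_ne_zero.2 hk)
      have h2 := b.hasSum_repr y
      have h3 : HasSum (fun k => b.repr y k • b k)
          (∑ k ∈ hfin.toFinset, b.repr y k • b k) := by
        refine hasSum_sum_of_ne_finset_zero fun k hk => ?_
        rw [b.repr_apply_apply, h0 k (by simpa using hk), zero_smul]
      rw [h2.unique h3]
      refine Submodule.sum_mem _ fun k hk => Submodule.smul_mem _ _ (Submodule.subset_span ?_)
      exact ⟨⟨k, by simpa using hk⟩, rfl⟩
    · rw [Submodule.span_le]
      rintro _ ⟨k, rfl⟩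
      rw [SetLike.mem_coe, Module.End.mem_eigenspace_iff]
      have := hT k
      rwa [k.2] at this
  rw [hE]
  have hli : LinearIndependent ℂ fun k : {k // (μ k : ℂ) = c} => b k :=
    (b.orthonormal.comp _ Subtype.val_injective).linearIndependent
  rw [rank_span hli, Cardinal.mk_range_eq _ hli.injective]

/-- Approximate eigenvectors that are almost orthonormal are matched with true eigenvalues. -/
theorem exists_matching {T : H →L[ℂ] H} (hs : (T : H →ₗ[ℂ] H).IsSymmetric)
    (b : HilbertBasis K ℂ H) {μ : K → ℝ} (hT : ∀ k, T (b k) = (μ k : ℂ) • b k)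
    (hx : ∀ i, ‖x i‖ ≤ 2) [DecidableEq I] (A : Finset I) {a η : ℝ} (ha : 0 < a) (hη : 0 ≤ η)
    (hfin : ∀ i ∈ A, {k | |μ k - d i| < a}.Finite)
    (hgram : ∀ i ∈ A, ∀ j ∈ A, ‖inner ℂ (x i) (x j) - (if i = j then 1 else 0)‖ ≤ η)
    (hquasi : ∀ i ∈ A, ‖T (x i) - (d i : ℂ) • x i‖ ≤ η)
    (hsmall : A.card * η + 2 * (A.card * (η / a)) < 1) :
    ∃ f : A → K, Function.Injective f ∧ ∀ i, |μ (f i) - d i| < a := by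
  classical
  let t : A → Finset K := fun i => (hfin i i.2).toFinset
  suffices h : ∃ f : A → K, Function.Injective f ∧ ∀ i, f i ∈ t i by
    obtain ⟨f, hf, h⟩ := h
    exact ⟨f, hf, fun i => by simpa [t] using h i⟩
  -- Hall's marriage theorem: it suffices that the windows around the `d i`, `i ∈ S`, contain at
  -- least `|S|` eigenvalues in total.
  rw [← Finset.all_card_le_biUnion_card_iff_exists_injective]
  intro S
  by_contra! hlt
  set U := S.biUnion t
  let M : (S → ℂ) →ₗ[ℂ] (U → ℂ) :=
    { toFun := fun c k => ∑ i : S, c i * inner ℂ (b k) (x i)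
      map_add' := fun c c' => by
        funext k; simp [add_mul, Finset.sum_add_distrib]
      map_smul' := fun c c' => by
        funext k; simp [Finset.mul_sum, mul_assoc] }
  -- With fewer eigenvalues than labels, some nontrivial combination of the `x i` is orthogonal to
  -- all eigenvectors in the windows.
  obtain ⟨c, hc, hc0⟩ : ∃ c, M c = 0 ∧ c ≠ 0 := by
    have h1 : LinearMap.ker M ≠ ⊥ := LinearMap.ker_ne_bot_of_finrank_lt (by simpa using hlt)
    obtain ⟨c, h1, h2⟩ := Submodule.exists_mem_ne_zero_of_ne_bot h1
    exact ⟨c, h1, h2⟩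
  have hne : Nonempty S := by
    by_contra h
    rw [not_nonempty_iff] at h
    exact hc0 (Subsingleton.elim _ _)
  obtain ⟨j, -, hj⟩ := Finset.exists_max_image (Finset.univ : Finset S) (fun i => ‖c i‖)
    Finset.univ_nonempty
  have hcj : 0 < ‖c j‖ := by
    by_contra! h
    refine hc0 (funext fun i => norm_le_zero_iff.1 ((hj i (Finset.mem_univ i)).trans h))
  have hcard : (Fintype.card S : ℝ) ≤ A.card := by
    have : S.card ≤ A.card := by simpa using Finset.card_le_univ S
    simpa using this
  -- The part of `x i` outside the windows. There `|μ k - d i| ≥ a`, so the residual `η` of the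
  -- approximate eigenvector bounds it by `η / a`.
  let y : S → H := fun i => x i - ∑ k : U, inner ℂ (b k) (x i) • b k
  have hy : ∀ i, ‖y i‖ ≤ η / a := by
    intro i
    rw [le_div_iff₀ ha, mul_comm]
    refine (norm_le_of_inner_le b ha.le fun k => ?_).trans (hquasi i i.1.2)
    have h1 : inner ℂ (b k) (T (x i) - (d i : ℂ) • x i) =
        ((μ k - d i : ℝ) : ℂ) * inner ℂ (b k) (x i) := by
      have h2 := hs (b k) (x i)
      change inner ℂ (T (b k)) (x i) = inner ℂ (b k) (T (x i)) at h2
      rw [inner_sub_right, ← h2, hT k, inner_smul_left, inner_smul_right, Complex.conj_ofReal]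
      push_cast; ring
    rw [h1, norm_mul, Complex.norm_real, Real.norm_eq_abs]
    have horth := orthonormal_iff_ite.1 b.orthonormal
    by_cases hk : k ∈ U
    · have : inner ℂ (b k) (y i) = 0 := by
        simp only [y, inner_sub_right, inner_sum, inner_smul_right, horth]
        rw [Finset.sum_eq_single ⟨k, hk⟩]
        · simp
        · intro l _ hl
          rw [if_neg, mul_zero]
          rintro rfl; exact hl rfl
        · simp
      rw [this, norm_zero, mul_zero]; positivity
    · have : inner ℂ (b k) (y i) = inner ℂ (b k) (x i) := by
        simp only [y, inner_sub_right, inner_sum, inner_smul_right, horth]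
        rw [Finset.sum_eq_zero, sub_zero]
        intro l _
        rw [if_neg, mul_zero]
        rintro rfl; exact hk l.2
      rw [this]
      gcongr
      by_contra! hlt
      exact hk (Finset.mem_biUnion.2 ⟨i, i.2, by simpa [t] using hlt⟩)
  -- The window components of the combination cancel by the choice of `c`, so the combination is
  -- small.
  have hX : ∑ i, c i • x i = ∑ i, c i • y i := by
    simp only [y, smul_sub, Finset.sum_sub_distrib, Finset.smul_sum, smul_smul]
    rw [Finset.sum_comm, eq_comm, sub_eq_self]
    refine Finset.sum_eq_zero fun k _ => ?_
    rw [← Finset.sum_smul]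
    have : (∑ i : S, c i * inner ℂ (b k) (x i)) = 0 := congrFun hc k
    rw [this, zero_smul]
  have hXle : ‖∑ i, c i • x i‖ ≤ A.card * (‖c j‖ * (η / a)) := by
    rw [hX]
    refine (norm_sum_le _ _).trans ?_
    calc ∑ i, ‖c i • y i‖ ≤ ∑ i : S, ‖c j‖ * (η / a) := by
          refine Finset.sum_le_sum fun i hi => ?_
          rw [norm_smul]
          exact mul_le_mul (hj i hi) (hy i) (norm_nonneg _) (norm_nonneg _)
      _ = (Fintype.card S : ℝ) * (‖c j‖ * (η / a)) := by simp
      _ ≤ _ := by gcongr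
  have hin : inner ℂ (x j) (∑ i, c i • x i) - c j =
      ∑ i, c i * (inner ℂ (x j) (x i) - (if (j : I) = i then 1 else 0)) := by
    simp only [inner_sum, inner_smul_right, mul_sub, Finset.sum_sub_distrib]
    congr 1
    rw [Finset.sum_eq_single j]
    · simp
    · intro i _ hi
      rw [if_neg, mul_zero]
      intro h; exact hi (Subtype.ext (Subtype.ext h.symm))
    · simp
  have h1 : ‖inner ℂ (x j) (∑ i, c i • x i) - c j‖ ≤ A.card * (‖c j‖ * η) := by
    rw [hin]
    refine (norm_sum_le _ _).trans ?_
    calc _ ≤ ∑ i : S, ‖c j‖ * η := by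
          refine Finset.sum_le_sum fun i hi => ?_
          rw [norm_mul]
          exact mul_le_mul (hj i hi) (hgram j j.1.2 i i.1.2) (norm_nonneg _) (norm_nonneg _)
      _ = (Fintype.card S : ℝ) * (‖c j‖ * η) := by simp
      _ ≤ _ := by gcongr
  have h2 : ‖inner ℂ (x j) (∑ i, c i • x i)‖ ≤ 2 * (A.card * (‖c j‖ * (η / a))) :=
    (norm_inner_le_norm _ _).trans (mul_le_mul (hx _) hXle (norm_nonneg _) (by norm_num))
  -- Pairing with `x j`, where `|c j|` is maximal, almost recovers `c j` because the Gram matrix is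
  -- almost the identity; `hsmall` makes this contradictory.
  have h3 : ‖c j‖ ≤ 2 * (A.card * (‖c j‖ * (η / a))) + A.card * (‖c j‖ * η) := by
    calc ‖c j‖ = ‖inner ℂ (x j) (∑ i, c i • x i) -
          (inner ℂ (x j) (∑ i, c i • x i) - c j)‖ := by rw [sub_sub_cancel]
      _ ≤ _ := (norm_sub_le _ _).trans (add_le_add h2 h1)
  have h4 : ‖c j‖ * (A.card * η + 2 * (A.card * (η / a))) < ‖c j‖ * 1 := by gcongr
  linarith

end Spectral

end

/-! ### Listing eigenvalues by labels, and closeness for almost orthonormal frames. -/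

section

/-- A countable family of nonzero values can be listed by the members of an infinite set of labels,
with prescribed labels for finitely many of them. -/
theorem exists_listing {I K : Type} (μ : K → ℝ) (hc : {k | μ k ≠ 0}.Countable) {D : Set I}
    (hD : D.Infinite) (A : Finset I) (f : A → K) (hf : Function.Injective f) :
    ∃ r : I → ℝ, (∀ i : A, r i = μ (f i)) ∧ (∀ i ∉ D, i ∉ A → r i = 0) ∧
      (∀ i ∉ A, r i = 0 ∨ ∃ k, k ∉ Set.range f ∧ r i = μ k) ∧
      ∀ c : ℂ, c ≠ 0 → Cardinal.mk {i // (r i : ℂ) = c} = Cardinal.mk {k // (μ k : ℂ) = c} := by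
  classical
  have hcount : Countable {k | μ k ≠ 0} := hc.to_subtype
  have hinf : Infinite ↥(D \ (A : Set I)) := (hD.sdiff A.finite_toSet).to_subtype
  obtain ⟨e, he⟩ := hcount.exists_injective_nat
  let g : {k | μ k ≠ 0} → I := fun k => (Infinite.natEmbedding ↥(D \ (A : Set I)) (e k) : I)
  have hg : Function.Injective g := fun k l h =>
    he ((Infinite.natEmbedding _).injective (Subtype.ext h))
  have hgD : ∀ k, g k ∈ D ∧ g k ∉ A := fun k => (Infinite.natEmbedding ↥(D \ (A : Set I)) (e k)).2
  -- Values hit by `f` receive their prescribed label, all others an unused label in `D \ A`; labels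
  -- not reached will carry the value `0`.
  let j : {k | μ k ≠ 0} → I := fun k => if h : ∃ i, f i = k then (h.choose : I) else g k
  have j1 : ∀ (k : {k | μ k ≠ 0}) (i : A), f i = k → j k = i := by
    intro k i hi
    have h : ∃ i, f i = k := ⟨i, hi⟩
    simp only [j, dif_pos h]
    exact congrArg _ (hf (h.choose_spec.trans hi.symm))
  have j2 : ∀ (k : {k | μ k ≠ 0}), (k : K) ∉ Set.range f → j k = g k := fun k hk => dif_neg hk
  have hj : Function.Injective j := by
    intro k l h
    by_cases hk : (k : K) ∈ Set.range f <;> by_cases hl : (l : K) ∈ Set.range f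
    · obtain ⟨i, hi⟩ := hk
      obtain ⟨i', hi'⟩ := hl
      rw [j1 k i hi, j1 l i' hi'] at h
      apply Subtype.ext
      rw [← hi, ← hi', Subtype.ext h]
    · obtain ⟨i, hi⟩ := hk
      rw [j1 k i hi, j2 l hl] at h
      exact absurd i.2 (h ▸ (hgD l).2)
    · obtain ⟨i, hi⟩ := hl
      rw [j1 l i hi, j2 k hk] at h
      exact absurd i.2 (h ▸ (hgD k).2)
    · rw [j2 k hk, j2 l hl] at h
      exact hg h
  let r : I → ℝ := Function.extend j (fun k => μ k) 0
  have r1 : ∀ k, r (j k) = μ k := fun k => hj.extend_apply _ _ k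
  have r0 : ∀ i, (¬ ∃ k, j k = i) → r i = 0 := fun i h => by
    simp only [r]; rw [Function.extend_apply' _ _ _ h]; rfl
  have hcase : ∀ k : {k | μ k ≠ 0}, (∃ i, f i = k ∧ j k = i) ∨
      ((k : K) ∉ Set.range f ∧ j k ∈ D ∧ j k ∉ A) := by
    intro k
    by_cases hk : (k : K) ∈ Set.range f
    · obtain ⟨i, hi⟩ := hk
      exact Or.inl ⟨i, hi, j1 k i hi⟩
    · exact Or.inr ⟨hk, by rw [j2 k hk]; exact hgD k⟩
  refine ⟨r, fun i => ?_, fun i hi hA => ?_, fun i hi => ?_, fun c hc => ?_⟩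
  · by_cases h : μ (f i) = 0
    · rw [h]
      apply r0
      rintro ⟨k, hk⟩
      rcases hcase k with ⟨i', h1, h2⟩ | ⟨-, -, h2⟩
      · have : i' = i := Subtype.ext (h2.symm.trans hk)
        subst this
        exact k.2 (h1 ▸ h)
      · exact h2 (hk ▸ i.2)
    · rw [← j1 ⟨f i, h⟩ i rfl, r1]
  · apply r0
    rintro ⟨k, rfl⟩
    rcases hcase k with ⟨i', h1, h2⟩ | ⟨-, h2, -⟩
    · exact hA (h2 ▸ i'.2)
    · exact hi h2
  · by_cases h : ∃ k, j k = i
    · obtain ⟨k, rfl⟩ := h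
      right
      rcases hcase k with ⟨i', h1, h2⟩ | ⟨h2, -, -⟩
      · exact absurd i'.2 (h2 ▸ hi)
      · exact ⟨k, h2, r1 k⟩
    · exact Or.inl (r0 i h)
  · have hne : ∀ k : {k // (μ k : ℂ) = c}, μ k ≠ 0 := fun k h => hc (by
      rw [← k.2, h, Complex.ofReal_zero])
    symm
    refine Cardinal.mk_congr (Equiv.ofBijective
      (fun k => ⟨j ⟨k, hne k⟩, by rw [r1]; exact k.2⟩) ⟨fun k l h => ?_, fun i => ?_⟩)
    · have := hj (Subtype.ext_iff.1 h)
      exact Subtype.ext (congrArg (fun k : {k | μ k ≠ 0} => (k : K)) this)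
    · by_cases h : ∃ k, j k = i
      · obtain ⟨k, hk⟩ := h
        refine ⟨⟨k, ?_⟩, Subtype.ext hk⟩
        rw [← r1 k, hk]; exact i.2
      · refine absurd ?_ hc
        rw [← i.2, r0 i h, Complex.ofReal_zero]

section Spectral

variable {H : Type} [NormedAddCommGroup H] [InnerProductSpace ℂ H] [CompleteSpace H] {I : Type}
  {d : I → ℝ}

/-- The eigenvalues of `∑ dᵢ |xᵢ⟩⟨xᵢ|` are listed by the labels. -/
def ListsFrameOp (d : I → ℝ) (x : I → H) (r : I → ℝ) : Prop :=
  (∀ i, d i = 0 → r i = 0) ∧ ∀ c : ℂ, c ≠ 0 → Cardinal.mk {i // (r i : ℂ) = c} =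
    Module.rank ℂ (Module.End.eigenspace (frameOp d x : H →ₗ[ℂ] H) c)

theorem exists_eigenvalues_frameOp (hd : Summable fun i => |d i|) {x : I → H}
    (hx : ∀ i, ‖x i‖ ≤ 2) :
    ∃ (K : Type) (b : HilbertBasis K ℂ H) (μ : K → ℝ),
      (∀ k, frameOp d x (b k) = (μ k : ℂ) • b k) ∧ Summable (fun k => |μ k|) := by
  obtain ⟨K, b, μ, h⟩ := exists_eigenbasis (isCompactOperator_frameOp hd hx)
    (isSymmetric_frameOp hd hx)
  exact ⟨K, b, μ, h, summable_of_sum_le (fun k => abs_nonneg _)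
    (sum_abs_eigenvalue_le hd hx b.orthonormal h)⟩

theorem countable_of_summable_abs {K : Type} {μ : K → ℝ} (h : Summable fun k => |μ k|) :
    {k | μ k ≠ 0}.Countable := by
  simpa [Function.support] using h.countable_support

theorem exists_listsFrameOp (hd : Summable fun i => |d i|) (hD : {i | d i ≠ 0}.Infinite)
    {x : I → H} (hx : ∀ i, ‖x i‖ ≤ 2) : ∃ r, ListsFrameOp d x r := by
  obtain ⟨K, b, μ, h, hμ⟩ := exists_eigenvalues_frameOp hd hx
  obtain ⟨r, -, h2, -, h4⟩ := exists_listing μ (countable_of_summable_abs hμ) hD ∅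
    (fun i => absurd i.2 (Finset.notMem_empty _)) (fun i => absurd i.2 (Finset.notMem_empty _))
  refine ⟨r, fun i hi => h2 i (by simpa using hi) (Finset.notMem_empty _), fun c hc => ?_⟩
  rw [h4 c hc, rank_eigenspace_eq (isSymmetric_frameOp hd hx) b h hμ hc]

/-- If the vectors `xᵢ` are almost orthonormal, the eigenvalues of `∑ dᵢ |xᵢ⟩⟨xᵢ|` are uniformly
close to the numbers `dᵢ`. -/
theorem exists_close_listsFrameOp [DecidableEq I] (hd : Summable fun i => |d i|)
    (hD : {i | d i ≠ 0}.Infinite)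
    {δ : ℝ} (hδ : 0 < δ) : ∃ (A : Finset I) (η : ℝ), 0 < η ∧ ∀ x : I → H, (∀ i, ‖x i‖ ≤ 2) →
      (∀ i ∈ A, ∀ j ∈ A, ‖inner ℂ (x i) (x j) - (if i = j then 1 else 0)‖ ≤ η) →
      (∀ i ∈ A, ‖frameOp d x (x i) - (d i : ℂ) • x i‖ ≤ η) →
      (∑' i, |d i| * ‖x i‖ ^ 2 ≤ ∑' i, |d i| + η) →
      ∃ r, ListsFrameOp d x r ∧ ∀ i, |r i - d i| ≤ δ := by
  classical
  -- All but `δ / 8` of the mass `∑ |dᵢ|` is placed in a finite set. Labels with `dᵢ = 0` are then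
  -- discarded, since they must remain unused.
  obtain ⟨A₀, hA₀⟩ : ∃ A₀ : Finset I, ∑' i, |d i| - δ / 8 < ∑ i ∈ A₀, |d i| :=
    (hd.hasSum.eventually_const_lt (by linarith)).exists
  let A := A₀.filter fun i => d i ≠ 0
  have hAsum : ∑ i ∈ A, |d i| = ∑ i ∈ A₀, |d i| := by
    refine Finset.sum_filter_of_ne fun i _ h => by simpa using h
  rw [← hAsum] at hA₀
  have hAne : ∀ i ∈ A, d i ≠ 0 := fun i hi => (Finset.mem_filter.1 hi).2
  -- The bound `2 a ≤ |dᵢ|` keeps the windows away from `0`, so each contains finitely many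
  -- eigenvalues; `A.card * a ≤ δ / 8` bounds the total matching error.
  obtain ⟨a, ha, haA, had⟩ : ∃ a > 0, A.card * a ≤ δ / 8 ∧ (∀ i ∈ A, 2 * a ≤ |d i|) ∧ a ≤ δ := by
    have h1 : ∀ᶠ a : ℝ in 𝓝[>] 0, A.card * a < δ / 8 :=
      ((by fun_prop : Continuous fun a : ℝ => A.card * a).tendsto' 0 0 (by simp)
        |>.mono_left nhdsWithin_le_nhds).eventually_lt_const (by positivity)
    have h2 : ∀ᶠ a : ℝ in 𝓝[>] 0, ∀ i ∈ A, 2 * a < |d i| := by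
      rw [eventually_all_finset]
      intro i hi
      exact ((by fun_prop : Continuous fun a : ℝ => 2 * a).tendsto' 0 0 (by simp)
        |>.mono_left nhdsWithin_le_nhds).eventually_lt_const (abs_pos.2 (hAne i hi))
    have h3 : ∀ᶠ a : ℝ in 𝓝[>] 0, a < δ :=
      ((continuous_id).tendsto' (0 : ℝ) 0 rfl
        |>.mono_left nhdsWithin_le_nhds).eventually_lt_const hδ
    obtain ⟨a, ⟨⟨h1, h2⟩, h3⟩, h4⟩ := (((h1.and h2).and h3).and self_mem_nhdsWithin).exists
    exact ⟨a, h4, h1.le, fun i hi => (h2 i hi).le, h3.le⟩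
  obtain ⟨η, hη, hη1, hη2⟩ : ∃ η > 0, η ≤ δ / 8 ∧ A.card * η + 2 * (A.card * (η / a)) < 1 := by
    have h1 : ∀ᶠ η : ℝ in 𝓝[>] 0, A.card * η + 2 * (A.card * (η / a)) < 1 :=
      ((by fun_prop : Continuous fun η : ℝ => A.card * η + 2 * (A.card * (η / a))).tendsto' 0 0
        (by simp) |>.mono_left nhdsWithin_le_nhds).eventually_lt_const one_pos
    have h3 : ∀ᶠ a : ℝ in 𝓝[>] 0, a < δ / 8 :=
      ((continuous_id).tendsto' (0 : ℝ) 0 rfl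
        |>.mono_left nhdsWithin_le_nhds).eventually_lt_const (by positivity)
    obtain ⟨η, ⟨h1, h3⟩, h4⟩ := ((h1.and h3).and self_mem_nhdsWithin).exists
    exact ⟨η, h4, h3.le, h1⟩
  refine ⟨A, η, hη, fun x hx hgram hquasi htr => ?_⟩
  obtain ⟨K, b, μ, h, hμ⟩ := exists_eigenvalues_frameOp hd hx
  have hfin : ∀ i ∈ A, {k | |μ k - d i| < a}.Finite := by
    intro i hi
    have h0 : ∀ᶠ k in cofinite, |μ k| < a := hμ.tendsto_cofinite_zero.eventually_lt_const ha
    refine (eventually_cofinite.1 h0).subset fun k hk => ?_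
    have hk : |μ k - d i| < a := hk
    have h1 := had.1 i hi
    have h2 := abs_sub_abs_le_abs_sub (d i) (μ k)
    rw [abs_sub_comm] at h2
    change ¬ _
    linarith
  obtain ⟨f, hf, hfa⟩ := exists_matching (isSymmetric_frameOp hd hx) b h hx A ha hη.le hfin hgram
    hquasi hη2
  obtain ⟨r, h1, h2, h3, h4⟩ := exists_listing μ (countable_of_summable_abs hμ) hD A f hf
  refine ⟨r, ⟨fun i hi => h2 i (by simpa using hi) fun hA => hAne i hA hi, fun c hc => ?_⟩,
    fun i => ?_⟩
  · rw [h4 c hc, rank_eigenspace_eq (isSymmetric_frameOp hd hx) b h hμ hc]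
  by_cases hi : i ∈ A
  · have := h1 ⟨i, hi⟩
    simp only at this
    rw [this]
    exact (hfa ⟨i, hi⟩).le.trans had.2
  · have hdi : |d i| ≤ δ / 8 := by
      have := hd.sum_le_tsum (insert i A) (fun j _ => abs_nonneg _)
      rw [Finset.sum_insert hi] at this
      linarith
    -- An unmatched eigenvalue is at most the trace bound minus the matched mass: `δ / 8` each from
    -- the tail of `d`, from `η` and from the matching error.
    have hri : |r i| ≤ 3 * (δ / 8) := by
      rcases h3 i hi with h0 | ⟨k, hk, h0⟩
      · rw [h0, abs_zero]; positivity
      · rw [h0]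
        have hmem : k ∉ Finset.univ.image f := by
          intro hk'
          obtain ⟨i, -, hi⟩ := Finset.mem_image.1 hk'
          exact hk ⟨i, hi⟩
        have h5 := sum_abs_eigenvalue_le hd hx b.orthonormal h (insert k (Finset.univ.image f))
        rw [Finset.sum_insert hmem, Finset.sum_image fun _ _ _ _ h => hf h] at h5
        have h6 : ∑ i ∈ A, |d i| ≤ ∑ i : A, |μ (f i)| + A.card * a := by
          rw [← Finset.sum_coe_sort A]
          have : (A.card : ℝ) * a = ∑ i : A, a := by simp
          rw [this, ← Finset.sum_add_distrib]
          refine Finset.sum_le_sum fun i _ => ?_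
          have h2 := abs_sub_abs_le_abs_sub (d i) (μ (f i))
          rw [abs_sub_comm] at h2
          have := hfa i
          linarith
        linarith
    have := abs_sub (r i) (d i)
    linarith

end Spectral

end

/-! ### Power series in several variables. -/

section

/-- A finite product of absolutely convergent series expands into a series over multi-indices. -/
theorem hasSum_prod_pi {m : ℕ} {f : Fin m → ℕ → ℂ} {a : Fin m → ℂ} {b : Fin m → ℝ}
    (hf : ∀ l, HasSum (f l) (a l)) (hb : ∀ l, HasSum (fun n => ‖f l n‖) (b l)) :
    HasSum (fun α : Fin m → ℕ => ∏ l, f l (α l)) (∏ l, a l) ∧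
      HasSum (fun α : Fin m → ℕ => ‖∏ l, f l (α l)‖) (∏ l, b l) := by
  induction m with
  | zero =>
    have h1 : HasSum (fun α : Fin 0 → ℕ => ∏ l, f l (α l)) (∏ l, a l) := by
      simp
    have h2 : HasSum (fun α : Fin 0 → ℕ => ‖∏ l, f l (α l)‖) (∏ l, b l) := by
      simp
    exact ⟨h1, h2⟩
  | succ m ih =>
    obtain ⟨h1, h2⟩ := ih (f := fun l => f l.succ) (a := fun l => a l.succ)
      (b := fun l => b l.succ) (fun l => hf _) (fun l => hb _)
    obtain ⟨e, he⟩ : ∃ e : ℕ × (Fin m → ℕ) ≃ (Fin (m + 1) → ℕ), ∀ p, e p = Fin.cons p.1 p.2 :=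
      ⟨Fin.consEquiv (fun _ => ℕ), fun _ => rfl⟩
    obtain ⟨g, hg⟩ : ∃ g : (Fin m → ℕ) → ℂ, ∀ α, ∏ l, f l.succ (α l) = g α := ⟨_, fun _ => rfl⟩
    simp only [hg] at h1 h2
    have hs : Summable fun p : ℕ × (Fin m → ℕ) => ‖f 0 p.1 * g p.2‖ :=
      (hb 0).summable.mul_norm h2.summable
    have hfac : ∀ p, ∏ l, f l (e p l) = f 0 p.1 * g p.2 := by
      intro p
      rw [he, Fin.prod_univ_succ, ← hg]
      simp
    constructor
    · rw [← e.hasSum_iff, Fin.prod_univ_succ]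
      have h3 := (hf 0).mul h1 hs.of_norm
      refine h3.congr_fun fun p => ?_
      exact hfac p
    · rw [← e.hasSum_iff, Fin.prod_univ_succ]
      have h3 := (hb 0).mul h2 (by simpa only [norm_mul] using hs)
      refine h3.congr_fun fun p => ?_
      rw [Function.comp_apply, hfac p, norm_mul]

/-- The complex monomial `z^α`. -/
def zpow {m : ℕ} (z : Fin m → ℂ) (α : Fin m → ℕ) : ℂ := ∏ l, z l ^ α l

theorem norm_zpow {m : ℕ} (z : Fin m → ℂ) (α : Fin m → ℕ) :
    ‖zpow z α‖ = monomial (fun l => ‖z l‖) α := by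
  simp [zpow, monomial]

theorem zpow_add {m : ℕ} (z : Fin m → ℂ) (α γ : Fin m → ℕ) :
    zpow z (α + γ) = zpow z α * zpow z γ := by
  simp [zpow, pow_add, Finset.prod_mul_distrib]

theorem monomial_add {m : ℕ} (r : Fin m → ℝ) (α γ : Fin m → ℕ) :
    monomial r (α + γ) = monomial r α * monomial r γ := by
  simp [monomial, pow_add, Finset.prod_mul_distrib]

theorem monomial_nonneg {m : ℕ} {r : Fin m → ℝ} (hr : ∀ l, 0 ≤ r l) (α : Fin m → ℕ) :
    0 ≤ monomial r α := Finset.prod_nonneg fun l _ => pow_nonneg (hr l) _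

theorem monomial_mono {m : ℕ} {r s : Fin m → ℝ} (hr : ∀ l, 0 ≤ r l) (h : ∀ l, r l ≤ s l)
    (α : Fin m → ℕ) : monomial r α ≤ monomial s α :=
  Finset.prod_le_prod (fun l _ => pow_nonneg (hr l) _)
    fun l _ => pow_le_pow_left₀ (hr l) (h l) _

/-- Coefficients of a multiple power series that vanishes near the origin are zero. -/
theorem coeff_eq_zero {m : ℕ} {c : (Fin m → ℕ) → ℂ} {r : Fin m → ℝ} (hr : ∀ l, 0 < r l)
    (hs : Summable fun α => ‖c α‖ * monomial r α)
    (h0 : ∀ z : Fin m → ℂ, (∀ l, ‖z l‖ ≤ r l) → HasSum (fun α => c α * zpow z α) 0) : c = 0 := by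
  induction m with
  | zero =>
    funext α
    have h1 := h0 0 (fun l => l.elim0)
    have h2 := hasSum_unique (fun α : Fin 0 → ℕ => c α * zpow 0 α)
    have := h2.unique h1
    simp only [zpow, Finset.univ_eq_empty, Finset.prod_empty, mul_one] at this
    change c α = 0
    rw [← this]
    exact congrArg c (Subsingleton.elim _ _)
  | succ m ih =>
    obtain ⟨e, he⟩ : ∃ e : ℕ × (Fin m → ℕ) ≃ (Fin (m + 1) → ℕ), ∀ p, e p = Fin.cons p.1 p.2 :=
      ⟨Fin.consEquiv (fun _ => ℕ), fun _ => rfl⟩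
    have hs' : Summable fun p : ℕ × (Fin m → ℕ) => ‖c (e p)‖ * monomial r (e p) :=
      
      (e.summable_iff (f := fun α => ‖c α‖ * monomial r α)).2 hs
    have hmon : ∀ p : ℕ × (Fin m → ℕ), monomial r (e p) =
        r 0 ^ p.1 * monomial (fun l => r l.succ) p.2 := by
      intro p
      simp [monomial, he, Fin.prod_univ_succ]
    have hzp : ∀ (z : Fin (m + 1) → ℂ) (p : ℕ × (Fin m → ℕ)), zpow z (e p) =
        z 0 ^ p.1 * zpow (fun l => z l.succ) p.2 := by
      intro z p
      simp [zpow, he, Fin.prod_univ_succ]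
    have hrow : ∀ n, Summable fun α => ‖c (e (n, α))‖ * monomial (fun l => r l.succ) α := by
      intro n
      have := hs'.prod_factor n
      simp only [hmon] at this
      have h2 := this.mul_left ((r 0 ^ n)⁻¹)
      refine h2.congr fun α => ?_
      have := (pow_pos (hr 0) n).ne'
      field_simp
    have hterm : ∀ (z : Fin m → ℂ), (∀ l, ‖z l‖ ≤ r l.succ) → ∀ n,
        Summable fun α => c (e (n, α)) * zpow z α := by
      intro z hz n
      refine Summable.of_norm_bounded (hrow n) fun α => ?_
      rw [norm_mul, norm_zpow]
      gcongr
      exact monomial_mono (fun l => norm_nonneg _) hz α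
    have key : ∀ n, (fun α => c (e (n, α))) = 0 := by
      intro n
      refine ih (r := fun l => r l.succ) (fun l => hr _) (hrow n) fun z hz => ?_
      suffices h : ∑' α, c (e (n, α)) * zpow z α = 0 by
        rw [← h]; exact (hterm z hz n).hasSum
      -- The series is viewed as a one-variable power series in the first coordinate, whose
      -- coefficients are series in the other coordinates.
      let a : ℕ → ℂ := fun n => ∑' α, c (e (n, α)) * zpow z α
      have hps : ∀ w : ℂ, ‖w‖ ≤ r 0 → HasSum (fun n => w ^ n * a n) 0 := by
        intro w hw
        have h1 := h0 (Fin.cons w z) (Fin.cases (by simpa using hw) (by simpa using hz))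
        rw [← e.hasSum_iff] at h1
        have h2 := h1.prod_fiberwise (g := fun n => w ^ n * a n) fun n => by
          have := ((hterm z hz n).hasSum).mul_left (w ^ n)
          convert! this using 1
          funext α
          simp only [Function.comp_apply, hzp, Fin.cons_zero, Fin.cons_succ]
          ring
        exact h2
      have hF : HasFPowerSeriesAt (0 : ℂ → ℂ) (FormalMultilinearSeries.ofScalars ℂ a) 0 := by
        rw [hasFPowerSeriesAt_iff]
        filter_upwards [Metric.closedBall_mem_nhds (0 : ℂ) (hr 0)] with w hw
        have := hps w (by simpa using hw)
        simpa [FormalMultilinearSeries.coeff_ofScalars] using this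
      have h3 := hF.eq_zero
      have h4 : (FormalMultilinearSeries.ofScalars ℂ a : FormalMultilinearSeries ℂ ℂ ℂ).coeff
          n = 0 := by
        rw [h3]; rfl
      simpa [FormalMultilinearSeries.coeff_ofScalars] using h4
    funext α
    have := congrFun (key (e.symm α).1) (e.symm α).2
    simpa using this

end

/-! ### Cauchy's formula and Taylor expansion on polydiscs. -/

section

open MeasureTheory in
/-- The Cauchy integral formula on a polydisc. -/
theorem torusIntegral_cauchy {m : ℕ} {f : (Fin m → ℂ) → ℂ} {R r : Fin m → ℝ}
    (hf : DifferentiableOn ℂ f (polydisc R)) (hr : ∀ l, r l < R l) {z : Fin m → ℂ}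
    (hz : ∀ l, ‖z l‖ < r l) :
    (∯ ζ in T(0, r), (∏ l, (ζ l - z l))⁻¹ * f ζ) = (2 * Real.pi * Complex.I) ^ m * f z := by
  induction m with
  | zero =>
    rw [torusIntegral_dim0]
    simp [Subsingleton.elim z 0]
  | succ m ih =>
    have hpos : ∀ l, 0 < r l := fun l => (norm_nonneg _).trans_lt (hz l)
    have htor : ∀ θ l, ‖torusMap 0 r θ l‖ = r l := by
      intro θ l
      simp [torusMap, Complex.norm_exp_ofReal_mul_I, abs_of_pos (hpos l)]
    have hcm : Continuous (torusMap (0 : Fin (m + 1) → ℂ) r) := by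
      unfold torusMap; fun_prop
    have hne : ∀ θ l, torusMap 0 r θ l - z l ≠ 0 := by
      intro θ l h
      have := htor θ l
      rw [sub_eq_zero.1 h] at this
      exact (hz l).ne this
    have hint : TorusIntegrable (fun ζ => (∏ l, (ζ l - z l))⁻¹ * f ζ) 0 r := by
      refine ContinuousOn.integrableOn_compact isCompact_Icc (Continuous.continuousOn ?_)
      refine Continuous.mul (Continuous.inv₀ ?_ fun θ => Finset.prod_ne_zero_iff.2 fun l _ =>
          hne θ l) ?_
      · exact continuous_finsetProd _ fun l _ =>
          ((continuous_apply l).comp hcm).sub continuous_const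
      · exact hf.continuousOn.comp_continuous hcm fun θ l => (htor θ l).trans_lt (hr l)
    rw [torusIntegral_succ hint]
    have hz0 : z = Fin.cons (z 0) (fun l => z l.succ) := (Fin.cons_self_tail z).symm
    have hcons : Differentiable ℂ fun p : ℂ × (Fin m → ℂ) =>
        (Fin.cons p.1 p.2 : Fin (m + 1) → ℂ) := by
      rw [differentiable_pi]
      refine Fin.cases ?_ fun l => ?_
      · simp
      · simp only [Fin.cons_succ]; fun_prop
    have hinner : ∀ x ∈ Metric.sphere (0 : ℂ) (r 0),
        (∯ y in T(0, r ∘ Fin.succ), (∏ l, ((Fin.cons x y : Fin (m + 1) → ℂ) l - z l))⁻¹ *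
          f (Fin.cons x y)) =
        (x - z 0)⁻¹ • ((2 * Real.pi * Complex.I) ^ m * f (Fin.cons x fun l => z l.succ)) := by
      intro x hx
      have h1 := ih (f := fun y => f (Fin.cons x y)) (R := R ∘ Fin.succ) (r := r ∘ Fin.succ)
        (z := fun l => z l.succ) ?_ (fun l => hr _) (fun l => hz _)
      · rw [smul_eq_mul, ← h1, ← torusIntegral_const_mul]
        congr 1
        funext y
        rw [Fin.prod_univ_succ, mul_inv]
        simp [mul_assoc]
      · refine hf.comp (hcons.comp (by fun_prop :
          Differentiable ℂ fun y : Fin m → ℂ => (x, y))).differentiableOn ?_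
        intro y hy
        refine Fin.cases ?_ fun l => ?_
        · have : ‖x‖ = r 0 := by simpa using hx
          simpa [this] using hr 0
        · simpa using hy l
    have h0 : ((0 : Fin (m + 1) → ℂ) ∘ Fin.succ) = 0 := rfl
    rw [h0, show (0 : Fin (m + 1) → ℂ) 0 = 0 from rfl]
    rw [circleIntegral.integral_congr (hpos 0).le hinner]
    have hd : DifferentiableOn ℂ (fun x => (2 * Real.pi * Complex.I) ^ m * f (Fin.cons x fun l =>
        z l.succ))
        (Metric.closedBall 0 (r 0)) := by
      refine DifferentiableOn.const_mul (hf.comp (hcons.comp (by fun_prop : Differentiable ℂ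
        fun x : ℂ => (x, fun l : Fin m => z l.succ))).differentiableOn ?_) _
      intro x hx
      refine Fin.cases ?_ fun l => ?_
      · have : ‖x‖ ≤ r 0 := by simpa using hx
        simpa using this.trans_lt (hr 0)
      · simpa using (hz l.succ).trans (hr _)
    have := hd.circleIntegral_sub_inv_smul (w := z 0) (by simpa using hz 0)
    change (∮ x in C(0, r 0), _) = _
    rw [this, ← hz0, smul_eq_mul, pow_succ]
    ring

/-- Expansion of the Cauchy kernel, which converts the integral formula into a power series. -/
theorem hasSum_prod_geometric {m : ℕ} {ζ z : Fin m → ℂ} (h : ∀ l, ‖z l‖ < ‖ζ l‖) :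
    HasSum (fun α : Fin m → ℕ => ∏ l, ((ζ l)⁻¹ * (z l / ζ l) ^ α l)) (∏ l, (ζ l - z l)⁻¹) ∧
      Summable fun α : Fin m → ℕ => ‖∏ l, ((ζ l)⁻¹ * (z l / ζ l) ^ α l)‖ := by
  have hpos : ∀ l, 0 < ‖ζ l‖ := fun l => (norm_nonneg _).trans_lt (h l)
  have hq : ∀ l, ‖z l / ζ l‖ < 1 := fun l => by
    rw [norm_div, div_lt_one (hpos l)]
    exact h l
  have h1 : ∀ l, HasSum (fun n : ℕ => (ζ l)⁻¹ * (z l / ζ l) ^ n) (ζ l - z l)⁻¹ := by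
    intro l
    have := (hasSum_geometric_of_norm_lt_one (hq l)).mul_left (ζ l)⁻¹
    rwa [← mul_inv, mul_sub, mul_one, mul_div_cancel₀ _ (norm_pos_iff.1 (hpos l))] at this
  have h2 : ∀ l, HasSum (fun n : ℕ => ‖(ζ l)⁻¹ * (z l / ζ l) ^ n‖)
      (‖(ζ l)⁻¹‖ * (1 - ‖z l / ζ l‖)⁻¹) := by
    intro l
    simpa only [norm_mul, norm_pow] using
      (hasSum_geometric_of_lt_one (norm_nonneg _) (hq l)).mul_left ‖(ζ l)⁻¹‖
  exact ⟨(hasSum_prod_pi h1 h2).1, (hasSum_prod_pi h1 h2).2.summable⟩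

open MeasureTheory in
/-- The power series expansion of a holomorphic function on a polydisc. -/
theorem exists_taylor {m : ℕ} {f : (Fin m → ℂ) → ℂ} {R r : Fin m → ℝ}
    (hf : DifferentiableOn ℂ f (polydisc R)) (h0 : ∀ l, 0 ≤ r l) (hr : ∀ l, r l < R l) :
    ∃ c : (Fin m → ℕ) → ℂ, (Summable fun α => ‖c α‖ * monomial r α) ∧
      ∀ z : Fin m → ℂ, (∀ l, ‖z l‖ ≤ r l) → HasSum (fun α => c α * zpow z α) (f z) := by
  -- Integration takes place on a torus strictly between the two radii, so that `r / ρ < 1` gives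
  -- geometric decay.
  choose ρ hρ1 hρ2 using fun l => exists_between (hr l)
  have hpos : ∀ l, 0 < ρ l := fun l => (h0 l).trans_lt (hρ1 l)
  have htor : ∀ θ l, ‖torusMap 0 ρ θ l‖ = ρ l := by
    intro θ l
    simp [torusMap, Complex.norm_exp_ofReal_mul_I, abs_of_pos (hpos l)]
  have hcm : Continuous (torusMap (0 : Fin m → ℂ) ρ) := by
    unfold torusMap; fun_prop
  obtain ⟨M, hM⟩ : ∃ M, ∀ θ, ‖f (torusMap 0 ρ θ)‖ ≤ M := by
    have hK : IsCompact (closedPolydisc ρ) := by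
      have : closedPolydisc ρ = Set.univ.pi fun l => Metric.closedBall (0 : ℂ) (ρ l) := by
        ext z; simp [closedPolydisc, Set.mem_pi]
      rw [this]
      exact isCompact_univ_pi fun l => isCompact_closedBall _ _
    obtain ⟨M, hM⟩ := hK.exists_bound_of_continuousOn
      (hf.continuousOn.mono fun z hz l => (hz l).trans_lt (hρ2 l))
    exact ⟨M, fun θ => hM _ fun l => (htor θ l).le⟩
  have hM0 : 0 ≤ M := (norm_nonneg _).trans (hM 0)
  let c : (Fin m → ℕ) → ℂ := fun α => ((2 * Real.pi * Complex.I) ^ m)⁻¹ *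
    ∯ ζ in T(0, ρ), (∏ l, ζ l ^ (α l + 1))⁻¹ * f ζ
  have hnorm : ∀ α θ, ‖(∏ l, torusMap 0 ρ θ l ^ (α l + 1))⁻¹‖ =
      (∏ l, ρ l)⁻¹ * (monomial ρ α)⁻¹ := by
    intro α θ
    rw [norm_inv, norm_prod]
    simp only [norm_pow, htor]
    simp only [pow_succ, Finset.prod_mul_distrib, monomial]
    rw [mul_inv_rev]
  have hc : ∀ α, ‖c α‖ ≤ M * (monomial ρ α)⁻¹ := by
    intro α
    have h1 := norm_torusIntegral_le_of_norm_le_const (c := 0) (R := ρ)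
      (f := fun ζ : Fin m → ℂ => (∏ l, ζ l ^ (α l + 1))⁻¹ * f ζ)
      (C := (∏ l, ρ l)⁻¹ * (monomial ρ α)⁻¹ * M) (fun θ => by
        rw [norm_mul, hnorm]
        have := monomial_nonneg (fun l => (hpos l).le) α
        have := Finset.prod_nonneg (s := Finset.univ) fun l _ => (hpos l).le
        gcongr
        exact hM θ)
    have h2 : ‖(2 * Real.pi * Complex.I : ℂ) ^ m‖ = (2 * Real.pi) ^ m := by
      rw [norm_pow]
      simp [abs_of_pos Real.pi_pos]
    simp only [c, norm_mul, norm_inv]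
    rw [h2, inv_mul_le_iff₀ (by positivity)]
    refine h1.trans (le_of_eq ?_)
    have : ∏ l, |ρ l| = ∏ l, ρ l := Finset.prod_congr rfl fun l _ => abs_of_pos (hpos l)
    rw [this]
    have := (Finset.prod_pos (s := Finset.univ) fun l _ => hpos l).ne'
    field_simp
  refine ⟨c, ?_, fun z hz => ?_⟩
  · have hq : Summable fun α : Fin m → ℕ => ‖∏ l, ((r l / ρ l : ℝ) : ℂ) ^ α l‖ := by
      have hl : ∀ l, ‖((r l / ρ l : ℝ) : ℂ)‖ < 1 := by
        intro l
        rw [Complex.norm_real, Real.norm_eq_abs, abs_of_nonneg (div_nonneg (h0 l) (hpos l).le),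
          div_lt_one (hpos l)]
        exact hρ1 l
      exact (hasSum_prod_pi (fun l => hasSum_geometric_of_norm_lt_one (hl l))
        (fun l => by simpa only [norm_pow] using
          hasSum_geometric_of_lt_one (norm_nonneg _) (hl l))).2.summable
    refine Summable.of_nonneg_of_le (fun α => mul_nonneg (norm_nonneg _) (monomial_nonneg h0 α))
      (fun α => ?_) (hq.mul_left M)
    calc ‖c α‖ * monomial r α ≤ M * (monomial ρ α)⁻¹ * monomial r α :=
          mul_le_mul_of_nonneg_right (hc α) (monomial_nonneg h0 α)
      _ = M * ‖∏ l, ((r l / ρ l : ℝ) : ℂ) ^ α l‖ := by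
          rw [norm_prod, mul_assoc, monomial, monomial, ← Finset.prod_inv_distrib,
            ← Finset.prod_mul_distrib]
          congr 1
          refine Finset.prod_congr rfl fun l _ => ?_
          rw [norm_pow, Complex.norm_real, Real.norm_eq_abs,
            abs_of_nonneg (div_nonneg (h0 l) (hpos l).le), div_pow]
          ring
  · have hzρ : ∀ l, ‖z l‖ < ρ l := fun l => (hz l).trans_lt (hρ1 l)
    have hcauchy := torusIntegral_cauchy hf hρ2 hzρ
    have hpi : ((2 * Real.pi * Complex.I : ℂ) ^ m) ≠ 0 :=
      pow_ne_zero _ (by simp [Real.pi_ne_zero])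
    have hne : ∀ θ l, torusMap 0 ρ θ l ≠ 0 := by
      intro θ l h
      have := htor θ l
      rw [h, norm_zero] at this
      exact (hpos l).ne this
    have hgeom : ∀ θ, HasSum (fun α : Fin m → ℕ => ∏ l, ((torusMap 0 ρ θ l)⁻¹ *
        (z l / torusMap 0 ρ θ l) ^ α l)) (∏ l, (torusMap 0 ρ θ l - z l)⁻¹) ∧
        Summable (fun α : Fin m → ℕ => ‖∏ l, ((torusMap 0 ρ θ l)⁻¹ *
        (z l / torusMap 0 ρ θ l) ^ α l)‖) := fun θ =>
      hasSum_prod_geometric fun l => by rw [htor]; exact hzρ l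
    -- Termwise integration by dominated convergence. The norm of each kernel term depends only on
    -- the moduli, hence is constant on the torus, and its value at `0` serves as a bound.
    have hint : HasSum (fun α => ∯ ζ in T(0, ρ), zpow z α * ((∏ l, ζ l ^ (α l + 1))⁻¹ * f ζ))
        (∯ ζ in T(0, ρ), (∏ l, (ζ l - z l))⁻¹ * f ζ) := by
      unfold torusIntegral
      have hb : ∀ (α : Fin m → ℕ) θ, zpow z α * ((∏ l, torusMap 0 ρ θ l ^ (α l + 1))⁻¹ *
          f (torusMap 0 ρ θ))
          = (∏ l, ((torusMap 0 ρ θ l)⁻¹ * (z l / torusMap 0 ρ θ l) ^ α l)) *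
            f (torusMap 0 ρ θ) := by
        intro α θ
        rw [← mul_assoc, zpow, ← Finset.prod_inv_distrib, ← Finset.prod_mul_distrib]
        congr 1
        refine Finset.prod_congr rfl fun l _ => ?_
        have := hne θ l
        rw [div_pow, pow_succ]
        field_simp
      refine hasSum_integral_of_dominated_convergence
        (fun α _ => (∏ l, ρ l) * (‖∏ l, ((torusMap 0 ρ 0 l)⁻¹ *
            (z l / torusMap 0 ρ 0 l) ^ α l)‖ * M))
        (fun α => ?_) (fun α => ?_) ?_ ?_ ?_
      · refine Continuous.aestronglyMeasurable ?_
        have k1 : Continuous fun θ : Fin m → ℝ => ∏ l, ((ρ l : ℂ) * Complex.exp (θ l * Complex.I) *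
            Complex.I) := continuous_finsetProd _ fun l _ => by fun_prop
        have k2 : Continuous fun θ : Fin m → ℝ => (∏ l, torusMap 0 ρ θ l ^ (α l + 1))⁻¹ := by
          refine Continuous.inv₀ (continuous_finsetProd _ fun l _ =>
            ((continuous_apply l).comp hcm).pow _) fun θ =>
            Finset.prod_ne_zero_iff.2 fun l _ => pow_ne_zero _ (hne θ l)
        have k3 : Continuous fun θ : Fin m → ℝ => f (torusMap 0 ρ θ) :=
          hf.continuousOn.comp_continuous hcm fun θ l => (htor θ l).trans_lt (hρ2 l)
        exact k1.smul (continuous_const.mul (k2.mul k3))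
      · refine Eventually.of_forall fun θ => ?_
        beta_reduce
        rw [hb, norm_smul, norm_mul]
        have e1 : ‖∏ l, (ρ l : ℂ) * Complex.exp (θ l * Complex.I) * Complex.I‖ = ∏ l, ρ l := by
          rw [norm_prod]
          refine Finset.prod_congr rfl fun l _ => ?_
          simp [Complex.norm_exp_ofReal_mul_I, abs_of_pos (hpos l)]
        have e2 : ∀ θ (α : Fin m → ℕ), ‖∏ l, ((torusMap 0 ρ θ l)⁻¹ *
            (z l / torusMap 0 ρ θ l) ^ α l)‖ =
            ∏ l, ((ρ l)⁻¹ * (‖z l‖ / ρ l) ^ α l) := by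
          intro θ α
          simp only [norm_prod, norm_mul, norm_pow, norm_inv, norm_div, htor]
        rw [e1, e2, e2]
        have h3 := Finset.prod_nonneg (s := Finset.univ) fun l _ => (hpos l).le
        have h4 : 0 ≤ ∏ l, ((ρ l)⁻¹ * (‖z l‖ / ρ l) ^ α l) := Finset.prod_nonneg fun l _ => by
          have := hpos l
          positivity
        gcongr
        exact hM θ
      · exact Eventually.of_forall fun θ => ((hgeom 0).2.mul_right M).mul_left _
      · exact integrableOn_const isCompact_Icc.measure_lt_top.ne
      · refine Eventually.of_forall fun θ => ?_
        simp only [hb]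
        refine HasSum.const_smul _ (HasSum.mul_right _ ?_)
        rw [← Finset.prod_inv_distrib]
        exact (hgeom θ).1
    simp only [torusIntegral_const_mul] at hint
    rw [hcauchy] at hint
    have := hint.mul_left ((2 * Real.pi * Complex.I : ℂ) ^ m)⁻¹
    rw [inv_mul_cancel_left₀ hpi] at this
    refine this.congr_fun fun α => ?_
    simp only [c]
    ring

end

/-! ### The majorant norm: total coefficient mass at a polyradius. -/

section

section Expansion

variable {m : ℕ} {X : Type} (p : X → Fin m → ℂ)

/-- On the points with coordinates bounded by `r`, the function `f` is the sum of the power series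
with coefficients `c`, whose total mass at the radius `r` is at most `B`. -/
structure HasExpansion (f : X → ℂ) (r : Fin m → ℝ) (B : ℝ) (c : (Fin m → ℕ) → ℂ) : Prop where
  summable : Summable fun α => ‖c α‖ * monomial r α
  mass_le : ∑' α, ‖c α‖ * monomial r α ≤ B
  hasSum : ∀ x, (∀ l, ‖p x l‖ ≤ r l) → HasSum (fun α => c α * zpow (p x) α) (f x)

/-- The function `f` has a power series expansion of mass at most `B` at the radius `r`. -/
def Maj (f : X → ℂ) (r : Fin m → ℝ) (B : ℝ) : Prop := ∃ c, HasExpansion p f r B c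

variable {p} {f g : X → ℂ} {r : Fin m → ℝ} {B B' : ℝ}

theorem HasExpansion.coeff_le {c : (Fin m → ℕ) → ℂ} (h : HasExpansion p f r B c)
    (hr : ∀ l, 0 < r l) (α : Fin m → ℕ) : ‖c α‖ * monomial r α ≤ B :=
  (h.summable.le_tsum α fun γ _ => mul_nonneg (norm_nonneg _)
    (monomial_nonneg (fun l => (hr l).le) γ)).trans h.mass_le

theorem Maj.mono (h : Maj p f r B) (hB : B ≤ B') : Maj p f r B' :=
  let ⟨c, hc⟩ := h
  ⟨c, hc.summable, hc.mass_le.trans hB, hc.hasSum⟩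

theorem Maj.nonneg (h : Maj p f r B) (hr : ∀ l, 0 < r l) : 0 ≤ B :=
  let ⟨_, hc⟩ := h
  (mul_nonneg (norm_nonneg _) (monomial_nonneg (fun l => (hr l).le) 0)).trans (hc.coeff_le hr 0)

theorem HasExpansion.mono_radius {s : Fin m → ℝ} {c : (Fin m → ℕ) → ℂ}
    (hc : HasExpansion p f r B c) (hs : ∀ l, 0 ≤ s l) (hsr : ∀ l, s l ≤ r l) :
    HasExpansion p f s B c := by
  have hle : ∀ α, ‖c α‖ * monomial s α ≤ ‖c α‖ * monomial r α := fun α =>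
    mul_le_mul_of_nonneg_left (monomial_mono hs hsr α) (norm_nonneg _)
  have hsum : Summable fun α => ‖c α‖ * monomial s α :=
    Summable.of_nonneg_of_le (fun α => mul_nonneg (norm_nonneg _) (monomial_nonneg hs α)) hle
      hc.summable
  exact ⟨hsum, (hsum.tsum_le_tsum hle hc.summable).trans hc.mass_le,
    fun x hx => hc.hasSum x fun l => (hx l).trans (hsr l)⟩

theorem norm_zpow_le {z : Fin m → ℂ} (hz : ∀ l, ‖z l‖ ≤ r l) (α : Fin m → ℕ) :
    ‖zpow z α‖ ≤ monomial r α := by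
  rw [norm_zpow]
  exact monomial_mono (fun l => norm_nonneg _) hz α

/-- A family of monomial terms of finite total mass can be regrouped into a power series. -/
theorem Maj.of_family {ι : Type} (hr : ∀ l, 0 < r l) {a : ι → ℂ} {e : ι → Fin m → ℕ}
    (hs : Summable fun i => ‖a i‖ * monomial r (e i)) (hB : ∑' i, ‖a i‖ * monomial r (e i) ≤ B)
    (hf : ∀ x, (∀ l, ‖p x l‖ ≤ r l) → HasSum (fun i => a i * zpow (p x) (e i)) (f x)) :
    Maj p f r B := by
  have hpos : ∀ α, 0 < monomial r α := fun α => Finset.prod_pos fun l _ => pow_pos (hr l) _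
  -- Terms are grouped by exponent; absolute convergence permits the rearrangement and cancellation
  -- only lowers the mass.
  let E := Equiv.sigmaFiberEquiv e
  have hsE : Summable fun q : Σ α, {i // e i = α} => ‖a q.2‖ * monomial r q.1 := by
    have := (E.summable_iff (f := fun i => ‖a i‖ * monomial r (e i))).2 hs
    refine this.congr fun q => ?_
    simp [E, Equiv.sigmaFiberEquiv, q.2.2]
  have hfib : ∀ α, Summable fun i : {i // e i = α} => ‖a i‖ := by
    intro α
    have := (hsE.sigma_factor α).mul_right (monomial r α)⁻¹
    refine this.congr fun i => ?_
    simp [mul_assoc, mul_inv_cancel₀ (hpos α).ne']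
  have hterm : ∀ α, ‖∑' i : {i // e i = α}, a i‖ * monomial r α ≤
      ∑' i : {i // e i = α}, ‖a i‖ * monomial r α := by
    intro α
    rw [tsum_mul_right]
    exact mul_le_mul_of_nonneg_right (norm_tsum_le_tsum_norm (hfib α)) (hpos α).le
  have hsum : Summable fun α => ‖∑' i : {i // e i = α}, a i‖ * monomial r α :=
    Summable.of_nonneg_of_le (fun α => mul_nonneg (norm_nonneg _) (hpos α).le) hterm hsE.sigma
  refine ⟨fun α => ∑' i : {i // e i = α}, a i, hsum, ?_, fun x hx => ?_⟩
  · refine ((hsum.tsum_le_tsum hterm hsE.sigma).trans (le_of_eq ?_)).trans hB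
    rw [← hsE.tsum_sigma, ← E.tsum_eq (fun i => ‖a i‖ * monomial r (e i))]
    refine tsum_congr fun q => ?_
    simp [E, Equiv.sigmaFiberEquiv, q.2.2]
  · have h1 := (E.hasSum_iff (f := fun i => a i * zpow (p x) (e i))).2 (hf x hx)
    refine h1.sigma fun α => ?_
    have h2 := ((hfib α).of_norm.hasSum).mul_right (zpow (p x) α)
    refine h2.congr_fun fun i => ?_
    simp [E, Equiv.sigmaFiberEquiv, i.2]

/-- Submultiplicativity, through the Cauchy product. The mass behaves as a Banach algebra norm, so
bounds for weights and compositions follow mechanically. -/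
theorem Maj.mul (hr : ∀ l, 0 < r l) (hf : Maj p f r B) (hg : Maj p g r B') :
    Maj p (fun x => f x * g x) r (B * B') := by
  have hB := hf.nonneg hr
  obtain ⟨c, hc⟩ := hf
  obtain ⟨c', hc'⟩ := hg
  have hn : ∀ α, 0 ≤ monomial r α := monomial_nonneg fun l => (hr l).le
  have e : (fun q : (Fin m → ℕ) × (Fin m → ℕ) => ‖c q.1 * c' q.2‖ * monomial r (q.1 + q.2)) =
      fun q => (‖c q.1‖ * monomial r q.1) * (‖c' q.2‖ * monomial r q.2) := by
    funext q
    rw [norm_mul, monomial_add]; ring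
  have hs := hc.summable.mul_of_nonneg hc'.summable
    (fun α => mul_nonneg (norm_nonneg _) (hn α)) (fun α => mul_nonneg (norm_nonneg _) (hn α))
  refine Maj.of_family (a := fun q : (Fin m → ℕ) × (Fin m → ℕ) => c q.1 * c' q.2)
    (e := fun q => q.1 + q.2) hr (by rw [e]; exact hs) ?_ fun x hx => ?_
  · rw [e, ← hc.summable.tsum_mul_tsum hc'.summable hs]
    exact mul_le_mul hc.mass_le hc'.mass_le
      (tsum_nonneg fun α => mul_nonneg (norm_nonneg _) (hn α)) hB
  · have h3 : Summable fun q : (Fin m → ℕ) × (Fin m → ℕ) =>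
        (c q.1 * zpow (p x) q.1) * (c' q.2 * zpow (p x) q.2) := by
      refine Summable.of_norm_bounded hs fun q => ?_
      rw [norm_mul, norm_mul, norm_mul]
      gcongr <;> first | exact norm_zpow_le hx _ | exact mul_nonneg (norm_nonneg _) (hn _)
    refine ((hc.hasSum x hx).mul (hc'.hasSum x hx) h3).congr_fun fun q => ?_
    rw [zpow_add]; ring

theorem Maj.tsum {ι : Type} (hr : ∀ l, 0 < r l) {F : ι → X → ℂ} {b : ι → ℝ}
    (hF : ∀ i, Maj p (F i) r (b i)) (hb : Summable b) (hB : ∑' i, b i ≤ B)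
    (hf : ∀ x, (∀ l, ‖p x l‖ ≤ r l) → HasSum (fun i => F i x) (f x)) : Maj p f r B := by
  choose c hc using hF
  have hn : ∀ α, 0 ≤ monomial r α := monomial_nonneg fun l => (hr l).le
  have hnn : ∀ i α, 0 ≤ ‖c i α‖ * monomial r α := fun i α => mul_nonneg (norm_nonneg _) (hn α)
  have hs1 : Summable fun i => ∑' α, ‖c i α‖ * monomial r α :=
    Summable.of_nonneg_of_le (fun i => tsum_nonneg (hnn i)) (fun i => (hc i).mass_le) hb
  have hs : Summable fun q : ι × (Fin m → ℕ) => ‖c q.1 q.2‖ * monomial r q.2 :=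
    (summable_prod_of_nonneg fun q => hnn q.1 q.2).2 ⟨fun i => (hc i).summable, hs1⟩
  refine Maj.of_family (a := fun q : ι × (Fin m → ℕ) => c q.1 q.2) (e := fun q => q.2) hr hs ?_
    fun x hx => ?_
  · rw [hs.tsum_prod]
    exact (hs1.tsum_le_tsum (fun i => (hc i).mass_le) hb).trans hB
  · have h3 : Summable fun q : ι × (Fin m → ℕ) => c q.1 q.2 * zpow (p x) q.2 := by
      refine Summable.of_norm_bounded hs fun q => ?_
      rw [norm_mul]
      exact mul_le_mul_of_nonneg_left (norm_zpow_le hx _) (norm_nonneg _)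
    have h4 := h3.hasSum.prod_fiberwise fun i => (hc i).hasSum x hx
    rw [← h4.unique (hf x hx)]
    exact h3.hasSum

theorem Maj.norm_le (hf : Maj p f r B) {x : X} (hx : ∀ l, ‖p x l‖ ≤ r l) :
    ‖f x‖ ≤ B := by
  obtain ⟨c, hc⟩ := hf
  rw [← (hc.hasSum x hx).tsum_eq]
  have hle : ∀ α, ‖c α * zpow (p x) α‖ ≤ ‖c α‖ * monomial r α := by
    intro α
    rw [norm_mul]
    exact mul_le_mul_of_nonneg_left (norm_zpow_le hx _) (norm_nonneg _)
  exact (tsum_of_norm_bounded hc.summable.hasSum hle).trans hc.mass_le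

theorem Maj.monomial_term (hr : ∀ l, 0 < r l) (a : ℂ) (α : Fin m → ℕ) :
    Maj p (fun x => a * zpow (p x) α) r (‖a‖ * monomial r α) := by
  refine Maj.of_family (ι := Unit) (a := fun _ => a) (e := fun _ => α) hr
    (hasSum_unique _).summable (by simp) fun x _ => by simp

theorem Maj.const (hr : ∀ l, 0 < r l) (a : ℂ) : Maj p (fun _ => a) r ‖a‖ := by
  simpa [zpow, monomial] using Maj.monomial_term (p := p) hr a 0

theorem Maj.coord (hr : ∀ l, 0 < r l) (l : Fin m) : Maj p (fun x => p x l) r (r l) := by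
  have := Maj.monomial_term (p := p) hr 1 (Pi.single l 1)
  have e1 : ∀ z : Fin m → ℂ, zpow z (Pi.single l 1) = z l := by
    intro z
    rw [zpow, Finset.prod_eq_single l] <;> simp +contextual
  have e2 : monomial r (Pi.single l 1) = r l := by
    rw [monomial, Finset.prod_eq_single l] <;> simp +contextual
  simpa [e1, e2] using this

theorem Maj.const_mul (hr : ∀ l, 0 < r l) (a : ℂ) (hf : Maj p f r B) :
    Maj p (fun x => a * f x) r (‖a‖ * B) := (Maj.const hr a).mul hr hf

theorem Maj.finset_sum {ι : Type} (s : Finset ι) (hr : ∀ l, 0 < r l) {F : ι → X → ℂ} {b : ι → ℝ}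
    (hF : ∀ i, Maj p (F i) r (b i)) : Maj p (fun x => ∑ i ∈ s, F i x) r (∑ i ∈ s, b i) := by
  refine Maj.tsum (ι := s) (F := fun i => F i) (b := fun i => b i) hr (fun i => hF i)
    (hasSum_fintype _).summable ?_ fun x _ => ?_
  · rw [tsum_fintype, Finset.sum_coe_sort s]
  · rw [← Finset.sum_coe_sort s]
    exact hasSum_fintype _

theorem Maj.add (hr : ∀ l, 0 < r l) (hf : Maj p f r B) (hg : Maj p g r B') :
    Maj p (fun x => f x + g x) r (B + B') := by
  have := Maj.finset_sum (Finset.univ : Finset Bool) hr (F := fun i => if i then f else g)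
    (b := fun i => if i then B else B') (p := p) (fun i => by cases i <;> simpa)
  simpa using this

theorem Maj.pow (hr : ∀ l, 0 < r l) (hf : Maj p f r B) (n : ℕ) :
    Maj p (fun x => f x ^ n) r (B ^ n) := by
  induction n with
  | zero => simpa using Maj.const (p := p) hr 1
  | succ n ih => simpa only [pow_succ] using ih.mul hr hf

theorem Maj.finset_prod {ι : Type} (s : Finset ι) (hr : ∀ l, 0 < r l) {F : ι → X → ℂ} {b : ι → ℝ}
    (hF : ∀ i, Maj p (F i) r (b i)) : Maj p (fun x => ∏ i ∈ s, F i x) r (∏ i ∈ s, b i) := by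
  induction s using Finset.cons_induction with
  | empty => simpa using Maj.const (p := p) hr 1
  | cons a s ha ih =>
    simp only [Finset.prod_cons]
    exact (hF a).mul hr ih

theorem Maj.exp (hr : ∀ l, 0 < r l) (hf : Maj p f r B) :
    Maj p (fun x => Complex.exp (f x)) r (Real.exp B) := by
  have hsum : HasSum (fun n : ℕ => ‖((n.factorial : ℂ))⁻¹‖ * B ^ n) (Real.exp B) := by
    have := NormedSpace.exp_series_hasSum_exp' (𝕂 := ℝ) B
    rw [← Real.exp_eq_exp_ℝ] at this
    refine this.congr_fun fun n => ?_
    simp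
  refine Maj.tsum (F := fun n x => ((n.factorial : ℂ))⁻¹ * f x ^ n) hr
    (fun n => (hf.pow hr n).const_mul hr _) hsum.summable hsum.tsum_eq.le fun x _ => ?_
  have := NormedSpace.exp_series_hasSum_exp' (𝕂 := ℂ) (f x)
  rw [← Complex.exp_eq_exp_ℂ] at this
  exact this.congr_fun fun n => by simp

/-- Substitution into the power series: the inner coordinates have mass at most `ρ l`, so each
monomial contributes at most its mass at the radius `ρ`. -/
theorem Maj.comp {ρ : Fin m → ℝ} (hr : ∀ l, 0 < r l) (hf : Maj p f ρ B)
    {φ : X → X} (hφ : ∀ l, Maj p (fun x => p (φ x) l) r (ρ l)) : Maj p (fun x => f (φ x)) r B := by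
  obtain ⟨c, hc⟩ := hf
  refine Maj.tsum (F := fun α x => c α * zpow (p (φ x)) α) hr (fun α => Maj.const_mul hr (c α)
    (Maj.finset_prod Finset.univ hr fun l => (hφ l).pow hr (α l))) hc.summable hc.mass_le
    fun x hx => hc.hasSum (φ x) fun l => (hφ l).norm_le hx

end Expansion

end

/-! ### Growth of generalized eigenfunctions. -/

section

variable {m : ℕ} {lam R : Fin m → ℝ}

theorem exists_maj_holoSpace (f : HoloSpace R) {r : Fin m → ℝ} (hr : ∀ l, 0 < r l)
    (hrR : ∀ l, r l < R l) : ∃ B, Maj Subtype.val (fun z => f.1 z) r B := by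
  obtain ⟨f, g, hg, e⟩ := f
  obtain ⟨c, hc1, hc2⟩ := exists_taylor hg (fun l => (hr l).le) hrR
  refine ⟨_, c, hc1, le_rfl, fun z hz => ?_⟩
  rw [← e z fun l => (hz l).trans_lt (hrR l)]
  exact hc2 z hz

theorem HasExpansion.unique {f : closedPolydisc R → ℂ} {r : Fin m → ℝ} (hr : ∀ l, 0 < r l)
    (hrR : ∀ l, r l ≤ R l) {B B' : ℝ} {c c' : (Fin m → ℕ) → ℂ}
    (h : HasExpansion Subtype.val f r B c) (h' : HasExpansion Subtype.val f r B' c') : c = c' := by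
  rw [← sub_eq_zero]
  refine coeff_eq_zero hr ?_ fun z hz => ?_
  · refine Summable.of_nonneg_of_le
      (fun α => mul_nonneg (norm_nonneg _) (monomial_nonneg (fun l => (hr l).le) α)) (fun α => ?_)
      (h.summable.add h'.summable)
    rw [← add_mul]
    exact mul_le_mul_of_nonneg_right (norm_sub_le _ _) (monomial_nonneg (fun l => (hr l).le) α)
  · have hz' : z ∈ closedPolydisc R := fun l => (hz l).trans (hrR l)
    have := (h.hasSum ⟨z, hz'⟩ hz).sub (h'.hasSum ⟨z, hz'⟩ hz)
    rw [sub_self] at this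
    refine this.congr_fun fun α => ?_
    rw [Pi.sub_apply, sub_mul]

theorem ruelle_apply (J : Fin m → ℝ) (h : Admissible lam R) (β : ℂ)
    (f : HoloSpace R) (z : closedPolydisc R) :
    (ruelle J h β f).1 z = weight J β z * f.1 (branch h 1 (by simp) z) +
      weight J (-β) z * f.1 (branch h (-1) (by simp) z) := rfl

theorem HoloSpace.ext {f g : HoloSpace R} (h : ∀ z, f.1 z = g.1 z) : f = g :=
  Subtype.ext (ContinuousMap.ext h)

theorem maj_weight {J : Fin m → ℝ} (hJ : ∀ l, 0 ≤ J l) {r : Fin m → ℝ} (hr : ∀ l, 0 < r l)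
    (c : ℂ) : Maj (Subtype.val : closedPolydisc R → _) (fun z => weight J c z) r
      (Real.exp (‖c‖ * ∑ l, J l * r l)) := by
  refine Maj.exp hr (Maj.const_mul hr c (Maj.finset_sum Finset.univ hr fun l => ?_))
  have := (Maj.coord (p := (Subtype.val : closedPolydisc R → _)) hr l).const_mul hr (J l : ℂ)
  rwa [Complex.norm_real, Real.norm_eq_abs, abs_of_nonneg (hJ l)] at this

theorem maj_weightedComp {J : Fin m → ℝ} (hJ : ∀ l, 0 ≤ J l) (h : Admissible lam R) (c : ℂ)
    {s : ℝ} (hs : |s| ≤ 1) {f : HoloSpace R} {r ρ : Fin m → ℝ} (hr : ∀ l, 0 < r l)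
    (hρ : ∀ l, lam l * r l + lam l ≤ ρ l) {B : ℝ} (hf : Maj Subtype.val (fun z => f.1 z) ρ B) :
    Maj Subtype.val (fun z => (weightedComp J h c s hs f).1 z) r
      (Real.exp (‖c‖ * ∑ l, J l * r l) * B) := by
  refine Maj.mul hr (maj_weight hJ hr c) (hf.comp hr fun l => ?_)
  have h1 := (Maj.coord (p := (Subtype.val : closedPolydisc R → _)) hr l).const_mul hr (lam l : ℂ)
  have h2 := Maj.const (p := (Subtype.val : closedPolydisc R → _)) hr ((s : ℂ) * (lam l : ℂ))
  refine (h1.add hr h2).mono (le_trans ?_ (hρ l))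
  rw [norm_mul, Complex.norm_real, Complex.norm_real, Real.norm_eq_abs, Real.norm_eq_abs,
    abs_of_nonneg (h.nonneg l)]
  nlinarith [h.nonneg l]

/-- The gain that drives the bootstrap: both branches map the radius `r` into `ρ`, so control of `f`
at the smaller radius `ρ` gives control of its image at `r`, at the cost of the weight. -/
theorem maj_ruelle {J : Fin m → ℝ} (hJ : ∀ l, 0 ≤ J l) (h : Admissible lam R) (β : ℝ)
    {f : HoloSpace R} {r ρ : Fin m → ℝ} (hr : ∀ l, 0 < r l)
    (hρ : ∀ l, lam l * r l + lam l ≤ ρ l) {B : ℝ} (hf : Maj Subtype.val (fun z => f.1 z) ρ B) :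
    Maj Subtype.val (fun z => (ruelle J h β f).1 z) r
      (2 * (Real.exp (|β| * ∑ l, J l * r l) * B)) := by
  have h1 := maj_weightedComp hJ h (β : ℂ) (s := 1) (by simp) hr hρ hf
  have h2 := maj_weightedComp hJ h (-(β : ℂ)) (s := -1) (by simp) hr hρ hf
  rw [norm_neg] at h2
  rw [Complex.norm_real, Real.norm_eq_abs] at h1 h2
  exact (h1.add hr h2).mono (by rw [two_mul])

/-- Radii at which the branches contract uniformly. -/
theorem exists_radius (h : Admissible lam R) : ∃ (r : Fin m → ℝ) (s : ℝ), 1 < s ∧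
    (∀ l, 0 < r l) ∧ (∀ l, r l < R l) ∧ ∀ l, lam l * (s * r l) + lam l ≤ r l := by
  have h0 : ∀ l, 0 ≤ lam l / (1 - lam l) := fun l =>
    div_nonneg (h.nonneg l) (by linarith [h.lt_one l])
  choose r hr1 hr2 using fun l => exists_between (h.radius l)
  have hlt : ∀ l, lam l * (1 * r l) + lam l < r l := by
    intro l
    have := hr1 l
    rw [div_lt_iff₀ (by linarith [h.lt_one l])] at this
    linarith
  have hev : ∀ᶠ s : ℝ in 𝓝[>] 1, ∀ l, lam l * (s * r l) + lam l < r l := by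
    rw [eventually_all]
    intro l
    exact ((by fun_prop : Continuous fun s : ℝ => lam l * (s * r l) + lam l).tendsto 1
      |>.mono_left nhdsWithin_le_nhds).eventually_lt_const (hlt l)
  obtain ⟨s, hs, hs1⟩ := (hev.and self_mem_nhdsWithin).exists
  exact ⟨r, s, hs1, fun l => (h0 l).trans_lt (hr1 l), hr2, fun l => (hs l).le⟩

/-- Generalized eigenfunctions for nonzero eigenvalues have power series expansions at all radii,
of controlled growth. -/
theorem exists_maj_of_genEigen {J : Fin m → ℝ} (hJ : ∀ l, 0 ≤ J l) (h : Admissible lam R) (β : ℝ)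
    {μ : ℂ} (hμ : μ ≠ 0) {r : Fin m → ℝ} {s : ℝ} (hs : 1 < s) (hr : ∀ l, 0 < r l)
    (hrR : ∀ l, r l < R l) (hrs : ∀ l, lam l * (s * r l) + lam l ≤ r l) {C κ : ℝ}
    (hC : 4 / ‖μ‖ ≤ C) (hC1 : 1 ≤ C) (hκ : κ * (s - 1) = |β| * (∑ l, J l * r l) * s)
    (f : HoloSpace R) (hf : f ∈ Module.End.maxGenEigenspace (ruelle J h β) μ) :
    ∃ K, 0 ≤ K ∧ ∀ n : ℕ, Maj Subtype.val (fun z => f.1 z) (fun l => s ^ n * r l)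
      (K * C ^ n * Real.exp (κ * s ^ n)) := by
  have hμ0 : 0 < ‖μ‖ := norm_pos_iff.2 hμ
  have hs0 : 0 < s := one_pos.trans hs
  have hrn : ∀ (n : ℕ) l, 0 < s ^ n * r l := fun n l => mul_pos (pow_pos hs0 n) (hr l)
  have hκ0 : 0 ≤ κ := by
    have h1 : 0 ≤ κ * (s - 1) := by
      rw [hκ]
      have := Finset.sum_nonneg fun l (_ : l ∈ Finset.univ) => mul_nonneg (hJ l) (hr l).le
      positivity
    exact nonneg_of_mul_nonneg_left h1 (by linarith)
  obtain ⟨k, hk⟩ := (Module.End.mem_maxGenEigenspace _ _ _).1 hf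
  clear hf
  -- Induction on the order of nilpotency: `f' = (L - μ) f` has lower order, and `f = μ⁻¹ (L f -
  -- f')` carries bounds from the radius `s ^ n * r` to `s ^ (n + 1) * r`.
  induction k generalizing f with
  | zero =>
    refine ⟨0, le_rfl, fun n => ?_⟩
    have : f = 0 := hk
    subst this
    have := Maj.const (p := (Subtype.val : closedPolydisc R → _)) (hrn n) 0
    rw [norm_zero] at this
    rw [zero_mul, zero_mul]
    exact this
  | succ k ih =>
    set f' : HoloSpace R := (ruelle J h β - μ • 1) f with hf'
    obtain ⟨K', hK', ih⟩ := ih f' (by rw [pow_succ] at hk; exact hk)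
    obtain ⟨B, hB⟩ := exists_maj_holoSpace f hr hrR
    have hB0 := hB.nonneg hr
    have hfe : ∀ z, f.1 z = μ⁻¹ * ((ruelle J h β f).1 z + (-1) * f'.1 z) := by
      intro z
      have : f'.1 z = (ruelle J h β f).1 z - μ * f.1 z := rfl
      rw [this]; field_simp; ring
    refine ⟨B + 2 * K' / ‖μ‖, by positivity, fun n => ?_⟩
    -- The two summands of `K` cover the starting bound and make the contribution of `f'` at most
    -- half the target; `C ≥ 4 / ‖μ‖` does the same for `L f`.
    set K := B + 2 * K' / ‖μ‖ with hK
    have hK0 : 0 ≤ K := by positivity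
    induction n with
    | zero =>
      simp only [pow_zero, one_mul, mul_one]
      refine hB.mono ?_
      have h1 : B ≤ K := by rw [hK]; linarith [show 0 ≤ 2 * K' / ‖μ‖ by positivity]
      have h2 := Real.one_le_exp hκ0
      nlinarith
    | succ n ihn =>
      have h1 := maj_ruelle hJ h β (hrn (n + 1)) (ρ := fun l => s ^ n * r l) (fun l => ?_) ihn
      · have h2 := (h1.add (hrn (n + 1)) ((ih (n + 1)).const_mul (hrn (n + 1)) (-1))).const_mul
          (hrn (n + 1)) μ⁻¹
        simp only [← hfe] at h2
        refine h2.mono ?_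
        have hsum : ∑ l, J l * (s ^ (n + 1) * r l) = s ^ (n + 1) * ∑ l, J l * r l := by
          rw [Finset.mul_sum]; exact Finset.sum_congr rfl fun l _ => by ring
        -- The equation `hκ` for `κ` is exactly what makes the exponent from the weight and the old
        -- exponent add up to the new one.
        have hexp : Real.exp (|β| * ∑ l, J l * (s ^ (n + 1) * r l)) * Real.exp (κ * s ^ n) =
            Real.exp (κ * s ^ (n + 1)) := by
          rw [← Real.exp_add, hsum]
          congr 1
          have : κ * s ^ (n + 1) = κ * (s - 1) * s ^ n + κ * s ^ n := by ring
          rw [this, hκ]; ring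
        have h4 : ‖μ‖⁻¹ * 2 * K ≤ C * (K / 2) := by
          rw [div_le_iff₀ hμ0] at hC
          rw [inv_mul_eq_div, div_mul_eq_mul_div, div_le_iff₀ hμ0]
          nlinarith
        have h5 : ‖μ‖⁻¹ * K' ≤ K / 2 := by
          rw [hK, inv_mul_eq_div]
          have : 2 * K' / ‖μ‖ = 2 * (K' / ‖μ‖) := by ring
          rw [this]; linarith
        have hE := Real.exp_pos (κ * s ^ (n + 1))
        have hCn : 0 < C ^ n := by positivity
        simp only [norm_inv, norm_neg, norm_one, one_mul]
        calc ‖μ‖⁻¹ * (2 * (Real.exp (|β| * ∑ l, J l * (s ^ (n + 1) * r l)) *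
              (K * C ^ n * Real.exp (κ * s ^ n))) + K' * C ^ (n + 1) * Real.exp (κ * s ^ (n + 1)))
            = (‖μ‖⁻¹ * 2 * K) * (C ^ n * (Real.exp (|β| * ∑ l, J l * (s ^ (n + 1) * r l)) *
              Real.exp (κ * s ^ n))) + (‖μ‖⁻¹ * K') *
                (C ^ (n + 1) * Real.exp (κ * s ^ (n + 1))) := by
              ring
          _ ≤ (C * (K / 2)) * (C ^ n * Real.exp (κ * s ^ (n + 1))) +
              (K / 2) * (C ^ (n + 1) * Real.exp (κ * s ^ (n + 1))) := by
              rw [hexp]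
              gcongr
          _ = _ := by ring
      · have h3 := mul_le_mul_of_nonneg_left (hrs l) (pow_pos hs0 n).le
        have h4 : 1 ≤ s ^ n := one_le_pow₀ hs.le
        have h5 := h.nonneg l
        rw [pow_succ]
        nlinarith

theorem monomial_smul (a : ℝ) (r : Fin m → ℝ) (α : Fin m → ℕ) :
    monomial (fun l => a * r l) α = a ^ degree α * monomial r α := by
  simp [monomial, degree, mul_pow, Finset.prod_mul_distrib, Finset.prod_pow_eq_pow_sum]

/-- The Taylor coefficients of generalized eigenfunctions for nonzero eigenvalues. -/
theorem exists_coeff_of_genEigen {J : Fin m → ℝ} (hJ : ∀ l, 0 ≤ J l) (h : Admissible lam R) (β : ℝ)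
    {μ : ℂ} (hμ : μ ≠ 0) : ∃ (r : Fin m → ℝ) (s C κ : ℝ), (∀ l, 0 < r l) ∧ (∀ l, r l < R l) ∧
      1 < s ∧ 1 ≤ C ∧ 0 ≤ κ ∧ (β = 0 → κ = 0) ∧
      ∀ f ∈ Module.End.maxGenEigenspace (ruelle J h β) μ, ∃ c K B, 0 ≤ K ∧
        HasExpansion Subtype.val (fun z => f.1 z) r B c ∧
        ∀ (n : ℕ) α, ‖c α‖ * ((s ^ n) ^ degree α * monomial r α) ≤
          K * C ^ n * Real.exp (κ * s ^ n) := by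
  obtain ⟨r, s, hs, hr, hrR, hrs⟩ := exists_radius h
  have hs1 : s - 1 ≠ 0 := by linarith
  have hsum : 0 ≤ ∑ l, J l * r l :=
    Finset.sum_nonneg fun l _ => mul_nonneg (hJ l) (hr l).le
  refine ⟨r, s, max 1 (4 / ‖μ‖), |β| * (∑ l, J l * r l) * s / (s - 1), hr, hrR, hs, le_max_left _ _,
    ?_, fun h => by simp [h], fun f hf => ?_⟩
  · exact div_nonneg (by positivity) (by linarith)
  obtain ⟨K, hK, hM⟩ := exists_maj_of_genEigen hJ h β hμ hs hr hrR hrs (le_max_right 1 _)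
    (le_max_left _ _) (div_mul_cancel₀ _ hs1) f hf
  choose c hc using hM
  have hc0 := hc 0
  simp only [pow_zero, one_mul, mul_one] at hc0
  refine ⟨c 0, K, _, hK, hc0, fun n α => ?_⟩
  have hrn : ∀ l, 0 < s ^ n * r l := fun l => mul_pos (pow_pos (by linarith) n) (hr l)
  have hle : ∀ l, r l ≤ s ^ n * r l := fun l => le_mul_of_one_le_left (hr l).le (one_le_pow₀ hs.le)
  -- The expansions at different radii are a priori unrelated; restricted to the smallest radius
  -- they have the same coefficients.
  have hcn : HasExpansion Subtype.val (fun z => f.1 z) r (∑' α, ‖c n α‖ * monomial r α) (c n) := by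
    refine ⟨?_, le_rfl, fun z hz => (hc n).hasSum z fun l => (hz l).trans (hle l)⟩
    exact Summable.of_nonneg_of_le
      (fun α => mul_nonneg (norm_nonneg _) (monomial_nonneg (fun l => (hr l).le) α))
      (fun α => mul_le_mul_of_nonneg_left (monomial_mono (fun l => (hr l).le) hle α)
        (norm_nonneg _)) (hc n).summable
  rw [HasExpansion.unique hr (fun l => (hrR l).le) hc0 hcn, ← monomial_smul]
  exact (hc n).coeff_le hrn α

end

/-! ### Weights of the Fock space and membership criteria. -/

section

variable {m : ℕ} {lam R : Fin m → ℝ}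

theorem monomial_pos {r : Fin m → ℝ} (hr : ∀ l, 0 < r l) (α : Fin m → ℕ) : 0 < monomial r α :=
  Finset.prod_pos fun l _ => pow_pos (hr l) _

theorem summable_monomial {r : Fin m → ℝ} (h0 : ∀ l, 0 ≤ r l) (h1 : ∀ l, r l < 1) :
    Summable fun α : Fin m → ℕ => monomial r α := by
  have hl : ∀ l, ‖(r l : ℂ)‖ < 1 := fun l => by
    rw [Complex.norm_real, Real.norm_eq_abs, abs_of_nonneg (h0 l)]; exact h1 l
  have := (hasSum_prod_pi (fun l => hasSum_geometric_of_norm_lt_one (hl l))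
    (fun l => by simpa only [norm_pow] using
      hasSum_geometric_of_lt_one (norm_nonneg _) (hl l))).2.summable
  refine this.congr fun α => ?_
  simp [monomial, abs_of_nonneg (h0 _)]

/-- For termwise differentiation: the factor `|α|` from differentiating is absorbed as `|α| ≤ 2 ^
|α|`, which doubles the radius. -/
theorem exists_hasFDerivAt_zpow (z : Fin m → ℂ) (α : Fin m → ℕ) : ∃ D : (Fin m → ℂ) →L[ℂ] ℂ,
    HasFDerivAt (fun z => zpow z α) D z ∧ ∀ ρ : Fin m → ℝ, (∀ l, 1 ≤ ρ l) → (∀ l, ‖z l‖ ≤ ρ l) →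
      ‖D‖ ≤ monomial (fun l => 2 * ρ l) α := by
  classical
  have hd : ∀ l, HasFDerivAt (fun z : Fin m → ℂ => z l ^ α l)
      ((α l * z l ^ (α l - 1)) • (ContinuousLinearMap.proj l : (Fin m → ℂ) →L[ℂ] ℂ)) z := by
    intro l
    have h1 := (ContinuousLinearMap.proj l : (Fin m → ℂ) →L[ℂ] ℂ).hasFDerivAt (x := z)
    exact (hasDerivAt_pow (α l) (z l)).comp_hasFDerivAt z h1
  refine ⟨_, HasFDerivAt.finsetProd (fun l _ => hd l), fun ρ hρ hz => ?_⟩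
  have hρ0 : ∀ l, 0 ≤ ρ l := fun l => zero_le_one.trans (hρ l)
  have hterm : ∀ l, ‖(∏ j ∈ Finset.univ.erase l, z j ^ α j) • ((α l * z l ^ (α l - 1)) •
      (ContinuousLinearMap.proj l : (Fin m → ℂ) →L[ℂ] ℂ))‖ ≤ α l * monomial ρ α := by
    intro l
    have hp : ‖(ContinuousLinearMap.proj l : (Fin m → ℂ) →L[ℂ] ℂ)‖ ≤ 1 :=
      ContinuousLinearMap.opNorm_le_bound _ zero_le_one fun z => by
        simpa using norm_le_pi_norm z l
    rw [norm_smul, norm_smul, norm_mul, norm_prod, monomial,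
      ← Finset.prod_erase_mul _ _ (Finset.mem_univ l)]
    have h1 : ∏ j ∈ Finset.univ.erase l, ‖z j ^ α j‖ ≤ ∏ j ∈ Finset.univ.erase l, ρ j ^ α j :=
      Finset.prod_le_prod (fun j _ => norm_nonneg _) fun j _ => by
        rw [norm_pow]; exact pow_le_pow_left₀ (norm_nonneg _) (hz j) _
    have h2 : ‖z l ^ (α l - 1)‖ ≤ ρ l ^ α l := by
      rw [norm_pow]
      exact (pow_le_pow_left₀ (norm_nonneg _) (hz l) _).trans
        (pow_le_pow_right₀ (hρ l) (Nat.sub_le _ _))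
    have h3 : 0 ≤ ∏ j ∈ Finset.univ.erase l, ρ j ^ α j :=
      Finset.prod_nonneg fun j _ => pow_nonneg (hρ0 j) _
    have h4 : 0 ≤ ρ l ^ α l := pow_nonneg (hρ0 l) _
    rw [Complex.norm_natCast]
    calc _ ≤ (∏ j ∈ Finset.univ.erase l, ρ j ^ α j) * (α l * ρ l ^ α l * 1) := by gcongr
      _ = _ := by ring
  refine (norm_sum_le _ _).trans ((Finset.sum_le_sum fun l _ => hterm l).trans ?_)
  rw [← Finset.sum_mul, monomial_smul]
  refine mul_le_mul_of_nonneg_right ?_ (monomial_nonneg hρ0 α)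
  have : degree α < 2 ^ degree α := Nat.lt_two_pow_self
  have h5 : ((degree α : ℕ) : ℝ) ≤ 2 ^ degree α := by exact_mod_cast this.le
  simpa [degree] using h5

/-- The element of `B(D)` given by an everywhere convergent power series. -/
noncomputable def seriesHolo (R : Fin m → ℝ) (c : (Fin m → ℕ) → ℂ)
    (hc : ∀ ρ : Fin m → ℝ, (∀ l, 0 < ρ l) → Summable fun α => ‖c α‖ * monomial ρ α) :
    HoloSpace R :=
  ⟨⟨fun z => ∑' α, c α * zpow z α, by
    have hρ : ∀ l, 0 < max 1 (R l) := fun l => lt_max_of_lt_left one_pos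
    refine continuous_tsum (fun α => ?_) (hc _ hρ) fun α z => ?_
    · exact continuous_const.mul (continuous_finsetProd _ fun l _ =>
        ((continuous_apply l).comp continuous_subtype_val).pow _)
    · rw [norm_mul]
      exact mul_le_mul_of_nonneg_left
        (norm_zpow_le (fun l => (z.2 l).trans (le_max_right _ _)) α) (norm_nonneg _)⟩,
  ⟨fun z => ∑' α, c α * zpow z α, by
    have hρ : ∀ l, 0 < 2 * max 1 (R l) := fun l =>
      mul_pos two_pos (lt_max_of_lt_left one_pos)
    choose D hD1 hD2 using fun (α : Fin m → ℕ) z => exists_hasFDerivAt_zpow z α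
    have hopen : polydisc R = Set.univ.pi fun l => Metric.ball (0 : ℂ) (R l) := by
      ext z; simp [polydisc, Set.mem_pi]
    intro x hx
    refine (hasFDerivAt_tsum_of_isPreconnected (f' := fun α z => c α • D α z) (hc _ hρ)
      (s := polydisc R) ?_ ?_
      (fun α z hz => (hD1 α z).const_mul (c α)) (fun α z hz => ?_) hx ?_
      hx).differentiableAt.differentiableWithinAt
    · rw [hopen]
      exact isOpen_set_pi Set.finite_univ fun l _ => Metric.isOpen_ball
    · rw [hopen]
      exact (convex_pi fun l _ => convex_ball (0 : ℂ) (R l)).isPreconnected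
    · rw [norm_smul]
      exact mul_le_mul_of_nonneg_left (hD2 α z _ (fun l => le_max_left _ _)
        fun l => (hz l).le.trans (le_max_right _ _)) (norm_nonneg _)
    · refine Summable.of_norm_bounded (hc (fun l => max 1 (R l))
        fun l => lt_max_of_lt_left one_pos) fun α => ?_
      rw [norm_mul]
      exact mul_le_mul_of_nonneg_left
        (norm_zpow_le (fun l => (hx l).le.trans (le_max_right _ _)) α) (norm_nonneg _),
    fun z _ => rfl⟩⟩

/-- The multi-index factorial. -/
def mfact (α : Fin m → ℕ) : ℕ := ∏ l, (α l).factorial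

theorem mfact_pos (α : Fin m → ℕ) : 0 < mfact α :=
  Finset.prod_pos fun _ _ => Nat.factorial_pos _

theorem mfact_le (α : Fin m → ℕ) : mfact α ≤ (degree α).factorial :=
  Nat.le_of_dvd (Nat.factorial_pos _) (Nat.prod_factorial_dvd_factorial_sum _ _)

/-- The reciprocal norm of the monomial `z^α` in the Fock space with scales `t`. -/
noncomputable def fockWeight (t : Fin m → ℝ) (α : Fin m → ℕ) : ℝ :=
  (monomial t α * √(mfact α))⁻¹

theorem fockWeight_pos {t : Fin m → ℝ} (ht : ∀ l, 0 < t l) (α : Fin m → ℕ) :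
    0 < fockWeight t α :=
  inv_pos.2 (mul_pos (monomial_pos ht α) (Real.sqrt_pos.2 (by exact_mod_cast mfact_pos α)))

/-- The `1 / √α!` in the weight beats any geometric growth, so Fock space elements are entire
functions and evaluations are continuous. -/
theorem summable_fockWeight {t : Fin m → ℝ} (ht : ∀ l, 0 < t l) {ρ : Fin m → ℝ}
    (hρ : ∀ l, 0 < ρ l) : Summable fun α => fockWeight t α * monomial ρ α := by
  have hone : ∀ (a : ℝ), 0 < a → Summable fun n : ℕ => a ^ n / √(n.factorial) := by
    intro a ha
    refine Summable.of_nonneg_of_le (fun n => by positivity) (fun n => ?_)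
      ((summable_geometric_of_lt_one (by norm_num) (by norm_num : (1 / 2 : ℝ) < 1)).mul_left
        √(Real.exp (4 * a ^ 2)))
    have h1 := Real.pow_div_factorial_le_exp (4 * a ^ 2) (by positivity) n
    have h2 := Real.sqrt_le_sqrt h1
    have h3 : (4 * a ^ 2) ^ n = ((2 * a) ^ n) ^ 2 := by
      rw [← pow_mul, mul_comm n, pow_mul]; congr 1; ring
    rw [h3, Real.sqrt_div (by positivity), Real.sqrt_sq (by positivity)] at h2
    calc a ^ n / √(n.factorial) = (2 * a) ^ n / √(n.factorial) * (1 / 2) ^ n := by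
          rw [mul_pow]
          have : (2 : ℝ) ^ n * (1 / 2) ^ n = 1 := by rw [← mul_pow]; norm_num
          calc a ^ n / √(n.factorial) = ((2 : ℝ) ^ n * (1 / 2) ^ n) * (a ^ n / √(n.factorial)) := by
                rw [this, one_mul]
            _ = _ := by ring
      _ ≤ _ := by gcongr
  have hl : ∀ l, Summable fun n : ℕ => ‖(((ρ l / t l) ^ n / √(n.factorial) : ℝ) : ℂ)‖ := by
    intro l
    have := hone (ρ l / t l) (div_pos (hρ l) (ht l))
    refine this.congr fun n => ?_
    rw [Complex.norm_real, Real.norm_eq_abs, abs_of_nonneg]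
    have := ht l
    have := hρ l
    positivity
  have := (hasSum_prod_pi (fun l => (hl l).of_norm.hasSum) (fun l => (hl l).hasSum)).2.summable
  refine this.congr fun α => ?_
  rw [← Complex.ofReal_prod, Complex.norm_real, Real.norm_eq_abs, abs_of_nonneg]
  · simp only [fockWeight, monomial, mfact, Nat.cast_prod, div_pow]
    rw [Real.sqrt_prod _ fun _ _ => Nat.cast_nonneg _, ← Finset.prod_mul_distrib,
      ← Finset.prod_inv_distrib, ← Finset.prod_mul_distrib]
    refine Finset.prod_congr rfl fun l _ => ?_
    rw [div_div, inv_mul_eq_div]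
  · refine Finset.prod_nonneg fun l _ => ?_
    have := ht l
    have := hρ l
    positivity

/-- Power series whose coefficients satisfy the growth bounds of generalized eigenfunctions lie in
every Fock space. -/
theorem summable_fock_of_bound {r t : Fin m → ℝ} (hr : ∀ l, 0 < r l) (ht : ∀ l, 0 < t l)
    {s C κ K : ℝ} (hs : 1 < s) (hC : 1 ≤ C) (hκ : 0 ≤ κ) (hK : 0 ≤ K) {c : (Fin m → ℕ) → ℂ}
    (hc : ∀ (n : ℕ) α, ‖c α‖ * ((s ^ n) ^ degree α * monomial r α) ≤
          K * C ^ n * Real.exp (κ * s ^ n)) :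
    Summable fun α => (‖c α‖ * (fockWeight t α)⁻¹) ^ 2 := by
  have hs0 : 0 < s := one_pos.trans hs
  -- By Bernoulli `n (s - 1) ≤ s ^ n`, so `n ≤ p k` as soon as `s ^ n ≤ k`; this lets `C ^ n` be
  -- absorbed into a `k`-th power.
  obtain ⟨p, hp⟩ := exists_nat_ge (1 / (s - 1))
  rw [div_le_iff₀ (by linarith)] at hp
  set E := C ^ p * Real.exp κ * s with hE
  have hE0 : 0 < E := by positivity
  have key : ∀ α, ‖c α‖ * ((degree α : ℝ) ^ degree α * monomial r α) ≤
      K * Real.exp κ * E ^ degree α := by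
    intro α
    generalize hk : degree α = k
    rcases Nat.eq_zero_or_pos k with rfl | hk0
    · have := hc 0 α
      rw [hk] at this
      simpa using this
    · have hk1 : (1 : ℝ) ≤ k := by exact_mod_cast hk0
      -- The bound is used at the nearly optimal scale `s ^ n ≤ k < s ^ (n + 1)`, which gives
      -- coefficients of size `E ^ k / k ^ k`, the decay of exponential growth.
      obtain ⟨n, hn1, hn2⟩ := exists_nat_pow_near hk1 hs
      have h1 := hc n α
      rw [hk] at h1
      have hmon := monomial_pos hr α
      have h2 : (k : ℝ) ^ k ≤ s ^ k * (s ^ n) ^ k := by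
        rw [← mul_pow, ← pow_succ']
        exact pow_le_pow_left₀ (by positivity) hn2.le k
      have h3 : C ^ n ≤ (C ^ p) ^ k := by
        rw [← pow_mul]
        refine pow_le_pow_right₀ hC ?_
        have hb := one_add_mul_le_pow (a := s - 1) (by linarith) n
        have hb2 : (n : ℝ) * (s - 1) ≤ k := by
          have : (1 + (s - 1)) ^ n = s ^ n := by rw [add_sub_cancel]
          rw [this] at hb
          linarith
        have : (n : ℝ) ≤ p * k := by
          have h5 : (0 : ℝ) ≤ n := Nat.cast_nonneg n
          have h6 : (0 : ℝ) ≤ p := Nat.cast_nonneg p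
          nlinarith
        exact_mod_cast this
      have h4 : Real.exp (κ * s ^ n) ≤ Real.exp κ ^ k := by
        rw [← Real.exp_nat_mul]
        refine Real.exp_le_exp.2 ?_
        nlinarith
      calc ‖c α‖ * ((k : ℝ) ^ k * monomial r α)
          ≤ ‖c α‖ * (s ^ k * (s ^ n) ^ k * monomial r α) := by gcongr
        _ = s ^ k * (‖c α‖ * ((s ^ n) ^ k * monomial r α)) := by ring
        _ ≤ s ^ k * (K * C ^ n * Real.exp (κ * s ^ n)) := by gcongr
        _ ≤ s ^ k * (K * (C ^ p) ^ k * Real.exp κ ^ k) := by gcongr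
        _ = K * 1 * E ^ k := by rw [hE, mul_pow, mul_pow]; ring
        _ ≤ K * Real.exp κ * E ^ k := by
            have := Real.one_le_exp hκ
            gcongr
  -- A single factor with `t ≤ τ r` replaces the radii `r` by the scales `t`.
  set τ := 1 + ∑ l, t l / r l with hτ
  have hτ0 : 0 < τ := by
    have := Finset.sum_nonneg fun l (_ : l ∈ Finset.univ) => div_nonneg (ht l).le (hr l).le
    positivity
  have hτl : ∀ l, t l ≤ τ * r l := by
    intro l
    have := Finset.single_le_sum (fun l (_ : l ∈ Finset.univ) => div_nonneg (ht l).le (hr l).le)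
      (Finset.mem_univ l)
    rw [← div_le_iff₀ (hr l)]
    linarith
  set G := E * τ with hG
  have key2 : ∀ α, ‖c α‖ * ((degree α : ℝ) ^ degree α * monomial t α) ≤
      K * Real.exp κ * G ^ degree α := by
    intro α
    have h1 : monomial t α ≤ τ ^ degree α * monomial r α := by
      rw [← monomial_smul]
      exact monomial_mono (fun l => (ht l).le) hτl α
    calc _ ≤ ‖c α‖ * ((degree α : ℝ) ^ degree α * (τ ^ degree α * monomial r α)) := by gcongr
      _ = τ ^ degree α * (‖c α‖ * ((degree α : ℝ) ^ degree α * monomial r α)) := by ring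
      _ ≤ τ ^ degree α * (K * Real.exp κ * E ^ degree α) := by
          have := key α
          gcongr
      _ = _ := by rw [hG]; ring_nf
  have hsum : Summable fun α : Fin m → ℕ => monomial (fun _ => (1 / 2 : ℝ)) α :=
    summable_monomial (fun _ => by norm_num) (fun _ => by norm_num)
  refine Summable.of_nonneg_of_le (fun α => sq_nonneg _) (fun α => ?_)
    (hsum.mul_left ((K * Real.exp κ) ^ 2 * Real.exp (2 * G ^ 2)))
  have hk := key2 α
  have hf1 : (mfact α : ℝ) ≤ (degree α).factorial := by exact_mod_cast mfact_le α
  have hf2 : ((degree α).factorial : ℝ) ≤ (degree α : ℝ) ^ degree α := by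
    exact_mod_cast Nat.factorial_le_pow _
  have hhalf : monomial (fun _ => (1 / 2 : ℝ)) α = (1 / 2) ^ degree α := by
    simp [monomial, degree, Finset.prod_pow_eq_pow_sum]
  rw [hhalf, fockWeight, inv_inv, mul_pow, mul_pow, Real.sq_sqrt (Nat.cast_nonneg _)]
  generalize degree α = k at *
  have hkk : (0 : ℝ) < (k : ℝ) ^ k := lt_of_lt_of_le (by positivity) hf2
  have hkf : (0 : ℝ) < k.factorial := by positivity
  have hmt := (monomial_pos ht α).le
  have h1 : ‖c α‖ * monomial t α * (k : ℝ) ^ k ≤ K * Real.exp κ * G ^ k := by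
    calc _ = ‖c α‖ * ((k : ℝ) ^ k * monomial t α) := by ring
      _ ≤ _ := hk
  have h2 : (‖c α‖ * monomial t α * (k : ℝ) ^ k) ^ 2 ≤ (K * Real.exp κ * G ^ k) ^ 2 :=
    pow_le_pow_left₀ (by positivity) h1 2
  have h3 := Real.pow_div_factorial_le_exp (2 * G ^ 2) (by positivity) k
  -- Since `α! ≤ k! ≤ k ^ k`, the decay `k ^ (-2 k)` of the squared coefficients outweighs the
  -- factor `α!` of the Fock norm and leaves `1 / k!`.
  have h4 : (‖c α‖ * monomial t α) ^ 2 * k.factorial ≤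
      (K * Real.exp κ * G ^ k) ^ 2 / k.factorial := by
    rw [le_div_iff₀ hkf]
    calc (‖c α‖ * monomial t α) ^ 2 * k.factorial * k.factorial
        ≤ (‖c α‖ * monomial t α) ^ 2 * (k : ℝ) ^ k * (k : ℝ) ^ k := by gcongr
      _ = (‖c α‖ * monomial t α * (k : ℝ) ^ k) ^ 2 := by ring
      _ ≤ _ := h2
  calc ‖c α‖ ^ 2 * (monomial t α ^ 2 * (mfact α : ℝ))
      ≤ ‖c α‖ ^ 2 * (monomial t α ^ 2 * (k.factorial : ℝ)) := by gcongr
    _ = (‖c α‖ * monomial t α) ^ 2 * k.factorial := by ring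
    _ ≤ (K * Real.exp κ * G ^ k) ^ 2 / k.factorial := h4
    _ = (K * Real.exp κ) ^ 2 * ((2 * G ^ 2) ^ k / k.factorial) * (1 / 2) ^ k := by
        have : (2 : ℝ) ^ k * (1 / 2) ^ k = 1 := by rw [← mul_pow]; norm_num
        rw [mul_pow, mul_pow 2]
        calc (K * Real.exp κ) ^ 2 * (G ^ k) ^ 2 / k.factorial
            = (K * Real.exp κ) ^ 2 * (G ^ k) ^ 2 / k.factorial * ((2 : ℝ) ^ k * (1 / 2) ^ k) := by
              rw [this, mul_one]
          _ = _ := by ring_nf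
    _ ≤ _ := by gcongr

end

/-! ### Displaced number states in one variable. -/

section

/-- The coefficients of the displaced number states `exp (w u - w² / 2) (u - w) ^ n / √n!` in the
orthonormal basis `u ^ k / √k!` of the one-dimensional Fock space. -/
noncomputable def displaced (w : ℝ) : ℕ → ℕ → ℝ
  | 0, k => Real.exp (-w ^ 2 / 2) * w ^ k / √(k.factorial)
  | n + 1, k => (√k * displaced w n (k - 1) - w * displaced w n k) / √((n + 1 : ℕ) : ℝ)

variable (w : ℝ)

theorem sqrt_succ_ne_zero (n : ℕ) : √((n + 1 : ℕ) : ℝ) ≠ 0 :=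
  (Real.sqrt_pos.2 (by positivity)).ne'

theorem displaced_succ (n k : ℕ) : √((n + 1 : ℕ) : ℝ) * displaced w (n + 1) k =
    √k * displaced w n (k - 1) - w * displaced w n k := by
  rw [displaced, mul_div_cancel₀ _ (sqrt_succ_ne_zero n)]

theorem sqrt_factorial_succ (k : ℕ) :
    √((k + 1).factorial : ℝ) = √((k + 1 : ℕ) : ℝ) * √(k.factorial) := by
  rw [Nat.factorial_succ, Nat.cast_mul, Real.sqrt_mul (Nat.cast_nonneg _)]

theorem displaced_zero_succ (k : ℕ) : √((k + 1 : ℕ) : ℝ) * displaced w 0 (k + 1) =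
    w * displaced w 0 k := by
  rw [displaced, displaced, sqrt_factorial_succ]
  have h1 := sqrt_succ_ne_zero k
  have h2 : √(k.factorial : ℝ) ≠ 0 := (Real.sqrt_pos.2 (by positivity)).ne'
  field_simp
  ring

/-- The annihilation relation: differentiating `exp (w u) (u - w) ^ n` gives a multiple by `w` plus
a lower state. `displaced_succ` is the dual creation relation, multiplication by `u - w`. -/
theorem displaced_right_succ (n k : ℕ) : √((k + 1 : ℕ) : ℝ) * displaced w n (k + 1) =
    w * displaced w n k + √n * displaced w (n - 1) k := by
  induction n generalizing k with
  | zero => simpa using displaced_zero_succ w k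
  | succ n ih =>
    have hn := sqrt_succ_ne_zero n
    have hsq : ∀ j : ℕ, √(j : ℝ) * √(j : ℝ) = j := fun j => Real.mul_self_sqrt (Nat.cast_nonneg _)
    refine mul_left_cancel₀ hn ?_
    have h1 := displaced_succ w n (k + 1)
    have h2 := displaced_succ w n k
    have h3 := ih k
    simp only [Nat.add_sub_cancel] at h1 ⊢
    have h4 : √(k : ℝ) * (√(k : ℝ) * displaced w n k) =
        √(k : ℝ) * (w * displaced w n (k - 1) + √n * displaced w (n - 1) (k - 1)) := by
      rcases k with _ | k
      · simp
      · rw [Nat.add_sub_cancel, ih k]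
    have h5 : √(n : ℝ) * (√(n : ℝ) * displaced w n k) =
        √(n : ℝ) * (√k * displaced w (n - 1) (k - 1) - w * displaced w (n - 1) k) := by
      rcases n with _ | n
      · simp
      · rw [Nat.add_sub_cancel, displaced_succ]
    rw [← mul_assoc, hsq] at h4 h5
    have e1 := hsq (k + 1)
    have e2 := hsq (n + 1)
    push_cast at *
    linear_combination √(k + 1 : ℝ) * h1 + (-w) * h2 + displaced w n k * e1 -
      displaced w n k * e2 - w * h3 + h4 - h5

/-- The coefficients are matrix elements of a real displacement operator, whose transpose displaces
by `-w`. This symmetry will turn orthonormality of rows into that of columns, hence into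
completeness. -/
theorem displaced_swap (n k : ℕ) : displaced w k n = (-1) ^ (n + k) * displaced w n k := by
  induction k generalizing n with
  | zero =>
    induction n with
    | zero => simp
    | succ n ih =>
      refine mul_left_cancel₀ (sqrt_succ_ne_zero n) ?_
      have h1 := displaced_succ w n 0
      have h2 := displaced_zero_succ w n
      have e : (-1 : ℝ) ^ n * (-1) ^ n = 1 := by rw [← mul_pow]; simp
      simp only [Nat.cast_zero, Real.sqrt_zero, zero_mul, zero_sub, add_zero, pow_succ] at *
      linear_combination h2 + w * ih + (-1) ^ n * h1
  | succ k ih =>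
    refine mul_left_cancel₀ (sqrt_succ_ne_zero k) ?_
    have h1 := displaced_succ w k n
    have h2 := displaced_right_succ w n k
    have h3 := ih n
    have h4 : √(n : ℝ) * displaced w k (n - 1) =
        √(n : ℝ) * (-(-1) ^ (n + k) * displaced w (n - 1) k) := by
      rcases n with _ | n
      · simp
      · rw [Nat.add_sub_cancel, ih n]; ring
    rw [h1, h4, h3, ← add_assoc, pow_succ]
    linear_combination (-1) ^ (n + k) * h2

theorem exists_displaced_bound (n : ℕ) : ∃ K A : ℝ, 0 ≤ K ∧ 1 ≤ A ∧
    ∀ k, |displaced w n k| ≤ K * A ^ k / √(k.factorial) := by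
  induction n with
  | zero =>
    refine ⟨Real.exp (-w ^ 2 / 2), max 1 |w|, (Real.exp_pos _).le, le_max_left _ _, fun k => ?_⟩
    rw [displaced, abs_div, abs_mul, abs_pow, abs_of_pos (Real.exp_pos _),
      abs_of_nonneg (Real.sqrt_nonneg _)]
    gcongr
    exact le_max_right _ _
  | succ n ih =>
    obtain ⟨K, A, hK, hA, h⟩ := ih
    refine ⟨K + |w| * K, 2 * A, by positivity, by linarith, fun k => ?_⟩
    have hf : 0 < √(k.factorial : ℝ) := Real.sqrt_pos.2 (by positivity)
    have h1 : √(k : ℝ) * |displaced w n (k - 1)| ≤ K * (2 * A) ^ k / √(k.factorial) := by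
      rcases k with _ | k
      · simp; positivity
      · rw [Nat.add_sub_cancel, le_div_iff₀ hf, sqrt_factorial_succ]
        have h2 := h k
        rw [le_div_iff₀ (Real.sqrt_pos.2 (by positivity))] at h2
        have e1 : √((k + 1 : ℕ) : ℝ) * √((k + 1 : ℕ) : ℝ) = ((k + 1 : ℕ) : ℝ) :=
          Real.mul_self_sqrt (Nat.cast_nonneg _)
        have e2 : ((k + 1 : ℕ) : ℝ) ≤ 2 ^ (k + 1) := by exact_mod_cast Nat.lt_two_pow_self.le
        have e3 : A ^ k ≤ A ^ (k + 1) := pow_le_pow_right₀ hA (Nat.le_succ k)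
        calc √((k + 1 : ℕ) : ℝ) * |displaced w n k| * (√((k + 1 : ℕ) : ℝ) * √(k.factorial))
            = (√((k + 1 : ℕ) : ℝ) * √((k + 1 : ℕ) : ℝ)) * (|displaced w n k| * √(k.factorial)) := by
              ring
          _ ≤ 2 ^ (k + 1) * (K * A ^ (k + 1)) := by
              rw [e1]
              refine mul_le_mul e2 (h2.trans ?_) (by positivity) (by positivity)
              gcongr
          _ = _ := by rw [mul_pow]; ring
    have h2 : |w| * |displaced w n k| ≤ |w| * K * (2 * A) ^ k / √(k.factorial) := by
      rw [mul_assoc, mul_div_assoc]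
      refine mul_le_mul_of_nonneg_left ((h k).trans ?_) (abs_nonneg _)
      gcongr
      linarith
    have h3 : (1 : ℝ) ≤ √((n + 1 : ℕ) : ℝ) := by
      rw [Real.one_le_sqrt]; push_cast; linarith [Nat.cast_nonneg (α := ℝ) n]
    rw [displaced, abs_div, abs_of_nonneg (Real.sqrt_nonneg ((n + 1 : ℕ) : ℝ))]
    refine (div_le_self (abs_nonneg _) h3).trans ((abs_sub _ _).trans ?_)
    rw [abs_mul, abs_mul, abs_of_nonneg (Real.sqrt_nonneg (k : ℝ))]
    calc _ ≤ K * (2 * A) ^ k / √(k.factorial) + |w| * K * (2 * A) ^ k / √(k.factorial) :=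
          add_le_add h1 h2
      _ = _ := by ring

theorem summable_pow_mul_displaced (n : ℕ) (u : ℝ) :
    Summable fun k : ℕ => |displaced w n k| * (|u| ^ k / √(k.factorial)) := by
  obtain ⟨K, A, hK, hA, h⟩ := exists_displaced_bound w n
  have hs := (Real.summable_pow_div_factorial (A * |u|)).mul_left K
  refine Summable.of_nonneg_of_le (fun k => by positivity) (fun k => ?_) hs
  have hf : 0 < √(k.factorial : ℝ) := Real.sqrt_pos.2 (by positivity)
  have e : √(k.factorial : ℝ) * √(k.factorial : ℝ) = k.factorial :=
    Real.mul_self_sqrt (Nat.cast_nonneg _)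
  calc _ ≤ K * A ^ k / √(k.factorial) * (|u| ^ k / √(k.factorial)) := by
        gcongr; exact h k
    _ = K * ((A * |u|) ^ k / (√(k.factorial) * √(k.factorial))) := by
        rw [mul_pow]; field_simp
    _ = _ := by rw [e]

theorem summable_displaced_mul (n k : ℕ) (s : ℝ) :
    Summable fun j : ℕ => |s| ^ j * (|displaced w n j| * |displaced w k j|) := by
  obtain ⟨K, A, hK, hA, h⟩ := exists_displaced_bound w k
  have hs := (summable_pow_mul_displaced w n (|s| * A)).mul_left K
  refine Summable.of_nonneg_of_le (fun k => by positivity) (fun j => ?_) hs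
  calc _ ≤ |s| ^ j * (|displaced w n j| * (K * A ^ j / √(j.factorial))) := by
        gcongr; exact h j
    _ = K * (|displaced w n j| * ((|s| * A) ^ j / √(j.factorial))) := by rw [mul_pow]; ring
    _ = _ := by rw [abs_of_nonneg (by positivity : 0 ≤ |s| * A)]

/-- Identifies the recursively defined coefficients with the Taylor coefficients of the displaced
states, the recursion being multiplication by `u - w`. -/
theorem hasSum_displaced (n : ℕ) (u : ℂ) :
    HasSum (fun k : ℕ => (displaced w n k : ℂ) * (u ^ k / (√(k.factorial) : ℝ)))
      (Complex.exp (w * u - w ^ 2 / 2) * (u - w) ^ n / (√(n.factorial) : ℝ)) := by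
  have hfc : ∀ k : ℕ, ((√(k.factorial) : ℝ) : ℂ) ≠ 0 := fun k => by
    exact_mod_cast (Real.sqrt_pos.2 (by positivity)).ne'
  have hsc : ∀ k : ℕ, ((√((k + 1 : ℕ) : ℝ) : ℝ) : ℂ) ≠ 0 := fun k => by
    exact_mod_cast sqrt_succ_ne_zero k
  induction n with
  | zero =>
    have h1 := NormedSpace.exp_series_hasSum_exp' (𝕂 := ℂ) ((w : ℂ) * u)
    rw [← Complex.exp_eq_exp_ℂ] at h1
    have h2 := h1.mul_left (Complex.exp (-(w : ℂ) ^ 2 / 2))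
    rw [← Complex.exp_add] at h2
    have e1 : -(w : ℂ) ^ 2 / 2 + w * u = w * u - w ^ 2 / 2 := by ring
    rw [e1] at h2
    simp only [pow_zero, mul_one, Nat.factorial_zero, Nat.cast_one, Real.sqrt_one,
      Complex.ofReal_one, div_one]
    refine h2.congr_fun fun k => ?_
    have e2 : ((√(k.factorial) : ℝ) : ℂ) * ((√(k.factorial) : ℝ) : ℂ) = (k.factorial : ℂ) := by
      rw [← Complex.ofReal_mul, Real.mul_self_sqrt (Nat.cast_nonneg _), Complex.ofReal_natCast]
    have e3 : (k.factorial : ℂ) ≠ 0 := by exact_mod_cast (Nat.factorial_pos k).ne'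
    rw [displaced, smul_eq_mul]
    push_cast
    have := hfc k
    rw [mul_pow, ← e2]
    field_simp
  | succ n ih =>
    have h1 : HasSum (fun k : ℕ => ((√(k : ℝ) : ℝ) : ℂ) * (displaced w n (k - 1) : ℂ) *
        (u ^ k / (√(k.factorial) : ℝ)))
        (u * (Complex.exp (w * u - w ^ 2 / 2) * (u - w) ^ n / (√(n.factorial) : ℝ))) := by
      rw [← hasSum_nat_add_iff' 1]
      simp only [Finset.range_one, Finset.sum_singleton, Nat.cast_zero, Real.sqrt_zero,
        Complex.ofReal_zero, zero_mul, sub_zero]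
      refine (ih.mul_left u).congr_fun fun k => ?_
      rw [Nat.add_sub_cancel, sqrt_factorial_succ, pow_succ]
      have h1 := hfc k
      have h2 := hsc k
      push_cast at *
      field_simp
    have h2 := (h1.sub (ih.mul_left (w : ℂ))).div_const ((√((n + 1 : ℕ) : ℝ) : ℝ) : ℂ)
    have e : Complex.exp (w * u - w ^ 2 / 2) * (u - w) ^ (n + 1) / (√((n + 1).factorial) : ℝ) =
        (u * (Complex.exp (w * u - w ^ 2 / 2) * (u - w) ^ n / (√(n.factorial) : ℝ)) -
          w * (Complex.exp (w * u - w ^ 2 / 2) * (u - w) ^ n / (√(n.factorial) : ℝ))) /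
          ((√((n + 1 : ℕ) : ℝ) : ℝ) : ℂ) := by
      rw [sqrt_factorial_succ, pow_succ]
      have h1 := hfc n
      have h2 := hsc n
      push_cast at *
      field_simp
      ring
    rw [e]
    refine h2.congr_fun fun k => ?_
    rw [displaced]
    push_cast
    ring

/-- The pairings `∑ⱼ s^j C(n,j) C(k,j)` of displaced number states. -/
noncomputable def pairing (s : ℝ) (n k : ℕ) : ℝ :=
  ∑' j, s ^ j * (displaced w n j * displaced w k j)

theorem hasSum_pairing (s : ℝ) (n k : ℕ) :
    HasSum (fun j => s ^ j * (displaced w n j * displaced w k j)) (pairing w s n k) := by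
  refine Summable.hasSum (Summable.of_norm ?_)
  simpa [abs_mul] using summable_displaced_mul w n k s

theorem pairing_comm (s : ℝ) (n k : ℕ) : pairing w s n k = pairing w s k n := by
  simp only [pairing, mul_comm (displaced w n _)]

/-- The creation relation in `n` is moved by a shift of the summation index onto `k`, where it
becomes the annihilation relation; the shift costs the factor `s`. The value `s = 1` yields the Gram
matrix, `s = -1` the overlap with the reflected states. -/
theorem pairing_succ (s : ℝ) (n k : ℕ) : √((n + 1 : ℕ) : ℝ) * pairing w s (n + 1) k =
    (s - 1) * w * pairing w s n k + s * √k * pairing w s n (k - 1) := by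
  have h1 : HasSum (fun j : ℕ => s ^ j * (√(j : ℝ) * displaced w n (j - 1) * displaced w k j))
      (s * w * pairing w s n k + s * √k * pairing w s n (k - 1)) := by
    rw [← hasSum_nat_add_iff' 1]
    simp only [Finset.range_one, Finset.sum_singleton, Nat.cast_zero, Real.sqrt_zero,
      zero_mul, mul_zero, sub_zero]
    refine (((hasSum_pairing w s n k).mul_left (s * w)).add
      ((hasSum_pairing w s n (k - 1)).mul_left (s * √k))).congr_fun fun j => ?_
    rw [Nat.add_sub_cancel, pow_succ]
    have := displaced_right_succ w k j
    linear_combination s ^ j * s * displaced w n j * this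
  have h2 := h1.sub ((hasSum_pairing w s n k).mul_left w)
  refine ((hasSum_pairing w s (n + 1) k).mul_left √((n + 1 : ℕ) : ℝ)).unique ?_
  have e : (s - 1) * w * pairing w s n k + s * √k * pairing w s n (k - 1) =
      s * w * pairing w s n k + s * √k * pairing w s n (k - 1) - w * pairing w s n k := by ring
  rw [e]
  refine h2.congr_fun fun j => ?_
  have := displaced_succ w n j
  linear_combination s ^ j * displaced w k j * this

theorem pairing_zero_zero (s : ℝ) : pairing w s 0 0 = Real.exp ((s - 1) * w ^ 2) := by
  have h1 := NormedSpace.exp_series_hasSum_exp' (𝕂 := ℝ) (s * w ^ 2)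
  rw [← Real.exp_eq_exp_ℝ] at h1
  have h2 := h1.mul_left (Real.exp (-w ^ 2))
  rw [← Real.exp_add] at h2
  have e : -w ^ 2 + s * w ^ 2 = (s - 1) * w ^ 2 := by ring
  rw [e] at h2
  refine (hasSum_pairing w s 0 0).unique (h2.congr_fun fun j => ?_)
  have e2 : √(j.factorial : ℝ) * √(j.factorial : ℝ) = j.factorial :=
    Real.mul_self_sqrt (Nat.cast_nonneg _)
  have e3 : Real.exp (-w ^ 2 / 2) * Real.exp (-w ^ 2 / 2) = Real.exp (-w ^ 2) := by
    rw [← Real.exp_add]; congr 1; ring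
  have e4 : √(j.factorial : ℝ) ≠ 0 := (Real.sqrt_pos.2 (by positivity)).ne'
  rw [displaced, smul_eq_mul, ← e3, mul_pow, ← pow_mul]
  generalize √(j.factorial : ℝ) = q at *
  rw [← e2]
  field_simp
  ring

theorem pairing_one (n k : ℕ) : pairing w 1 n k = if n = k then 1 else 0 := by
  have h0 : ∀ n, pairing w 1 (n + 1) 0 = 0 := by
    intro n
    have := pairing_succ w 1 n 0
    refine mul_left_cancel₀ (sqrt_succ_ne_zero n) ?_
    rw [this]; simp
  induction n generalizing k with
  | zero =>
    rcases k with _ | k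
    · simp [pairing_zero_zero]
    · rw [pairing_comm, h0]; simp
  | succ n ih =>
    rcases k with _ | k
    · rw [h0]; simp
    · have h1 := pairing_succ w 1 n (k + 1)
      rw [Nat.add_sub_cancel, ih k] at h1
      refine mul_left_cancel₀ (sqrt_succ_ne_zero n) ?_
      rw [h1]
      by_cases h : n = k
      · subst h; simp
      · simp [h]

/-- A Cauchy–Schwarz bound for unit vectors, obtained termwise from `2 |x y| ≤ x² + y²`. -/
theorem abs_pairing_neg_one_le (n k : ℕ) : |pairing w (-1) n k| ≤ 1 := by
  have hn := hasSum_pairing w 1 n n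
  have hk := hasSum_pairing w 1 k k
  rw [pairing_one, if_pos rfl] at hn hk
  have h := (hn.add hk).mul_left (1 / 2 : ℝ)
  have h2 : ‖∑' j, (-1 : ℝ) ^ j * (displaced w n j * displaced w k j)‖ ≤ 1 / 2 * (1 + 1) := by
    refine tsum_of_norm_bounded h fun j => ?_
    rw [norm_mul, norm_pow, norm_neg, norm_one, one_pow, one_mul, Real.norm_eq_abs, abs_mul]
    nlinarith [sq_nonneg (|displaced w n j| - |displaced w k j|), sq_abs (displaced w n j),
      sq_abs (displaced w k j)]
  rw [Real.norm_eq_abs] at h2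
  rw [pairing]
  linarith

/-- The ground state overlap is `exp (-2 w²)` and each step of the recursion costs at most one
factor `w`; the weight `w ^ i` in the statement lets the induction absorb these factors. -/
theorem tendsto_pow_mul_pairing (i n k : ℕ) :
    Tendsto (fun w => w ^ i * pairing w (-1) n k) atTop (𝓝 0) := by
  have h00 : ∀ i, Tendsto (fun w => w ^ i * pairing w (-1) 0 0) atTop (𝓝 0) := by
    intro i
    simp only [pairing_zero_zero]
    have h1 : Tendsto (fun w : ℝ => w ^ i * Real.exp (-w)) atTop (𝓝 0) :=
      Real.tendsto_pow_mul_exp_neg_atTop_nhds_zero i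
    refine squeeze_zero' (eventually_atTop.2 ⟨1, fun w hw => by positivity⟩)
      (eventually_atTop.2 ⟨1, fun w hw => ?_⟩) h1
    gcongr
    nlinarith
  have hk0 : ∀ k i, Tendsto (fun w => w ^ i * pairing w (-1) k 0) atTop (𝓝 0) := by
    intro k
    induction k with
    | zero => exact h00
    | succ k ih =>
      intro i
      have := (ih (i + 1)).const_mul (-2 / √((k + 1 : ℕ) : ℝ))
      rw [mul_zero] at this
      refine this.congr fun w => ?_
      have h1 := pairing_succ w (-1) k 0
      have h2 := sqrt_succ_ne_zero k
      simp only [Nat.cast_zero, Real.sqrt_zero, mul_zero, zero_mul, add_zero] at h1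
      field_simp
      rw [pow_succ]
      linear_combination (-w ^ i) * h1
  induction n generalizing i k with
  | zero =>
    simp only [pairing_comm _ _ 0 k]
    exact hk0 k i
  | succ n ih =>
    have := ((ih (i + 1) k).const_mul (-2 / √((n + 1 : ℕ) : ℝ))).add
      ((ih i (k - 1)).const_mul (-√k / √((n + 1 : ℕ) : ℝ)))
    rw [mul_zero, mul_zero, add_zero] at this
    refine this.congr fun w => ?_
    have h1 := pairing_succ w (-1) n k
    have h2 := sqrt_succ_ne_zero n
    field_simp
    rw [pow_succ]
    linear_combination (-w ^ i) * h1

theorem tendsto_pairing (n k : ℕ) : Tendsto (fun w => pairing w (-1) n k) atTop (𝓝 0) := by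
  simpa using tendsto_pow_mul_pairing 0 n k

end

/-! ### The Fock space in several variables and its embedding into `B(D)`. -/

section

variable {m : ℕ} {R : Fin m → ℝ}

/-- The Fock space in `m` variables, in coordinates. -/
abbrev Fock (m : ℕ) : Type := lp (fun _ : Fin m → ℕ => ℂ) 2

theorem summable_norm_sq_fock (x : Fock m) : Summable fun γ => ‖x γ‖ ^ 2 := by
  simpa using (lp.hasSum_norm (by norm_num) x).summable

theorem memFock_of_summable {f : (Fin m → ℕ) → ℂ} (hf : Summable fun γ => ‖f γ‖ ^ 2) :
    Memℓp f 2 :=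
  memℓp_gen (by simpa using hf)

theorem inner_coord (a b : ℂ) : inner ℂ a b = b * (starRingEnd ℂ) a := by
  simp [RCLike.inner_apply]

/-- Reflection on the Fock space. -/
noncomputable def fockParity (m : ℕ) : Fock m →ₗᵢ[ℂ] Fock m where
  toFun x := ⟨fun γ => (-1) ^ degree γ * x γ, memFock_of_summable (by
    simpa using summable_norm_sq_fock x)⟩
  map_add' x y := by ext γ; exact mul_add _ (x γ) (y γ)
  map_smul' a x := by ext γ; simp [mul_left_comm]
  norm_map' x := by
    have h1 := lp.hasSum_norm (by norm_num : 0 < (2 : ENNReal).toReal) x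
    have h2 := lp.hasSum_norm (by norm_num : 0 < (2 : ENNReal).toReal)
      (⟨fun γ => (-1) ^ degree γ * x γ, memFock_of_summable (by
        simpa using summable_norm_sq_fock x)⟩ : Fock m)
    simp only [norm_mul, norm_pow, norm_neg, norm_one, one_pow, one_mul] at h2
    have := h2.unique h1
    simp only [ENNReal.toReal_ofNat, Real.rpow_ofNat] at this
    exact (sq_eq_sq₀ (norm_nonneg _) (norm_nonneg _)).1 this

theorem fockParity_apply (x : Fock m) (γ : Fin m → ℕ) :
    fockParity m x γ = (-1) ^ degree γ * x γ := rfl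

theorem fockParity_fockParity (x : Fock m) : fockParity m (fockParity m x) = x := by
  ext γ
  rw [fockParity_apply, fockParity_apply, ← mul_assoc, ← mul_pow]
  simp

theorem inner_fockParity (x y : Fock m) :
    inner ℂ (fockParity m x) y = inner ℂ x (fockParity m y) := by
  rw [← (fockParity m).inner_map_map x, fockParity_fockParity]

/-- Multivariate displaced number states. -/
noncomputable def prodDisplaced (w : Fin m → ℝ) (α γ : Fin m → ℕ) : ℝ :=
  ∏ l, displaced (w l) (α l) (γ l)

theorem prodDisplaced_swap (w : Fin m → ℝ) (α γ : Fin m → ℕ) :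
    prodDisplaced w γ α = (-1) ^ degree α * (-1) ^ degree γ * prodDisplaced w α γ := by
  simp only [prodDisplaced, degree, ← Finset.prod_pow_eq_pow_sum, ← Finset.prod_mul_distrib,
    ← pow_add]
  exact Finset.prod_congr rfl fun l _ => displaced_swap _ _ _

theorem hasSum_prodDisplaced (w : Fin m → ℝ) (s : ℝ) (α β : Fin m → ℕ) :
    HasSum (fun γ => s ^ degree γ * (prodDisplaced w α γ * prodDisplaced w β γ))
      (∏ l, pairing (w l) s (α l) (β l)) := by
  have h := (hasSum_prod_pi
    (fun l => Complex.hasSum_ofReal.2 (hasSum_pairing (w l) s (α l) (β l)))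
    (fun l => (Summable.hasSum (by
      simpa [abs_mul] using summable_displaced_mul (w l) (α l) (β l) s)))).1
  rw [← Complex.hasSum_ofReal, Complex.ofReal_prod]
  refine h.congr_fun fun γ => ?_
  rw [← Complex.ofReal_prod]
  simp only [prodDisplaced, degree, ← Finset.prod_pow_eq_pow_sum, ← Finset.prod_mul_distrib]

theorem prod_pairing_one (w : Fin m → ℝ) (α β : Fin m → ℕ) :
    ∏ l, pairing (w l) 1 (α l) (β l) = if α = β then 1 else 0 := by
  simp only [pairing_one]
  split_ifs with h
  · simp [h]
  · obtain ⟨l, hl⟩ := Function.ne_iff.1 h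
    exact Finset.prod_eq_zero (Finset.mem_univ l) (if_neg hl)

/-- Displaced number states as elements of the Fock space. -/
noncomputable def coherent (w : Fin m → ℝ) (α : Fin m → ℕ) : Fock m :=
  ⟨fun γ => prodDisplaced w α γ, memFock_of_summable (by
    have := (hasSum_prodDisplaced w 1 α α).summable
    simpa [sq] using this)⟩

theorem coherent_apply (w : Fin m → ℝ) (α γ : Fin m → ℕ) :
    coherent w α γ = (prodDisplaced w α γ : ℂ) := rfl

theorem inner_coherent (w : Fin m → ℝ) (α β : Fin m → ℕ) :
    inner ℂ (coherent w α) (coherent w β) = if α = β then 1 else 0 := by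
  have h1 := lp.hasSum_inner (𝕜 := ℂ) (coherent w α) (coherent w β)
  have h2 := Complex.hasSum_ofReal.2 (hasSum_prodDisplaced w 1 α β)
  rw [prod_pairing_one] at h2
  refine (h1.unique (h2.congr_fun fun γ => ?_)).trans (by split_ifs <;> simp)
  rw [inner_coord, coherent_apply, coherent_apply, Complex.conj_ofReal]
  push_cast
  ring

theorem inner_coherent_fockParity (w : Fin m → ℝ) (α β : Fin m → ℕ) :
    inner ℂ (coherent w α) (fockParity m (coherent w β)) =
      ((∏ l, pairing (w l) (-1) (α l) (β l) : ℝ) : ℂ) := by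
  have h1 := lp.hasSum_inner (𝕜 := ℂ) (coherent w α) (fockParity m (coherent w β))
  have h2 := Complex.hasSum_ofReal.2 (hasSum_prodDisplaced w (-1) α β)
  refine h1.unique (h2.congr_fun fun γ => ?_)
  rw [inner_coord, fockParity_apply, coherent_apply, coherent_apply, Complex.conj_ofReal]
  push_cast
  ring

theorem orthonormal_coherent (w : Fin m → ℝ) : Orthonormal ℂ (coherent w) := by
  rw [orthonormal_iff_ite]
  exact inner_coherent w

theorem hasSum_coherent_apply {y : Fock m} {I : Type} {f : I → Fock m} (h : HasSum f y)
    (γ : Fin m → ℕ) : HasSum (fun i => f i γ) (y γ) := by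
  classical
  have := h.mapL (innerSL ℂ (lp.single 2 γ (1 : ℂ) : Fock m))
  simpa [lp.inner_single_left] using this

theorem orthogonal_coherent (w : Fin m → ℝ) :
    (Submodule.span ℂ (Set.range (coherent w)))ᗮ = ⊥ := by
  classical
  rw [eq_bot_iff]
  intro x hx
  rw [Submodule.mem_bot]
  have hx' : ∀ α, inner ℂ x (coherent w α) = 0 := fun α =>
    (Submodule.mem_orthogonal' _ _).1 hx _ (Submodule.subset_span ⟨α, rfl⟩)
  ext γ
  -- Candidate expansion of a coordinate vector in the displaced states. By `prodDisplaced_swap` its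
  -- coefficients have the same squares as one normalized state.
  have hs : Summable fun α => (coherent w α γ) • coherent w α := by
    have h1 := (orthonormal_coherent w).orthogonalFamily.summable_iff_norm_sq_summable
      (fun α => coherent w α γ)
    refine h1.2 ((hasSum_prodDisplaced w 1 γ γ).summable.congr fun α => ?_)
    rw [coherent_apply, prodDisplaced_swap w γ α, Complex.norm_real]
    simp [sq]
  have hsum : HasSum (fun α => (coherent w α γ) • coherent w α) (lp.single 2 γ (1 : ℂ)) := by
    have : ∑' α, (coherent w α γ) • coherent w α = lp.single 2 γ (1 : ℂ) := by
      ext δ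
      have h1 := hasSum_coherent_apply hs.hasSum δ
      -- Orthogonality of the columns is orthogonality of the rows after the transposition symmetry;
      -- the signs depending on `α` cancel in pairs.
      have h2 := (Complex.hasSum_ofReal.2 (hasSum_prodDisplaced w 1 γ δ)).mul_left
        ((-1) ^ degree γ * (-1) ^ degree δ)
      rw [prod_pairing_one] at h2
      rw [h1.unique (h2.congr_fun fun α => ?_)]
      · by_cases hγ : γ = δ
        · subst hγ
          simp [← mul_pow]
        · simp [hγ, lp.single_apply, Ne.symm hγ]
      · rw [lp.coeFn_smul, Pi.smul_apply, coherent_apply, coherent_apply, smul_eq_mul,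
          prodDisplaced_swap w γ α, prodDisplaced_swap w δ α]
        have e : ((-1 : ℂ) ^ degree α) * (-1) ^ degree α = 1 := by rw [← mul_pow]; simp
        push_cast
        linear_combination (-1 : ℂ) ^ degree γ * (-1) ^ degree δ * (prodDisplaced w γ α : ℂ) *
          (prodDisplaced w δ α : ℂ) * e
    exact this ▸ hs.hasSum
  -- A vector orthogonal to all displaced states is therefore orthogonal to all coordinate vectors.
  have h3 := hsum.mapL (innerSL ℂ x)
  simp only [innerSL_apply_apply, inner_smul_right, hx', mul_zero] at h3
  have h4 : inner ℂ x (lp.single 2 γ (1 : ℂ)) = 0 := h3.unique hasSum_zero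
  have h5 := inner_eq_zero_symm.1 h4
  rw [lp.inner_single_left] at h5
  simpa using h5

theorem hasSum_coherent (w : Fin m → ℝ) (x : Fock m) :
    HasSum (fun α => inner ℂ (coherent w α) x • coherent w α) x := by
  let b := HilbertBasis.mkOfOrthogonalEqBot (orthonormal_coherent w) (orthogonal_coherent w)
  have hb : ∀ α, b α = coherent w α := fun α => by
    simp [b, HilbertBasis.coe_mkOfOrthogonalEqBot]
  have := b.hasSum_repr x
  simpa only [b.repr_apply_apply, hb] using this

variable {t : Fin m → ℝ}

theorem summable_fock_coeff (ht : ∀ l, 0 < t l) (x : Fock m) {ρ : Fin m → ℝ} (hρ : ∀ l, 0 < ρ l) :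
    Summable fun γ => ‖x γ * (fockWeight t γ : ℂ)‖ * monomial ρ γ := by
  refine Summable.of_nonneg_of_le
    (fun γ => mul_nonneg (norm_nonneg _) (monomial_nonneg (fun l => (hρ l).le) γ)) (fun γ => ?_)
    ((summable_fockWeight ht hρ).mul_left ‖x‖)
  rw [norm_mul, Complex.norm_real, Real.norm_eq_abs, abs_of_pos (fockWeight_pos ht γ), mul_assoc]
  exact mul_le_mul_of_nonneg_right (lp.norm_apply_le_norm (by norm_num) x γ)
    (mul_nonneg (fockWeight_pos ht γ).le (monomial_nonneg (fun l => (hρ l).le) γ))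

theorem norm_fock_term_le (ht : ∀ l, 0 < t l) (z : Fin m → ℂ) (x : Fock m) (γ : Fin m → ℕ) :
    ‖x γ * (fockWeight t γ : ℂ) * zpow z γ‖ ≤
      ‖x‖ * (fockWeight t γ * monomial (fun l => ‖z l‖ + 1) γ) := by
  rw [norm_mul, norm_mul, Complex.norm_real, Real.norm_eq_abs, abs_of_pos (fockWeight_pos ht γ),
    norm_zpow, mul_assoc]
  have h1 : monomial (fun l => ‖z l‖) γ ≤ monomial (fun l => ‖z l‖ + 1) γ :=
    monomial_mono (fun l => norm_nonneg _) (fun l => by linarith) γ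
  have h2 := fockWeight_pos ht γ
  have h3 : 0 ≤ monomial (fun l => ‖z l‖) γ := monomial_nonneg (fun l => norm_nonneg _) γ
  have h4 := lp.norm_apply_le_norm (by norm_num) x γ
  gcongr

theorem summable_fock_term (ht : ∀ l, 0 < t l) (z : Fin m → ℂ) (x : Fock m) :
    Summable fun γ => x γ * (fockWeight t γ : ℂ) * zpow z γ :=
  Summable.of_norm_bounded
    ((summable_fockWeight ht (ρ := fun l => ‖z l‖ + 1) fun l => by positivity).mul_left ‖x‖)
    (norm_fock_term_le ht z x)

/-- Evaluation at a point of the entire function given by an element of the Fock space. -/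
noncomputable def fockEval (ht : ∀ l, 0 < t l) (z : Fin m → ℂ) : Fock m →L[ℂ] ℂ :=
  LinearMap.mkContinuous
    { toFun := fun x => ∑' γ, x γ * (fockWeight t γ : ℂ) * zpow z γ
      map_add' := fun x y => by
        rw [← (summable_fock_term ht z x).tsum_add (summable_fock_term ht z y)]
        simp [add_mul]
      map_smul' := fun a x => by
        rw [RingHom.id_apply, smul_eq_mul, ← tsum_mul_left]
        simp [mul_assoc] }
    (∑' γ, fockWeight t γ * monomial (fun l => ‖z l‖ + 1) γ) fun x => by
      rw [mul_comm]
      exact tsum_of_norm_bounded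
        ((summable_fockWeight ht (ρ := fun l => ‖z l‖ + 1) fun l => by positivity).hasSum.mul_left
            ‖x‖)
        (norm_fock_term_le ht z x)

theorem hasSum_fockEval (ht : ∀ l, 0 < t l) (z : Fin m → ℂ) (x : Fock m) :
    HasSum (fun γ => x γ * (fockWeight t γ : ℂ) * zpow z γ) (fockEval ht z x) :=
  (summable_fock_term ht z x).hasSum

theorem zpow_neg (z : Fin m → ℂ) (γ : Fin m → ℕ) : zpow (-z) γ = (-1) ^ degree γ * zpow z γ := by
  simp only [zpow, degree, ← Finset.prod_pow_eq_pow_sum, ← Finset.prod_mul_distrib]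
  exact Finset.prod_congr rfl fun l _ => by rw [Pi.neg_apply, neg_pow]

theorem fockEval_fockParity (ht : ∀ l, 0 < t l) (z : Fin m → ℂ) (x : Fock m) :
    fockEval ht z (fockParity m x) = fockEval ht (-z) x := by
  refine (hasSum_fockEval ht z _).unique ((hasSum_fockEval ht (-z) x).congr_fun fun γ => ?_)
  rw [fockParity_apply, zpow_neg]
  ring

theorem fockEval_coherent (ht : ∀ l, 0 < t l) (z : Fin m → ℂ) (w : Fin m → ℝ) (α : Fin m → ℕ) :
    fockEval ht z (coherent w α) = ∏ l, Complex.exp (w l * (z l / t l) - w l ^ 2 / 2) *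
      (z l / t l - w l) ^ α l / (√((α l).factorial) : ℝ) := by
  have h := (hasSum_prod_pi (fun l => hasSum_displaced (w l) (α l) (z l / t l))
    (fun l => (Summable.hasSum (by
      refine (summable_pow_mul_displaced (w l) (α l) ‖z l / t l‖).congr fun k => ?_
      rw [abs_norm, norm_mul, norm_div _ (((√_ : ℝ) : ℂ)), norm_pow, Complex.norm_real,
        Complex.norm_real, Real.norm_eq_abs, Real.norm_eq_abs, abs_of_nonneg
            (Real.sqrt_nonneg _)])))).1
  refine (hasSum_fockEval ht z _).unique (h.congr_fun fun γ => ?_)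
  rw [coherent_apply, prodDisplaced, fockWeight, zpow, monomial, mfact, Nat.cast_prod,
    Real.sqrt_prod _ fun _ _ => Nat.cast_nonneg _, ← Finset.prod_mul_distrib,
    ← Finset.prod_inv_distrib, Complex.ofReal_prod, Complex.ofReal_prod,
    ← Finset.prod_mul_distrib, ← Finset.prod_mul_distrib]
  refine Finset.prod_congr rfl fun l _ => ?_
  push_cast
  rw [div_pow, mul_inv]
  ring

/-- The embedding of the Fock space into `B(D)`. -/
noncomputable def fockMap (R : Fin m → ℝ) (ht : ∀ l, 0 < t l) : Fock m →ₗ[ℂ] HoloSpace R where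
  toFun x := seriesHolo R (fun γ => x γ * (fockWeight t γ : ℂ))
    fun _ hρ => summable_fock_coeff ht x hρ
  map_add' x y := HoloSpace.ext fun z => (fockEval ht z.1).map_add x y
  map_smul' a x := HoloSpace.ext fun z => (fockEval ht z.1).map_smul a x

theorem hasExpansion_fockMap (R : Fin m → ℝ) (ht : ∀ l, 0 < t l) (x : Fock m) {r : Fin m → ℝ}
    (hr : ∀ l, 0 < r l) : ∃ B, HasExpansion Subtype.val (fun z => (fockMap R ht x).1 z) r B
      (fun γ => x γ * (fockWeight t γ : ℂ)) :=
  ⟨_, summable_fock_coeff ht x hr, le_rfl, fun z _ => hasSum_fockEval ht z.1 x⟩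

theorem fockMap_injective (hR : ∀ l, 0 < R l) (ht : ∀ l, 0 < t l) :
    Function.Injective (fockMap R ht) := by
  intro x y hxy
  obtain ⟨B, h1⟩ := hasExpansion_fockMap R ht x hR
  obtain ⟨B', h2⟩ := hasExpansion_fockMap R ht y hR
  rw [hxy] at h1
  have h := HasExpansion.unique hR (fun l => le_rfl) h1 h2
  ext γ
  exact mul_right_cancel₀ (Complex.ofReal_ne_zero.2 (fockWeight_pos ht γ).ne') (congrFun h γ)

theorem reflection_fockMap (ht : ∀ l, 0 < t l) (x : Fock m) :
    reflection R (fockMap R ht x) = fockMap R ht (fockParity m x) :=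
  HoloSpace.ext fun z => (fockEval_fockParity ht z.1 x).symm

end

/-! ### Comparison of `B(D)` with the Fock space, and diagonalization of a single branch. -/

section

variable {m : ℕ} {lam R : Fin m → ℝ}

theorem Admissible.radius_pos (h : Admissible lam R) (l : Fin m) : 0 < R l :=
  (div_nonneg (h.nonneg l) (by linarith [h.lt_one l])).trans_lt (h.radius l)

/-- Elements of `B(D)` with the same Taylor coefficients are equal. -/
theorem HoloSpace.eq_of_expansion (hR : ∀ l, 0 < R l) {f g : HoloSpace R} {r : Fin m → ℝ}
    (hr : ∀ l, 0 < r l) (hrR : ∀ l, r l < R l) {B B' : ℝ} {c : (Fin m → ℕ) → ℂ}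
    (hf : HasExpansion Subtype.val (fun z => f.1 z) r B c)
    (hg : HasExpansion Subtype.val (fun z => g.1 z) r B' c) : f = g := by
  -- Inside the open polydisc a Taylor expansion at a radius reaching `z` has the given
  -- coefficients; boundary points are then limits along rays from the origin.
  have hopen : ∀ z : closedPolydisc R, (∀ l, ‖z.1 l‖ < R l) → f.1 z = g.1 z := by
    intro z hz
    have h1 : ∀ l, 0 < max (r l) ‖z.1 l‖ := fun l => lt_max_of_lt_left (hr l)
    have h2 : ∀ l, max (r l) ‖z.1 l‖ < R l := fun l => max_lt (hrR l) (hz l)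
    have h3 : ∀ l, r l ≤ max (r l) ‖z.1 l‖ := fun l => le_max_left _ _
    obtain ⟨B₁, c₁, hc₁⟩ := exists_maj_holoSpace f h1 h2
    obtain ⟨B₂, c₂, hc₂⟩ := exists_maj_holoSpace g h1 h2
    have e₁ := HasExpansion.unique hr (fun l => (hrR l).le)
      (hc₁.mono_radius (fun l => (hr l).le) h3) hf
    have e₂ := HasExpansion.unique hr (fun l => (hrR l).le)
      (hc₂.mono_radius (fun l => (hr l).le) h3) hg
    subst e₁ e₂
    exact (hc₁.hasSum z fun l => le_max_right _ _).unique (hc₂.hasSum z fun l => le_max_right _ _)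
  refine HoloSpace.ext fun z => ?_
  have hmem : ∀ s : Set.Icc (0 : ℝ) 1, (s.1 : ℂ) • z.1 ∈ closedPolydisc R := by
    intro s l
    rw [Pi.smul_apply, norm_smul, Complex.norm_real, Real.norm_eq_abs, abs_of_nonneg s.2.1]
    exact (mul_le_of_le_one_left (norm_nonneg _) s.2.2).trans (z.2 l)
  let φ : Set.Icc (0 : ℝ) 1 → closedPolydisc R := fun s => ⟨(s.1 : ℂ) • z.1, hmem s⟩
  have hφ : Continuous φ := by
    refine Continuous.subtype_mk ?_ _
    fun_prop
  have hcl : IsClosed {s | f.1 (φ s) = g.1 (φ s)} :=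
    isClosed_eq (f.1.continuous.comp hφ) (g.1.continuous.comp hφ)
  let one : Set.Icc (0 : ℝ) 1 := ⟨1, by simp⟩
  have hone : one ∈ closure {s | f.1 (φ s) = g.1 (φ s)} := by
    rw [mem_closure_iff_seq_limit]
    refine ⟨fun n => ⟨1 - 1 / ((n : ℝ) + 1), ?_, ?_⟩, fun n => hopen _ fun l => ?_, ?_⟩
    · have : (1 : ℝ) / (n + 1) ≤ 1 := by
        rw [div_le_one (by positivity)]; linarith [n.cast_nonneg (α := ℝ)]
      linarith
    · have : (0 : ℝ) ≤ 1 / (n + 1) := by positivity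
      linarith
    · have h0 : (0 : ℝ) < 1 / (n + 1) := by positivity
      have h1 : (1 : ℝ) / (n + 1) ≤ 1 := by
        rw [div_le_one (by positivity)]; linarith [n.cast_nonneg (α := ℝ)]
      change ‖((1 - 1 / ((n : ℝ) + 1) : ℝ) : ℂ) * z.1 l‖ < R l
      rw [norm_mul, Complex.norm_real, Real.norm_eq_abs, abs_of_nonneg (by linarith)]
      have := z.2 l
      have := hR l
      nlinarith [norm_nonneg (z.1 l)]
    · rw [tendsto_subtype_rng]
      simpa using tendsto_one_div_add_atTop_nhds_zero_nat.const_sub (1 : ℝ)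
  rw [hcl.closure_eq] at hone
  have e : φ one = z := Subtype.ext (by simp [φ, one])
  simpa [e] using hone

/-- Generalized eigenfunctions of the transfer operator lie in every Fock space. -/
theorem exists_fockMap_eq {J : Fin m → ℝ} (hJ : ∀ l, 0 ≤ J l) (h : Admissible lam R) (β : ℝ)
    {μ : ℂ} (hμ : μ ≠ 0) {t : Fin m → ℝ} (ht : ∀ l, 0 < t l) {f : HoloSpace R}
    (hf : f ∈ Module.End.maxGenEigenspace (ruelle J h β) μ) : ∃ x, fockMap R ht x = f := by
  obtain ⟨r, s, C, κ, hr, hrR, hs, hC, hκ, -, H⟩ := exists_coeff_of_genEigen hJ h β hμ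
  obtain ⟨c, K, B, hK, hexp, hc⟩ := H f hf
  have hsum := summable_fock_of_bound hr ht hs hC hκ hK hc
  let x : Fock m := ⟨fun γ => c γ * ((fockWeight t γ)⁻¹ : ℝ), memFock_of_summable (by
    refine hsum.congr fun γ => ?_
    rw [norm_mul, Complex.norm_real, Real.norm_eq_abs,
      abs_of_pos (inv_pos.2 (fockWeight_pos ht γ))])⟩
  refine ⟨x, ?_⟩
  obtain ⟨B', hx⟩ := hasExpansion_fockMap R ht x hr
  have e : (fun γ => x γ * (fockWeight t γ : ℂ)) = c := by
    funext γ
    change c γ * ((fockWeight t γ)⁻¹ : ℝ) * (fockWeight t γ : ℂ) = c γ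
    have := Complex.ofReal_ne_zero.2 (fockWeight_pos ht γ).ne'
    push_cast
    field_simp
  rw [e] at hx
  exact HoloSpace.eq_of_expansion h.radius_pos hr hrR hx hexp

/-- Scales `t` and displacements `b` in which the transfer operator at inverse temperature `±B` is
self-adjoint. -/
structure Scales (J lam : Fin m → ℝ) (B : ℝ) (t b : Fin m → ℝ) : Prop where
  pos : ∀ l, 0 < t l
  left : ∀ l, B * J l * t l = b l
  right : ∀ l, lam l = t l * b l

/-- The displacement `b / (1 - σ λ)`. -/
noncomputable def displacement (lam : Fin m → ℝ) (σ : ℝ) (b : Fin m → ℝ) : Fin m → ℝ :=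
  fun l => b l / (1 - σ * lam l)

theorem one_sub_mul_pos (h : Admissible lam R) {σ : ℝ} (hσ : |σ| ≤ 1) (l : Fin m) :
    0 < 1 - σ * lam l := by
  have h1 := h.nonneg l
  have h2 := h.lt_one l
  have h3 := le_of_abs_le hσ
  nlinarith

/-- In the variable `u = z / t` the branch is `u ↦ w + σ λ (u - w)`, so the power of `u - w` is
multiplied by `(σ λ) ^ α`. In the Gaussian factor the weight `exp (b u)` restores the exponent `w
u`, and the constant left over is `w b = B J λ / (1 - σ λ)`. -/
theorem weight_mul_fockEval_coherent {J t b : Fin m → ℝ} {B σ : ℝ} (h : Admissible lam R)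
    (hσ : |σ| ≤ 1) (hs : Scales J lam B t b) (z : Fin m → ℂ) (α : Fin m → ℕ) :
    weight J B z * fockEval hs.pos (fun l => σ * lam l * z l + lam l)
        (coherent (displacement lam σ b) α) =
      Complex.exp ((B * ∑ l, J l * (lam l / (1 - σ * lam l)) : ℝ)) *
        ((σ ^ degree α * monomial lam α : ℝ) *
          fockEval hs.pos z (coherent (displacement lam σ b) α)) := by
  rw [fockEval_coherent, fockEval_coherent, weight, degree, monomial,
    ← Finset.prod_pow_eq_pow_sum, ← Finset.prod_mul_distrib, Finset.mul_sum, Finset.mul_sum,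
    Complex.exp_sum, Complex.ofReal_sum, Complex.exp_sum, Complex.ofReal_prod,
    ← Finset.prod_mul_distrib, ← Finset.prod_mul_distrib, ← Finset.prod_mul_distrib]
  refine Finset.prod_congr rfl fun l _ => ?_
  have h0 := one_sub_mul_pos h hσ l
  have ht := (hs.pos l).ne'
  have hb := hs.left l
  have hl := hs.right l
  set w := displacement lam σ b l with hw
  have hwb : w * (1 - σ * lam l) = b l := by
    rw [hw, displacement]; field_simp
  have e1 : ((σ * lam l * z l + lam l) / t l : ℂ) - w = σ * lam l * (z l / t l - w) := by
    have h1 : (lam l : ℂ) = t l * b l := by exact_mod_cast hl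
    have h2 : ((w : ℂ)) * (1 - σ * lam l) = b l := by exact_mod_cast hwb
    have h3 : (t l : ℂ) ≠ 0 := by exact_mod_cast ht
    have h4 : (lam l : ℂ) / t l = b l := by rw [h1]; field_simp
    rw [add_div, h4, ← h2]
    ring
  have e2 : (B : ℂ) * (J l * z l) = b l * (z l / t l) := by
    have h1 : (B : ℂ) * J l * t l = b l := by exact_mod_cast hb
    have h3 : (t l : ℂ) ≠ 0 := by exact_mod_cast ht
    rw [← h1]; field_simp
  have e3 : B * (J l * (lam l / (1 - σ * lam l))) = w * b l := by
    rw [hw, displacement, ← hb, hl, ← hb]; field_simp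
  have e4 : ((σ * lam l * z l + lam l) / t l : ℂ) = w + σ * lam l * (z l / t l - w) := by
    rw [← e1]; ring
  rw [e1, e2, e3, mul_pow]
  have e5 : Complex.exp (b l * (z l / t l)) *
      Complex.exp (w * ((σ * lam l * z l + lam l) / t l) - w ^ 2 / 2) =
      Complex.exp ((w * b l : ℝ)) * Complex.exp (w * (z l / t l) - w ^ 2 / 2) := by
    rw [← Complex.exp_add, ← Complex.exp_add, e4, ← hwb]
    congr 1
    push_cast
    ring
  push_cast at *
  linear_combination ((σ * lam l : ℂ) ^ α l * (z l / t l - w) ^ α l /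
    (√((α l).factorial) : ℝ)) * e5

end

/-! ### The self-adjoint model on functions of fixed parity. -/

section

variable {m : ℕ} {lam R : Fin m → ℝ}

/-- Displaced number states symmetrized to parity `ε`. -/
noncomputable def symCoherent (ε : ℝ) (w : Fin m → ℝ) (α : Fin m → ℕ) : Fock m :=
  (((√2)⁻¹ : ℝ) : ℂ) • (coherent w α + (ε : ℂ) • fockParity m (coherent w α))

theorem inv_sqrt_two_mul_self : (((√2)⁻¹ : ℝ) : ℂ) * (((√2)⁻¹ : ℝ) : ℂ) = 1 / 2 := by
  rw [← Complex.ofReal_mul, ← mul_inv, Real.mul_self_sqrt zero_le_two]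
  norm_num

theorem norm_coherent (w : Fin m → ℝ) (α : Fin m → ℕ) : ‖coherent w α‖ = 1 :=
  (orthonormal_coherent w).1 α

variable {ε : ℝ}

theorem fockParity_symCoherent (hε : ε * ε = 1) (w : Fin m → ℝ) (α : Fin m → ℕ) :
    fockParity m (symCoherent ε w α) = (ε : ℂ) • symCoherent ε w α := by
  have h : (ε : ℂ) * ε = 1 := by exact_mod_cast hε
  rw [symCoherent, map_smul, map_add, map_smul, fockParity_fockParity, smul_comm (ε : ℂ),
    smul_add (ε : ℂ), smul_smul (ε : ℂ), h, one_smul, add_comm]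

theorem norm_symCoherent_le (hε : ε * ε = 1) (w : Fin m → ℝ) (α : Fin m → ℕ) :
    ‖symCoherent ε w α‖ ≤ 2 := by
  have h1 : ‖(ε : ℂ)‖ = 1 := by
    rw [Complex.norm_real, Real.norm_eq_abs]
    rcases mul_self_eq_one_iff.1 hε with rfl | rfl <;> simp
  have h2 : (√2)⁻¹ ≤ 1 := inv_le_one_of_one_le₀ (by rw [Real.one_le_sqrt]; norm_num)
  rw [symCoherent, norm_smul, Complex.norm_real, Real.norm_eq_abs, abs_of_nonneg (by positivity)]
  have h3 : ‖coherent w α + (ε : ℂ) • fockParity m (coherent w α)‖ ≤ 2 := by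
    refine (norm_add_le _ _).trans ?_
    rw [norm_smul, LinearIsometry.norm_map, norm_coherent, h1]
    norm_num
  have := norm_nonneg (coherent w α + (ε : ℂ) • fockParity m (coherent w α))
  nlinarith

theorem inner_symCoherent_of_parity (hε : ε * ε = 1) (w : Fin m → ℝ) (α : Fin m → ℕ) {x : Fock m}
    (hx : fockParity m x = (ε : ℂ) • x) :
    inner ℂ (symCoherent ε w α) x = (((√2)⁻¹ : ℝ) : ℂ) * (2 * inner ℂ (coherent w α) x) := by
  have h : (ε : ℂ) * ε = 1 := by exact_mod_cast hε
  rw [symCoherent, inner_smul_left, inner_add_left, inner_smul_left, inner_fockParity, hx,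
    inner_smul_right, Complex.conj_ofReal, Complex.conj_ofReal, ← mul_assoc (ε : ℂ), h]
  ring

/-- The deviation of the Gram matrix from the identity is exactly the overlap of displaced states
with reflected ones. -/
theorem inner_symCoherent (hε : ε * ε = 1) (w : Fin m → ℝ) (α γ : Fin m → ℕ) :
    inner ℂ (symCoherent ε w α) (symCoherent ε w γ) =
      (((if α = γ then 1 else 0) + ε * ∏ l, pairing (w l) (-1) (α l) (γ l) : ℝ) : ℂ) := by
  rw [inner_symCoherent_of_parity hε w α (fockParity_symCoherent hε w γ), symCoherent,
    inner_smul_right, inner_add_right, inner_smul_right, inner_coherent, inner_coherent_fockParity]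
  have := inv_sqrt_two_mul_self
  split_ifs <;> push_cast at *
  · linear_combination (2 * (1 + ε * ∏ l, (pairing (w l) (-1) (α l) (γ l) : ℂ))) * this
  · linear_combination (2 * (0 + ε * ∏ l, (pairing (w l) (-1) (α l) (γ l) : ℂ))) * this

variable {d : (Fin m → ℕ) → ℝ}

theorem fockParity_frameOp (hε : ε * ε = 1) (hd : Summable fun α => |d α|) (w : Fin m → ℝ)
    (y : Fock m) :
    fockParity m (frameOp d (symCoherent ε w) y) = (ε : ℂ) • frameOp d (symCoherent ε w) y := by
  have h := hasSum_frameOp hd (norm_symCoherent_le hε w) y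
  have h1 := h.mapL (fockParity m).toContinuousLinearMap
  refine h1.unique ((h.const_smul (ε : ℂ)).congr_fun fun α => ?_)
  rw [LinearIsometry.coe_toContinuousLinearMap, map_smul, fockParity_symCoherent hε, smul_comm]

/-- On functions of parity `ε` the transfer operator is a multiple of a self-adjoint operator on
the Fock space. -/
theorem ruelle_fockMap (hε : ε * ε = 1) (hd : Summable fun α => |d α|)
    {J t b : Fin m → ℝ} {B σ κ : ℝ} (h : Admissible lam R)
    (hσ : σ = 1 ∧ κ = 1 ∨ σ = -1 ∧ κ = ε) (hs : Scales J lam B t b)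
    (hdef : ∀ α, d α = κ * (σ ^ degree α * monomial lam α)) {x : Fock m}
    (hx : fockParity m x = (ε : ℂ) • x) :
    ruelle J h ((σ * B : ℝ) : ℂ) (fockMap R hs.pos x) =
      Complex.exp ((B * ∑ l, J l * (lam l / (1 - σ * lam l)) : ℝ)) •
        fockMap R hs.pos (frameOp d (symCoherent ε (displacement lam σ b)) x) := by
  have hεc : (ε : ℂ) * ε = 1 := by exact_mod_cast hε
  have hσ1 : |σ| ≤ 1 := by rcases hσ with ⟨rfl, -⟩ | ⟨rfl, -⟩ <;> simp
  set w := displacement lam σ b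
  set c := Complex.exp ((B * ∑ l, J l * (lam l / (1 - σ * lam l)) : ℝ))
  have hneg : ∀ z, fockEval hs.pos (-z) x = ε * fockEval hs.pos z x := by
    intro z
    rw [← fockEval_fockParity, hx, map_smul, smul_eq_mul]
  have hW : ∀ z : Fin m → ℂ, HasSum (fun α => inner ℂ (coherent w α) x *
      (c * ((σ ^ degree α * monomial lam α : ℝ) * fockEval hs.pos z (coherent w α))))
      (weight J B z * fockEval hs.pos (fun l => σ * lam l * z l + lam l) x) := by
    intro z
    have h1 := ((hasSum_coherent w x).mapL
      (fockEval hs.pos (fun l => σ * lam l * z l + lam l))).mul_left (weight J B z)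
    refine h1.congr_fun fun α => ?_
    rw [← weight_mul_fockEval_coherent h hσ1 hs, map_smul, smul_eq_mul]
    ring
  have hT : ∀ z : Fin m → ℂ, HasSum (fun α => (d α : ℂ) * inner ℂ (coherent w α) x *
      (fockEval hs.pos z (coherent w α) + ε * fockEval hs.pos (-z) (coherent w α)))
      (fockEval hs.pos z (frameOp d (symCoherent ε w) x)) := by
    intro z
    have h1 := (hasSum_frameOp hd (norm_symCoherent_le hε w) x).mapL (fockEval hs.pos z)
    refine h1.congr_fun fun α => ?_
    rw [inner_symCoherent_of_parity hε w α hx, map_smul, symCoherent, map_smul, map_add, map_smul,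
      fockEval_fockParity]
    simp only [smul_eq_mul]
    linear_combination (-2 * (d α : ℂ) * inner ℂ (coherent w α) x *
      (fockEval hs.pos z (coherent w α) +
      ε * fockEval hs.pos (-z) (coherent w α))) * inv_sqrt_two_mul_self
  refine HoloSpace.ext fun z => ?_
  change weight J ((σ * B : ℝ) : ℂ) z * fockEval hs.pos (affine lam 1 z) x +
    weight J (-((σ * B : ℝ) : ℂ)) z * fockEval hs.pos (affine lam (-1) z) x =
      c * fockEval hs.pos z (frameOp d (symCoherent ε w) x)
  have hw : ∀ a, weight J (-a) z.1 = weight J a (-z.1) := by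
    intro a
    simp only [weight, Pi.neg_apply, mul_neg, Finset.sum_neg_distrib, neg_mul]
  -- With `W` the single branch, `κ (W + ε P W)` is the transfer operator on parity `ε`. For `σ =
  -- -1` parity is also used to rewrite `f (Λ z - λ)` as `ε f (-Λ z + λ)`, which accounts for `κ =
  -- ε`.
  have hsum := (((hW z.1).add ((hW (-z.1)).mul_left (ε : ℂ))).mul_left (κ : ℂ))
  have hrhs := hsum.unique (((hT z.1).mul_left c).congr_fun fun α => by
    rw [hdef]; push_cast; ring)
  rw [← hrhs]
  rcases hσ with ⟨rfl, rfl⟩ | ⟨rfl, rfl⟩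
  · have e1 : affine lam 1 z.1 = fun l => ((1 : ℝ) : ℂ) * lam l * z.1 l + lam l := by
      funext l; simp [affine]
    have e2 : affine lam (-1) z.1 = -fun l => ((1 : ℝ) : ℂ) * lam l * (-z.1) l + lam l := by
      funext l; simp [affine]; ring
    rw [e1, e2, hneg, hw]
    push_cast
    ring_nf
  · have e1 : affine lam 1 z.1 = fun l => ((-1 : ℝ) : ℂ) * lam l * (-z.1) l + lam l := by
      funext l; simp [affine]
    have e2 : affine lam (-1) z.1 = -fun l => ((-1 : ℝ) : ℂ) * lam l * z.1 l + lam l := by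
      funext l; simp [affine]; ring
    have e3 : (-(((-1 : ℝ) * B : ℝ) : ℂ)) = B := by push_cast; ring
    have e4 : ((((-1 : ℝ) * B : ℝ) : ℂ)) = -B := by push_cast; ring
    rw [e1, e2, hneg, e3, e4, hw]
    linear_combination (-(weight J B (-z.1)) *
      fockEval hs.pos (fun l => ((-1 : ℝ) : ℂ) * lam l * (-z.1) l + lam l) x) * hεc

/-- Nonzero eigenvalues of the transfer operator and of its self-adjoint model have the same
multiplicities. -/
theorem parityMultiplicity_eq_rank (hε : ε * ε = 1) (hd : Summable fun α => |d α|)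
    {J t b : Fin m → ℝ} {B σ κ : ℝ} (hJ : ∀ l, 0 ≤ J l)
    (h : Admissible lam R) (hσ : σ = 1 ∧ κ = 1 ∨ σ = -1 ∧ κ = ε) (hs : Scales J lam B t b)
    (hdef : ∀ α, d α = κ * (σ ^ degree α * monomial lam α)) {μ : ℂ} (hμ : μ ≠ 0) :
    parityMultiplicity J h ((σ * B : ℝ) : ℂ) ε
        (Complex.exp ((B * ∑ l, J l * (lam l / (1 - σ * lam l)) : ℝ)) * μ) =
      Module.rank ℂ (Module.End.eigenspace
        (frameOp d (symCoherent ε (displacement lam σ b)) : Fock m →ₗ[ℂ] Fock m) μ) := by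
  set w := displacement lam σ b
  set c := Complex.exp ((B * ∑ l, J l * (lam l / (1 - σ * lam l)) : ℝ)) with hc
  set T := frameOp d (symCoherent ε w) with hT
  set ι := fockMap R hs.pos with hι
  have hL : ∀ x : Fock m, fockParity m x = (ε : ℂ) • x →
      ruelle J h ((σ * B : ℝ) : ℂ) (ι x) = c • ι (T x) :=
    fun x hx => ruelle_fockMap hε hd h hσ hs hdef hx
  have hc0 : c ≠ 0 := Complex.exp_ne_zero _
  have hsym := isSymmetric_frameOp hd (norm_symCoherent_le hε w)
  have hinj : Function.Injective ι := fockMap_injective h.radius_pos hs.pos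
  suffices hV : Module.End.maxGenEigenspace (ruelle J h ((σ * B : ℝ) : ℂ)) (c * μ) ⊓
      paritySpace R ε = (Module.End.eigenspace (T : Fock m →ₗ[ℂ] Fock m) μ).map ι by
    rw [parityMultiplicity, hV]
    exact (Submodule.equivMapOfInjective ι hinj _).rank_eq.symm
  apply le_antisymm
  · rintro f ⟨hf1, hf2⟩
    obtain ⟨x, hx⟩ := exists_fockMap_eq hJ h _ (mul_ne_zero hc0 hμ) hs.pos hf1
    have hf2 : reflection R f = (ε : ℂ) • f := Module.End.mem_eigenspace_iff.1 hf2
    have hpar : fockParity m x = (ε : ℂ) • x := by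
      apply hinj
      rw [hι, ← reflection_fockMap, hx, hf2, map_smul, hx]
    obtain ⟨k, hk⟩ := (Module.End.mem_maxGenEigenspace _ _ _).1 hf1
    -- The intertwining holds only on vectors of parity `ε`; as `T` preserves them, it passes to all
    -- powers.
    have hpow : ∀ k : ℕ, ∀ y : Fock m, fockParity m y = (ε : ℂ) • y →
        ((ruelle J h ((σ * B : ℝ) : ℂ) - (c * μ) • 1) ^ k) (ι y) =
          c ^ k • ι ((((T : Fock m →ₗ[ℂ] Fock m) - μ • 1 : Module.End ℂ (Fock m)) ^ k) y) := by
      intro k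
      induction k with
      | zero => intro y _; simp
      | succ k ih =>
        intro y hy
        have e : (ruelle J h ((σ * B : ℝ) : ℂ) - (c * μ) • 1) (ι y) =
            c • ι (((T : Fock m →ₗ[ℂ] Fock m) - μ • 1 : Module.End ℂ (Fock m)) y) := by
          rw [LinearMap.sub_apply, LinearMap.sub_apply, hL y hy]
          simp only [LinearMap.smul_apply, Module.End.one_apply, map_sub, map_smul, smul_sub,
            mul_smul]
          rfl
        have hpy : fockParity m (((T : Fock m →ₗ[ℂ] Fock m) - μ • 1 : Module.End ℂ (Fock m)) y) =
            (ε : ℂ) • ((T : Fock m →ₗ[ℂ] Fock m) - μ • 1 : Module.End ℂ (Fock m)) y := by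
          rw [LinearMap.sub_apply, map_sub, smul_sub]
          simp only [LinearMap.smul_apply, Module.End.one_apply, map_smul, hy]
          rw [smul_comm μ]
          congr 1
          exact fockParity_frameOp hε hd w y
        rw [pow_succ, Module.End.mul_apply, e, map_smul, ih _ hpy, smul_smul, pow_succ' c,
          pow_succ (_ - _ : Module.End ℂ (Fock m)), Module.End.mul_apply]
    rw [← hx, hpow k x hpar] at hk
    have hk2 := hinj ((smul_eq_zero.1 hk).resolve_left (pow_ne_zero _ hc0)
      |>.trans (map_zero ι).symm)
    have hmem : x ∈ Module.End.maxGenEigenspace (T : Fock m →ₗ[ℂ] Fock m) μ :=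
      (Module.End.mem_maxGenEigenspace _ _ _).2 ⟨k, hk2⟩
    -- Symmetry of the model excludes Jordan blocks.
    rw [hsym.isFinitelySemisimple.maxGenEigenspace_eq_eigenspace] at hmem
    exact ⟨x, hmem, hx⟩
  · rintro _ ⟨x, hx, rfl⟩
    have hx : T x = μ • x := Module.End.mem_eigenspace_iff.1 hx
    -- The range of `T` consists of vectors of parity `ε`, hence so do its eigenvectors for `μ ≠ 0`.
    have hpar : fockParity m x = (ε : ℂ) • x := by
      have h1 := fockParity_frameOp hε hd w x
      rw [← hT, hx, map_smul, smul_comm] at h1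
      exact smul_right_injective _ hμ h1
    refine ⟨(Module.End.mem_maxGenEigenspace _ _ _).2 ⟨1, ?_⟩, ?_⟩
    · rw [pow_one, LinearMap.sub_apply, hL x hpar, hx, map_smul, smul_smul]
      simp
    · refine Module.End.mem_eigenspace_iff.2 ?_
      rw [hι, reflection_fockMap, hpar, map_smul]

end

/-! ### Low temperature: the model eigenvalues are approached uniformly. -/

section

variable {m : ℕ} {lam R : Fin m → ℝ}

/-- The numbers `r_α`, scaled by `exp c`, list the nonzero eigenvalues of parity `ε`, and only
labels with `λ^α ≠ 0` are used. -/
def ListsScaled (J : Fin m → ℝ) (h : Admissible lam R) (β ε c : ℝ) (r : (Fin m → ℕ) → ℝ) : Prop :=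
  (∀ α, monomial lam α = 0 → r α = 0) ∧ ∀ μ : ℂ, μ ≠ 0 →
    Cardinal.mk {α // (r α : ℂ) = μ} =
      parityMultiplicity J h (β : ℂ) ε (Complex.exp (c : ℝ) * μ)

theorem infinite_monomial_ne_zero (hne : ∃ l, lam l ≠ 0) :
    {α : Fin m → ℕ | monomial lam α ≠ 0}.Infinite := by
  classical
  obtain ⟨l, hl⟩ := hne
  refine Set.infinite_of_injective_forall_mem (f := fun n : ℕ => (Pi.single l n : Fin m → ℕ))
    (fun a b hab => by simpa using congrFun hab l) fun n => ?_
  refine Finset.prod_ne_zero_iff.2 fun k _ => ?_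
  by_cases hk : k = l
  · subst hk; exact pow_ne_zero _ hl
  · simp [hk]

/-- The approximate scaled eigenvalues. -/
noncomputable def model (lam : Fin m → ℝ) (σ κ : ℝ) (α : Fin m → ℕ) : ℝ :=
  κ * (σ ^ degree α * monomial lam α)

theorem abs_model (h : Admissible lam R) {σ κ : ℝ} (hσ : |σ| = 1) (hκ : |κ| = 1)
    (α : Fin m → ℕ) : |model lam σ κ α| = monomial lam α := by
  rw [model, abs_mul, abs_mul, abs_pow, hσ, hκ, one_pow, one_mul, one_mul,
    abs_of_nonneg (monomial_nonneg h.nonneg α)]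

theorem model_eq_zero_iff (h : Admissible lam R) {σ κ : ℝ} (hσ : |σ| = 1) (hκ : |κ| = 1)
    {α : Fin m → ℕ} : model lam σ κ α = 0 ↔ monomial lam α = 0 := by
  rw [← abs_eq_zero, abs_model h hσ hκ]

theorem summable_abs_model (h : Admissible lam R) {σ κ : ℝ} (hσ : |σ| = 1) (hκ : |κ| = 1) :
    Summable fun α => |model lam σ κ α| := by
  simpa only [abs_model h hσ hκ] using summable_monomial h.nonneg h.lt_one

theorem infinite_model_ne_zero (h : Admissible lam R) (hne : ∃ l, lam l ≠ 0) {σ κ : ℝ}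
    (hσ : |σ| = 1) (hκ : |κ| = 1) : {α | model lam σ κ α ≠ 0}.Infinite := by
  simpa only [ne_eq, model_eq_zero_iff h hσ hκ] using infinite_monomial_ne_zero hne

/-- The displacements `√(B J λ)`. -/
noncomputable def scaleB (J lam : Fin m → ℝ) (B : ℝ) (l : Fin m) : ℝ := √(B * J l * lam l)

open Classical in
/-- The scales `√(λ / (B J))`. -/
noncomputable def scaleT (J lam : Fin m → ℝ) (B : ℝ) (l : Fin m) : ℝ :=
  if lam l = 0 then 1 else √(lam l / (B * J l))

/-- When `λ_l = 0` the conditions force `b l = 0` and hence `J l = 0`; any positive scale then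
works. This is why couplings must vanish exactly where `λ` does. -/
theorem scales (h : Admissible lam R) {J : Fin m → ℝ} (hJ : ∀ l, 0 ≤ J l)
    (hJl : ∀ l, J l = 0 ↔ lam l = 0) {B : ℝ} (hB : 0 < B) :
    Scales J lam B (scaleT J lam B) (scaleB J lam B) := by
  have key : ∀ l, lam l ≠ 0 → 0 < lam l ∧ 0 < B * J l := fun l hl =>
    ⟨lt_of_le_of_ne (h.nonneg l) (Ne.symm hl),
      mul_pos hB (lt_of_le_of_ne (hJ l) (Ne.symm ((hJl l).not.2 hl)))⟩
  constructor <;> intro l <;> by_cases hl : lam l = 0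
  · simp [scaleT, hl]
  · obtain ⟨h1, h2⟩ := key l hl
    simp only [scaleT, hl, if_false]
    positivity
  · simp [scaleB, hl, (hJl l).2 hl]
  · obtain ⟨h1, h2⟩ := key l hl
    simp only [scaleT, scaleB, hl, if_false]
    rw [← Real.sqrt_sq h2.le, ← Real.sqrt_mul (sq_nonneg _), Real.sqrt_sq h2.le]
    congr 1
    field_simp
  · simp [scaleB, hl]
  · obtain ⟨h1, h2⟩ := key l hl
    simp only [scaleT, scaleB, hl, if_false]
    rw [← Real.sqrt_mul (by positivity)]
    have : lam l / (B * J l) * (B * J l * lam l) = lam l ^ 2 := by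
      generalize B * J l = a at h2; field_simp
    rw [this, Real.sqrt_sq h1.le]

/-- One active coordinate suffices for decay: the remaining factors, including those of undisplaced
coordinates, are at most `1`. -/
theorem abs_prod_pairing_le (w : Fin m → ℝ) (α γ : Fin m → ℕ) (l : Fin m) :
    |∏ l, pairing (w l) (-1) (α l) (γ l)| ≤ |pairing (w l) (-1) (α l) (γ l)| := by
  classical
  rw [Finset.abs_prod, ← Finset.mul_prod_erase _ _ (Finset.mem_univ l)]
  exact mul_le_of_le_one_right (abs_nonneg _)
    (Finset.prod_le_one (fun k _ => abs_nonneg _) fun k _ => abs_pairing_neg_one_le _ _ _)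

theorem tendsto_displacement (h : Admissible lam R) {J : Fin m → ℝ} (hJ : ∀ l, 0 ≤ J l)
    (hJl : ∀ l, J l = 0 ↔ lam l = 0) {σ : ℝ} (hσ : |σ| ≤ 1) {l : Fin m} (hl : lam l ≠ 0) :
    Tendsto (fun B => displacement lam σ (scaleB J lam B) l) atTop atTop := by
  have h1 : 0 < J l * lam l := mul_pos (lt_of_le_of_ne (hJ l) (Ne.symm ((hJl l).not.2 hl)))
    (lt_of_le_of_ne (h.nonneg l) (Ne.symm hl))
  refine Tendsto.atTop_div_const (one_sub_mul_pos h hσ l) ?_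
  simp only [scaleB, mul_assoc]
  exact Real.tendsto_sqrt_atTop.comp (tendsto_id.atTop_mul_const h1)

theorem tendsto_prod_pairing (h : Admissible lam R) {J : Fin m → ℝ} (hJ : ∀ l, 0 ≤ J l)
    (hJl : ∀ l, J l = 0 ↔ lam l = 0) (hne : ∃ l, lam l ≠ 0) {σ : ℝ} (hσ : |σ| ≤ 1)
    (α γ : Fin m → ℕ) :
    Tendsto (fun B => ∏ l, pairing (displacement lam σ (scaleB J lam B) l) (-1) (α l) (γ l))
      atTop (𝓝 0) := by
  obtain ⟨l, hl⟩ := hne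
  refine squeeze_zero_norm (fun B => abs_prod_pairing_le _ α γ l) ?_
  simpa using ((tendsto_pairing (α l) (γ l)).comp (tendsto_displacement h hJ hJl hσ hl)).abs

theorem listsScaled_of_listsFrameOp (h : Admissible lam R) {J : Fin m → ℝ} (hJ : ∀ l, 0 ≤ J l)
    {t b : Fin m → ℝ} {B σ κ ε : ℝ} (hs : Scales J lam B t b) (hε : ε * ε = 1)
    (hσ : σ = 1 ∧ κ = 1 ∨ σ = -1 ∧ κ = ε) (hσ1 : |σ| = 1) (hκ : |κ| = 1) {r : (Fin m → ℕ) → ℝ}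
    (hr : ListsFrameOp (model lam σ κ) (symCoherent ε (displacement lam σ b)) r) :
    ListsScaled J h (σ * B) ε (B * ∑ l, J l * (lam l / (1 - σ * lam l))) r := by
  refine ⟨fun α hα => hr.1 α ((model_eq_zero_iff h hσ1 hκ).2 hα), fun μ hμ => ?_⟩
  rw [hr.2 μ hμ, parityMultiplicity_eq_rank hε (summable_abs_model h hσ1 hκ) hJ h hσ hs
    (fun _ => rfl) hμ]

theorem sign_abs {σ κ ε : ℝ} (hε : ε * ε = 1) (hσ : σ = 1 ∧ κ = 1 ∨ σ = -1 ∧ κ = ε) :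
    |σ| = 1 ∧ |κ| = 1 := by
  rcases hσ with ⟨rfl, rfl⟩ | ⟨rfl, rfl⟩ <;> rcases mul_self_eq_one_iff.1 hε with rfl | rfl <;> simp

theorem exists_listsScaled (h : Admissible lam R) {J : Fin m → ℝ} (hJ : ∀ l, 0 ≤ J l)
    (hJl : ∀ l, J l = 0 ↔ lam l = 0) (hne : ∃ l, lam l ≠ 0) {σ κ ε : ℝ} (hε : ε * ε = 1)
    (hσ : σ = 1 ∧ κ = 1 ∨ σ = -1 ∧ κ = ε) {B : ℝ} (hB : 0 < B) :
    ∃ r, ListsScaled J h (σ * B) ε (B * ∑ l, J l * (lam l / (1 - σ * lam l))) r := by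
  obtain ⟨hσ1, hκ⟩ := sign_abs hε hσ
  obtain ⟨r, hr⟩ := exists_listsFrameOp (summable_abs_model h hσ1 hκ)
    (infinite_model_ne_zero h hne hσ1 hκ)
    (norm_symCoherent_le hε (displacement lam σ (scaleB J lam B)))
  exact ⟨r, listsScaled_of_listsFrameOp h hJ (scales h hJ hJl hB) hε hσ hσ1 hκ hr⟩

/-- At low temperature the scaled eigenvalues are uniformly close to the model. -/
theorem exists_close_listsScaled (h : Admissible lam R) {J : Fin m → ℝ} (hJ : ∀ l, 0 ≤ J l)
    (hJl : ∀ l, J l = 0 ↔ lam l = 0) (hne : ∃ l, lam l ≠ 0) {σ κ ε : ℝ} (hε : ε * ε = 1)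
    (hσ : σ = 1 ∧ κ = 1 ∨ σ = -1 ∧ κ = ε) {δ : ℝ} (hδ : 0 < δ) :
    ∀ᶠ B in atTop,
      ∃ r, ListsScaled J h (σ * B) ε (B * ∑ l, J l * (lam l / (1 - σ * lam l))) r ∧
        ∀ α, |r α - model lam σ κ α| ≤ δ := by
  classical
  obtain ⟨hσ1, hκ⟩ := sign_abs hε hσ
  have hd := summable_abs_model h hσ1 hκ
  set d := model lam σ κ with hd_def
  obtain ⟨A, η, hη, H⟩ := exists_close_listsFrameOp (H := Fock m) hd
    (infinite_model_ne_zero h hne hσ1 hκ) hδ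
  let w : ℝ → Fin m → ℝ := fun B => displacement lam σ (scaleB J lam B)
  let x : ℝ → (Fin m → ℕ) → Fock m := fun B => symCoherent ε (w B)
  let g : ℝ → (Fin m → ℕ) → (Fin m → ℕ) → ℝ := fun B α γ =>
    ε * ∏ l, pairing (w B l) (-1) (α l) (γ l)
  have hgram : ∀ B α γ, inner ℂ (x B α) (x B γ) = (((if α = γ then 1 else 0) + g B α γ : ℝ) : ℂ) :=
    fun B α γ => inner_symCoherent hε (w B) α γ
  have habs : |ε| = 1 := by rcases mul_self_eq_one_iff.1 hε with rfl | rfl <;> simp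
  have hg0 : ∀ α γ, Tendsto (fun B => |g B α γ|) atTop (𝓝 0) := by
    intro α γ
    simpa [g, w, abs_mul] using ((tendsto_prod_pairing h hJ hJl hne hσ1.le α γ).const_mul ε).abs
  have hg1 : ∀ B α γ, |g B α γ| ≤ 1 := by
    intro B α γ
    obtain ⟨l, -⟩ := hne
    rw [abs_mul, habs, one_mul]
    exact (abs_prod_pairing_le _ α γ l).trans (abs_pairing_neg_one_le _ _ _)
  have hx : ∀ B α, ‖x B α‖ ≤ 2 := fun B => norm_symCoherent_le hε (w B)
  have h1 : ∀ᶠ B in atTop, ∀ i ∈ A, ∀ j ∈ A,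
      ‖inner ℂ (x B i) (x B j) - (if i = j then 1 else 0)‖ ≤ η := by
    rw [eventually_all_finset]; intro i _
    rw [eventually_all_finset]; intro j _
    filter_upwards [(hg0 i j).eventually_le_const hη] with B hB
    rw [hgram]
    refine le_trans (le_of_eq ?_) hB
    rw [← Real.norm_eq_abs, ← Complex.norm_real]
    congr 1
    split_ifs <;> push_cast <;> ring
  have h2 : ∀ᶠ B in atTop, ∀ i ∈ A, ‖frameOp d (x B) (x B i) - (d i : ℂ) • x B i‖ ≤ η := by
    rw [eventually_all_finset]; intro j _
    -- The residual is `∑ᵢ dᵢ g_ij xᵢ`. Each `g_ij` tends to `0` and summability of `d` dominates,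
    -- so the whole infinite sum tends to `0`.
    have hlim : Tendsto (fun B => ∑' i, |d i| * |g B i j| * 2) atTop (𝓝 (∑' i, |d i| * 0 * 2)) := by
      refine tendsto_tsum_of_dominated_convergence (bound := fun i => |d i| * 2) (hd.mul_right 2)
        (fun i => ((hg0 i j).const_mul _).mul_const 2) (Eventually.of_forall fun B i => ?_)
      rw [Real.norm_eq_abs, abs_of_nonneg (by positivity)]
      have := hg1 B i j
      have := abs_nonneg (d i)
      nlinarith
    simp only [mul_zero, zero_mul, tsum_zero] at hlim
    filter_upwards [hlim.eventually_le_const hη] with B hB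
    have hs1 := hasSum_frameOp hd (hx B) (x B j)
    have hs2 : HasSum (fun i => ((if i = j then d j else 0 : ℝ) : ℂ) • x B i)
        ((d j : ℂ) • x B j) := by
      have := hasSum_ite_eq (L := SummationFilter.unconditional _) j ((d j : ℂ) • x B j)
      refine this.congr_fun fun i => ?_
      split_ifs with hij
      · rw [hij]
      · simp
    have hs3 := hs1.sub hs2
    rw [← hs3.tsum_eq]
    have hsum : Summable fun i => |d i| * |g B i j| * 2 :=
      Summable.of_nonneg_of_le (fun i => by positivity) (fun i => by
        have := hg1 B i j
        have := abs_nonneg (d i)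
        nlinarith) (hd.mul_right 2)
    refine (tsum_of_norm_bounded hsum.hasSum fun i => ?_).trans hB
    have e : ((d i : ℂ) * inner ℂ (x B i) (x B j)) • x B i -
        ((if i = j then d j else 0 : ℝ) : ℂ) • x B i = ((d i * g B i j : ℝ) : ℂ) • x B i := by
      rw [hgram, ← sub_smul]
      congr 1
      split_ifs with hij
      · rw [hij]; push_cast; ring
      · push_cast; ring
    rw [e, norm_smul, Complex.norm_real, Real.norm_eq_abs, abs_mul]
    exact mul_le_mul_of_nonneg_left (hx B i) (by positivity)
  have h3 : ∀ᶠ B in atTop, ∑' i, |d i| * ‖x B i‖ ^ 2 ≤ ∑' i, |d i| + η := by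
    -- Since `‖xᵢ‖² = 1 + g_ii`, the trace bound converges to `∑ |dᵢ|`.
    have hlim : Tendsto (fun B => ∑' i, |d i| * ‖x B i‖ ^ 2) atTop (𝓝 (∑' i, |d i| * 1)) := by
      refine tendsto_tsum_of_dominated_convergence (bound := fun i => |d i| * 2 ^ 2)
        (hd.mul_right _) (fun i => Tendsto.const_mul _ ?_) (Eventually.of_forall fun B i => ?_)
      · have e : ∀ B, ‖x B i‖ ^ 2 = 1 + g B i i := by
          intro B
          have h4 := hgram B i i
          rw [if_pos rfl, inner_self_eq_norm_sq_to_K] at h4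
          exact Complex.ofReal_injective (by rw [← h4]; push_cast; rfl)
        simp only [e]
        simpa using (tendsto_zero_iff_abs_tendsto_zero _ |>.2 (hg0 i i)).const_add 1
      · rw [Real.norm_eq_abs, abs_of_nonneg (by positivity)]
        have := hx B i
        gcongr
    simp only [mul_one] at hlim
    exact hlim.eventually_le_const (by linarith)
  filter_upwards [h1, h2, h3, eventually_gt_atTop 0] with B e1 e2 e3 hB
  obtain ⟨r, hr, hrd⟩ := H (x B) (hx B) e1 e2 e3
  exact ⟨r, listsScaled_of_listsFrameOp h hJ (scales h hJ hJl hB) hε hσ hσ1 hκ hr, hrd⟩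

end

/-! ### Inactive coordinates, and the point `β = 0`. -/

section

variable {m : ℕ} {lam R : Fin m → ℝ}

section LinearAlgebra

variable {V : Type} [AddCommGroup V] [Module ℂ V]

/-- This and the next two lemmas express that two operators of the forms `A Q` and `Q A` have the
same nonzero generalized eigenvalues, with multiplicity. -/
theorem mem_maxGenEigenspace_of_intertwine {A B P : Module.End ℂ V} (hP : B * P = P * A) {μ : ℂ}
    {f : V} (hf : f ∈ Module.End.maxGenEigenspace A μ) :
    P f ∈ Module.End.maxGenEigenspace B μ := by
  obtain ⟨k, hk⟩ := (Module.End.mem_maxGenEigenspace _ _ _).1 hf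
  refine (Module.End.mem_maxGenEigenspace _ _ _).2 ⟨k, ?_⟩
  have h1 : SemiconjBy P (A - μ • 1) (B - μ • 1) := by
    rw [SemiconjBy, mul_sub, sub_mul, hP]
    simp
  have h2 := LinearMap.congr_fun (h1.pow_right k).eq f
  rw [Module.End.mul_apply, Module.End.mul_apply, hk, map_zero] at h2
  exact h2.symm

theorem eq_zero_of_mem_maxGenEigenspace {A : Module.End ℂ V} {μ : ℂ} (hμ : μ ≠ 0) {f : V}
    (hf : f ∈ Module.End.maxGenEigenspace A μ) (h0 : A f = 0) : f = 0 := by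
  have hd := Module.End.disjoint_genEigenspace A hμ ⊤ ⊤
  refine Submodule.disjoint_def.1 hd f hf ?_
  refine (Module.End.mem_maxGenEigenspace A 0 f).2 ⟨1, ?_⟩
  simpa using h0

theorem rank_le_of_injOn {p q : Submodule ℂ V} (P : Module.End ℂ V) (hm : ∀ x ∈ p, P x ∈ q)
    (hi : ∀ x ∈ p, P x = 0 → x = 0) : Module.rank ℂ p ≤ Module.rank ℂ q := by
  refine LinearMap.rank_le_of_injective (P.restrict hm) ?_
  rw [← LinearMap.ker_eq_bot, LinearMap.ker_eq_bot']
  intro x hx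
  exact Subtype.ext (hi x x.2 (congrArg Subtype.val hx))

theorem exists_eigenvector_of_pow {A : Module.End ℂ V} (k : ℕ) {f : V} (hf : f ≠ 0)
    (h0 : (A ^ k) f = 0) : ∃ g ≠ 0, A g = 0 := by
  induction k generalizing f with
  | zero => exact absurd h0 hf
  | succ k ih =>
    by_cases h : A f = 0
    · exact ⟨f, hf, h⟩
    · rw [pow_succ, Module.End.mul_apply] at h0
      exact ih h h0

end LinearAlgebra

theorem reflection_ruelle (J : Fin m → ℝ) (h : Admissible lam R) (β : ℂ) (f : HoloSpace R) :
    reflection R (ruelle J h β f) = ruelle J h β (reflection R f) := by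
  refine HoloSpace.ext fun z => ?_
  have hw : ∀ a, weight J a (-z.1) = weight J (-a) z.1 := by
    intro a
    simp only [weight, Pi.neg_apply, mul_neg, Finset.sum_neg_distrib, neg_mul]
  have hb : ∀ (s : ℝ) (hs : |s| ≤ 1) (hs' : |-s| ≤ 1), branch h s hs (negMap R z) =
      negMap R (branch h (-s) hs' z) := by
    intro s hs hs'
    refine Subtype.ext (funext fun l => ?_)
    change (lam l : ℂ) * (-z.1) l + (s : ℂ) * lam l =
      -((lam l : ℂ) * z.1 l + ((-s : ℝ) : ℂ) * lam l)
    simp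
    ring
  change weight J β (-z.1) * f.1 (branch h 1 (by simp) (negMap R z)) +
      weight J (-β) (-z.1) * f.1 (branch h (-1) (by simp) (negMap R z)) =
    weight J β z.1 * f.1 (negMap R (branch h 1 (by simp) z)) +
      weight J (-β) z.1 * f.1 (negMap R (branch h (-1) (by simp) z))
  rw [hw, hw, hb 1 (by simp) (by simp), hb (-1) (by simp) (by simp)]
  simp only [neg_neg]
  ring

open Classical in
/-- The couplings `J_l` with `λ_l ≠ 0`. -/
noncomputable def activeCoupling (J lam : Fin m → ℝ) (l : Fin m) : ℝ :=
  if lam l = 0 then 0 else J l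

open Classical in
/-- The projection that drops the coordinates with `λ_l = 0`. -/
noncomputable def activeMap (h : Admissible lam R) : C(closedPolydisc R, closedPolydisc R) where
  toFun z := ⟨fun l => if lam l = 0 then 0 else z.1 l, fun l => by
    simp only
    split_ifs
    · simpa using (h.radius_pos l).le
    · exact z.2 l⟩
  continuous_toFun := by
    refine Continuous.subtype_mk (continuous_pi fun l => ?_) _
    split_ifs
    · exact continuous_const
    · exact (continuous_apply l).comp continuous_subtype_val

open Classical in
/-- Composition with the projection that drops the coordinates with `λ_l = 0`. -/
noncomputable def activeComp (h : Admissible lam R) : Module.End ℂ (HoloSpace R) where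
  toFun f := ⟨f.1.comp (activeMap h), by
    obtain ⟨f, g, hg, e⟩ := f
    have hm : ∀ z ∈ polydisc R, (fun l => if lam l = 0 then 0 else z l) ∈ polydisc R := by
      intro z hz l
      simp only
      split_ifs
      · simpa using h.radius_pos l
      · exact hz l
    refine ⟨fun z => g fun l => if lam l = 0 then 0 else z l, hg.comp ?_ hm, fun z hz => ?_⟩
    · refine Differentiable.differentiableOn (differentiable_pi.2 fun l => ?_)
      split_ifs
      · exact differentiable_const _
      · exact differentiable_apply l
    · exact e (activeMap h z) (hm z hz)⟩
  map_add' _ _ := rfl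
  map_smul' _ _ := rfl

/-- The branches land in the subspace where inactive coordinates vanish, so the projection is
invisible before `L`. Applied after `L` it removes the inactive couplings from the weight; hence `L
= L Q` and `Q L` have the same nonzero spectrum. -/
theorem ruelle_mul_activeComp (J : Fin m → ℝ) (h : Admissible lam R) (β : ℂ) :
    ruelle J h β * activeComp h = ruelle J h β := by
  refine LinearMap.ext fun f => HoloSpace.ext fun z => ?_
  have hb : ∀ (s : ℝ) (hs : |s| ≤ 1), activeMap h (branch h s hs z) = branch h s hs z := by
    intro s hs
    refine Subtype.ext (funext fun l => ?_)
    change (if lam l = 0 then 0 else (lam l : ℂ) * z.1 l + (s : ℂ) * lam l) =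
      (lam l : ℂ) * z.1 l + (s : ℂ) * lam l
    split_ifs with hl <;> simp [hl]
  change weight J β z.1 * f.1 (activeMap h (branch h 1 (by simp) z)) +
    weight J (-β) z.1 * f.1 (activeMap h (branch h (-1) (by simp) z)) = _
  rw [hb, hb]
  rfl

theorem activeComp_mul_ruelle (J : Fin m → ℝ) (h : Admissible lam R) (β : ℂ) :
    activeComp h * ruelle J h β = ruelle (activeCoupling J lam) h β := by
  refine LinearMap.ext fun f => HoloSpace.ext fun z => ?_
  have hb : ∀ (s : ℝ) (hs : |s| ≤ 1), branch h s hs (activeMap h z) = branch h s hs z := by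
    intro s hs
    refine Subtype.ext (funext fun l => ?_)
    change (lam l : ℂ) * (if lam l = 0 then 0 else z.1 l) + (s : ℂ) * lam l =
      (lam l : ℂ) * z.1 l + (s : ℂ) * lam l
    split_ifs with hl <;> simp [hl]
  have hw : ∀ a, weight J a (activeMap h z).1 = weight (activeCoupling J lam) a z.1 := by
    intro a
    have : ∀ l, (J l : ℂ) * (activeMap h z).1 l = (activeCoupling J lam l : ℂ) * z.1 l := by
      intro l
      change (J l : ℂ) * (if lam l = 0 then 0 else z.1 l) =
        ((if lam l = 0 then 0 else J l : ℝ) : ℂ) * z.1 l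
      split_ifs <;> simp
    simp only [weight, this]
  change weight J β (activeMap h z).1 * f.1 (branch h 1 (by simp) (activeMap h z)) +
    weight J (-β) (activeMap h z).1 * f.1 (branch h (-1) (by simp) (activeMap h z)) = _
  rw [hb, hb, hw, hw]
  rfl

theorem reflection_activeComp (h : Admissible lam R) (f : HoloSpace R) :
    reflection R (activeComp h f) = activeComp h (reflection R f) := by
  refine HoloSpace.ext fun z => ?_
  change f.1 (activeMap h (negMap R z)) = f.1 (negMap R (activeMap h z))
  congr 1
  refine Subtype.ext (funext fun l => ?_)
  change (if lam l = 0 then 0 else -z.1 l) = -(if lam l = 0 then 0 else z.1 l)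
  split_ifs <;> simp

/-- Couplings of variables with `λ_l = 0` do not influence the nonzero eigenvalues. -/
theorem parityMultiplicity_activeCoupling (J : Fin m → ℝ) (h : Admissible lam R) (β ε : ℂ) {μ : ℂ}
    (hμ : μ ≠ 0) :
    parityMultiplicity (activeCoupling J lam) h β ε μ = parityMultiplicity J h β ε μ := by
  have e1 := ruelle_mul_activeComp J h β
  have e2 := activeComp_mul_ruelle J h β
  refine le_antisymm (rank_le_of_injOn (ruelle J h β) ?_ ?_) (rank_le_of_injOn (activeComp h) ?_ ?_)
  · rintro f ⟨hf1, hf2⟩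
    refine ⟨mem_maxGenEigenspace_of_intertwine ?_ hf1, ?_⟩
    · rw [← e2, ← mul_assoc, e1]
    · rw [paritySpace, SetLike.mem_coe, Module.End.mem_eigenspace_iff] at hf2 ⊢
      rw [reflection_ruelle, hf2, map_smul]
  · rintro f ⟨hf1, -⟩ h0
    refine eq_zero_of_mem_maxGenEigenspace hμ hf1 ?_
    rw [← e2, Module.End.mul_apply, h0, map_zero]
  · rintro f ⟨hf1, hf2⟩
    refine ⟨mem_maxGenEigenspace_of_intertwine ?_ hf1, ?_⟩
    · rw [← e2, mul_assoc, e1]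
    · rw [paritySpace, SetLike.mem_coe, Module.End.mem_eigenspace_iff] at hf2 ⊢
      rw [reflection_activeComp, hf2, map_smul]
  · rintro f ⟨hf1, -⟩ h0
    refine eq_zero_of_mem_maxGenEigenspace hμ hf1 ?_
    rw [← e1, Module.End.mul_apply, h0, map_zero]

theorem listsScaled_activeCoupling {J : Fin m → ℝ} {h : Admissible lam R} {β ε c : ℝ}
    {r : (Fin m → ℕ) → ℝ} (hr : ListsScaled (activeCoupling J lam) h β ε c r) :
    ListsScaled J h β ε c r :=
  ⟨hr.1, fun μ hμ => by
    rw [hr.2 μ hμ, parityMultiplicity_activeCoupling J h _ _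
      (mul_ne_zero (Complex.exp_ne_zero _) hμ)]⟩

theorem sum_activeCoupling (J : Fin m → ℝ) (σ : ℝ) :
    ∑ l, activeCoupling J lam l * (lam l / (1 - σ * lam l)) =
      ∑ l, J l * (lam l / (1 - σ * lam l)) := by
  refine Finset.sum_congr rfl fun l _ => ?_
  rw [activeCoupling]
  split_ifs with hl <;> simp [hl]

theorem activeCoupling_nonneg {J : Fin m → ℝ} (hJ : ∀ l, 0 < J l) (l : Fin m) :
    0 ≤ activeCoupling J lam l := by
  rw [activeCoupling]
  split_ifs
  exacts [le_rfl, (hJ l).le]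

theorem activeCoupling_eq_zero_iff {J : Fin m → ℝ} (hJ : ∀ l, 0 < J l) (l : Fin m) :
    activeCoupling J lam l = 0 ↔ lam l = 0 := by
  rw [activeCoupling]
  split_ifs with hl <;> simp [hl, (hJ l).ne']

/-! ### Infinite temperature -/

/-- The coefficients of the transfer operator at `β = 0` in the monomials. -/
noncomputable def binomCoeff (lam : Fin m → ℝ) (γ δ : Fin m → ℕ) : ℂ :=
  ∏ l, ((lam l : ℂ) ^ γ l * ((γ l).choose (δ l) : ℂ)) +
    ∏ l, ((lam l : ℂ) ^ γ l * ((γ l).choose (δ l) : ℂ) * (-1) ^ (γ l - δ l))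

theorem binomCoeff_self (γ : Fin m → ℕ) : binomCoeff lam γ γ = ((2 * monomial lam γ : ℝ) : ℂ) := by
  simp [binomCoeff, monomial]
  ring

/-- Triangularity: an affine substitution does not raise any exponent of a monomial. -/
theorem binomCoeff_eq_zero {γ δ : Fin m → ℕ} (hl : ¬ δ ≤ γ) : binomCoeff lam γ δ = 0 := by
  obtain ⟨l, hl⟩ : ∃ l, γ l < δ l := by simpa [Pi.le_def] using hl
  rw [binomCoeff, Finset.prod_eq_zero (Finset.mem_univ l), Finset.prod_eq_zero (Finset.mem_univ l),
    add_zero] <;> simp [Nat.choose_eq_zero_of_lt hl]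

/-- The multi-indices with entries at most `N`. -/
def box (m N : ℕ) : Finset (Fin m → ℕ) := Fintype.piFinset fun _ => Finset.range (N + 1)

theorem mem_box {N : ℕ} {γ : Fin m → ℕ} : γ ∈ box m N ↔ ∀ l, γ l ≤ N := by
  simp [box, Fintype.mem_piFinset]

theorem zpow_affine_add {N : ℕ} {γ : Fin m → ℕ} (hγ : γ ∈ box m N) (z : Fin m → ℂ) :
    zpow (affine lam 1 z) γ + zpow (affine lam (-1) z) γ =
      ∑ δ ∈ box m N, binomCoeff lam γ δ * zpow z δ := by
  have hone : ∀ (s : ℂ), ∏ l, ((lam l : ℂ) * z l + s * lam l) ^ γ l = ∑ δ ∈ box m N,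
      ∏ l, ((lam l : ℂ) ^ γ l * ((γ l).choose (δ l) : ℂ) * s ^ (γ l - δ l) * z l ^ δ l) := by
    intro s
    rw [box, Finset.sum_prod_piFinset (Finset.range (N + 1)) fun l k =>
      (lam l : ℂ) ^ γ l * ((γ l).choose k : ℂ) * s ^ (γ l - k) * z l ^ k]
    refine Finset.prod_congr rfl fun l _ => ?_
    have hle := mem_box.1 hγ l
    have : (lam l : ℂ) * z l + s * lam l = lam l * (z l + s) := by ring
    rw [this, mul_pow, add_pow, Finset.mul_sum]
    refine Finset.sum_subset_zero_on_sdiff (Finset.range_mono (by omega)) (fun k hk => ?_)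
      fun k _ => by ring
    rw [Finset.mem_sdiff, Finset.mem_range, Finset.mem_range] at hk
    rw [Nat.choose_eq_zero_of_lt (by omega)]
    simp
  have h1 := hone 1
  have h2 := hone (-1)
  simp only [zpow, affine, Complex.ofReal_one, Complex.ofReal_neg] at *
  rw [h1, h2, ← Finset.sum_add_distrib]
  refine Finset.sum_congr rfl fun δ _ => ?_
  rw [binomCoeff, add_mul, ← Finset.prod_mul_distrib, ← Finset.prod_mul_distrib]
  simp

theorem eq_zero_of_sum_zpow (hR : ∀ l, 0 < R l) (F : Finset (Fin m → ℕ)) {c : (Fin m → ℕ) → ℂ}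
    (h0 : ∀ z ∈ closedPolydisc R, ∑ γ ∈ F, c γ * zpow z γ = 0) : ∀ γ ∈ F, c γ = 0 := by
  classical
  have h : (fun γ => if γ ∈ F then c γ else 0) = 0 := by
    refine coeff_eq_zero hR ?_ fun z hz => ?_
    · refine summable_of_ne_finset_zero (s := F) fun γ hγ => ?_
      simp [hγ]
    · have h1 : ∀ γ ∉ F, (if γ ∈ F then c γ else 0) * zpow z γ = 0 := fun γ hγ => by simp [hγ]
      have h2 := hasSum_sum_of_ne_finset_zero (L := SummationFilter.unconditional _) h1
      rwa [Finset.sum_congr rfl fun γ hγ => by rw [if_pos hγ], h0 z hz] at h2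
  intro γ hγ
  simpa [hγ] using congrFun h γ

/-- The monomial `z^γ` as an element of `B(D)`. -/
noncomputable def monoHolo (R : Fin m → ℝ) (γ : Fin m → ℕ) : HoloSpace R :=
  ⟨⟨fun z => zpow z.1 γ, continuous_finsetProd _ fun l _ =>
      ((continuous_apply l).comp continuous_subtype_val).pow _⟩,
    fun z => zpow z γ, fun z _ => by
      obtain ⟨D, hD, -⟩ := exists_hasFDerivAt_zpow z γ
      exact hD.differentiableAt.differentiableWithinAt, fun _ _ => rfl⟩

/-- Evaluation at a point of the closed polydisc. -/
noncomputable def evalHolo (z : closedPolydisc R) : HoloSpace R →ₗ[ℂ] ℂ where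
  toFun f := f.1 z
  map_add' _ _ := rfl
  map_smul' _ _ := rfl

theorem sum_monoHolo_apply (F : Finset (Fin m → ℕ)) (c : (Fin m → ℕ) → ℂ) (z : closedPolydisc R) :
    (∑ γ ∈ F, c γ • monoHolo R γ).1 z = ∑ γ ∈ F, c γ * zpow z.1 γ := by
  change evalHolo z _ = _
  rw [map_sum]
  rfl

theorem exists_eq_sum_monoHolo {J : Fin m → ℝ} (hJ : ∀ l, 0 ≤ J l) (h : Admissible lam R) {μ : ℂ}
    (hμ : μ ≠ 0) : ∃ N, ∀ f ∈ Module.End.maxGenEigenspace (ruelle J h ((0 : ℝ) : ℂ)) μ,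
      ∃ c : (Fin m → ℕ) → ℂ, f = ∑ γ ∈ box m N, c γ • monoHolo R γ := by
  obtain ⟨r, s, C, κ, hr, hrR, hs, hC, -, hκ, H⟩ := exists_coeff_of_genEigen hJ h 0 hμ
  obtain ⟨N, hN⟩ := pow_unbounded_of_one_lt C hs
  refine ⟨N, fun f hf => ?_⟩
  obtain ⟨c, K, B, hK, hexp, hc⟩ := H f hf
  -- At `β = 0` the growth bound has no exponential factor: the coefficient is at most a constant
  -- times `(C / s ^ |γ|) ^ n` for every `n`, hence zero once `s ^ |γ| > C`.
  have hzero : ∀ γ ∉ box m N, c γ = 0 := by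
    intro γ hγ
    have hdeg : N ≤ degree γ := by
      rw [mem_box] at hγ
      push Not at hγ
      obtain ⟨l, hl⟩ := hγ
      exact hl.le.trans (Finset.single_le_sum (f := γ) (fun _ _ => Nat.zero_le _)
        (Finset.mem_univ l))
    have hC0 : 0 < C := by linarith
    have hq : C / s ^ degree γ < 1 := by
      rw [div_lt_one (by positivity)]
      exact hN.trans_le (pow_le_pow_right₀ hs.le hdeg)
    have hlim := (tendsto_pow_atTop_nhds_zero_of_lt_one (by positivity) hq).const_mul K
    rw [mul_zero] at hlim
    have hle : ‖c γ‖ * monomial r γ ≤ 0 := by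
      refine ge_of_tendsto' hlim fun n => ?_
      have h1 := hc n γ
      rw [hκ rfl, zero_mul, Real.exp_zero, mul_one] at h1
      rw [div_pow, ← mul_div_assoc, le_div_iff₀ (by positivity), ← pow_mul, mul_comm (degree γ),
        pow_mul]
      linarith
    have := monomial_pos hr γ
    have := norm_nonneg (c γ)
    exact norm_eq_zero.1 (by nlinarith)
  refine ⟨c, HoloSpace.eq_of_expansion h.radius_pos hr hrR hexp
    (B' := ∑' γ, ‖c γ‖ * monomial r γ) ⟨?_, le_rfl, fun z _ => ?_⟩⟩
  · exact summable_of_ne_finset_zero (s := box m N) fun γ hγ => by simp [hzero γ hγ]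
  · rw [sum_monoHolo_apply]
    exact hasSum_sum_of_ne_finset_zero fun γ hγ => by rw [hzero γ hγ, zero_mul]

theorem parityMultiplicity_zero_le {J : Fin m → ℝ} (hJ : ∀ l, 0 ≤ J l) (h : Admissible lam R)
    (ε : ℂ) {μ : ℂ} (hμ : μ ≠ 0) :
    parityMultiplicity J h ((0 : ℝ) : ℂ) ε μ ≤ Cardinal.aleph0 := by
  obtain ⟨N, hN⟩ := exists_eq_sum_monoHolo hJ h hμ
  have hle : Module.End.maxGenEigenspace (ruelle J h ((0 : ℝ) : ℂ)) μ ⊓ paritySpace R ε ≤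
      Submodule.span ℂ (Set.range (monoHolo R)) := by
    rintro f ⟨hf, -⟩
    obtain ⟨c, rfl⟩ := hN f hf
    exact Submodule.sum_mem _ fun γ _ =>
      Submodule.smul_mem _ _ (Submodule.subset_span ⟨γ, rfl⟩)
  exact (Submodule.rank_mono hle).trans ((rank_span_le _).trans
    (Cardinal.mk_range_le.trans (Cardinal.mk_le_aleph0)))

theorem exists_eq_monomial_of_ne_zero {J : Fin m → ℝ} (hJ : ∀ l, 0 ≤ J l) (h : Admissible lam R)
    (ε : ℂ) {μ : ℂ} (hμ : μ ≠ 0) (h0 : parityMultiplicity J h ((0 : ℝ) : ℂ) ε μ ≠ 0) :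
    ∃ α : Fin m → ℕ, μ = ((2 * monomial lam α : ℝ) : ℂ) := by
  classical
  obtain ⟨N, hN⟩ := exists_eq_sum_monoHolo hJ h hμ
  set L := ruelle J h ((0 : ℝ) : ℂ) with hL
  obtain ⟨⟨f, hf, hpar⟩, hf0⟩ := rank_pos_iff_exists_ne_zero.1 (pos_iff_ne_zero.2 h0)
  obtain ⟨k, hk⟩ := (Module.End.mem_maxGenEigenspace _ _ _).1 hf
  obtain ⟨g, hg0, hg⟩ := exists_eigenvector_of_pow k (fun e => hf0 (Subtype.ext e)) hk
  have hgm : g ∈ Module.End.maxGenEigenspace L μ :=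
    (Module.End.mem_maxGenEigenspace _ _ _).2 ⟨1, by rwa [pow_one]⟩
  obtain ⟨c, hc⟩ := hN g hgm
  have hval : ∀ z : closedPolydisc R, g.1 z = ∑ γ ∈ box m N, c γ * zpow z.1 γ := fun z => by
    rw [hc, sum_monoHolo_apply]
  have heig : ∀ z : closedPolydisc R,
      g.1 (branch h 1 (by simp) z) + g.1 (branch h (-1) (by simp) z) =
      μ * g.1 z := by
    intro z
    have h1 : L g = μ • g := by
      rw [LinearMap.sub_apply] at hg
      exact sub_eq_zero.1 hg
    have h2 : (L g).1 z = μ * g.1 z := by rw [h1]; rfl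
    rw [hL, ruelle_apply] at h2
    simpa [weight] using h2
  have hcoef : ∀ δ ∈ box m N, ∑ γ ∈ box m N, c γ * binomCoeff lam γ δ - μ * c δ = 0 := by
    refine eq_zero_of_sum_zpow h.radius_pos (box m N) fun z hz => ?_
    have h1 := heig ⟨z, hz⟩
    rw [hval, hval, hval, ← Finset.sum_add_distrib] at h1
    have h2 : ∑ γ ∈ box m N, (c γ * zpow (affine lam 1 z) γ + c γ * zpow (affine lam (-1) z) γ) =
        ∑ δ ∈ box m N, (∑ γ ∈ box m N, c γ * binomCoeff lam γ δ) * zpow z δ := by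
      simp only [Finset.sum_mul]
      rw [Finset.sum_comm]
      refine Finset.sum_congr rfl fun γ hγ => ?_
      rw [← mul_add, zpow_affine_add hγ, Finset.mul_sum]
      exact Finset.sum_congr rfl fun δ _ => (mul_assoc _ _ _).symm
    simp only [sub_mul, Finset.sum_sub_distrib]
    rw [← h2, sub_eq_zero]
    refine h1.trans ?_
    rw [Finset.mul_sum]
    exact Finset.sum_congr rfl fun γ _ => (mul_assoc _ _ _).symm
  have hne : ((box m N).filter fun γ => c γ ≠ 0).Nonempty := by
    by_contra hempty
    rw [Finset.not_nonempty_iff_eq_empty, Finset.filter_eq_empty_iff] at hempty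
    refine hg0 (hc.trans (Finset.sum_eq_zero fun γ hγ => ?_))
    rw [not_not.1 (hempty hγ), zero_smul]
  -- At a maximal exponent only the diagonal entry of the triangular matrix contributes, so the
  -- eigenvalue is that entry.
  obtain ⟨α, hα⟩ := Finset.exists_maximal hne
  obtain ⟨hαb, hα0⟩ := Finset.mem_filter.1 hα.prop
  have h1 := hcoef α hαb
  rw [Finset.sum_eq_single_of_mem α hαb fun γ hγ hγα => ?_, binomCoeff_self] at h1
  · refine ⟨α, mul_right_cancel₀ hα0 ?_⟩
    linear_combination -h1
  · by_cases hcγ : c γ = 0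
    · rw [hcγ, zero_mul]
    · rw [binomCoeff_eq_zero fun hle => hγα ?_, mul_zero]
      exact le_antisymm (hα.le_of_ge (Finset.mem_filter.2 ⟨hγ, hcγ⟩) hle) hle

/-- At `β = 0` the nonzero eigenvalues can be listed by the multi-indices. -/
theorem exists_lists_zero {J : Fin m → ℝ} (hJ : ∀ l, 0 ≤ J l) (h : Admissible lam R)
    (hne : ∃ l, lam l ≠ 0) (ε : ℂ) : ∃ r : (Fin m → ℕ) → ℝ, ∀ μ : ℂ, μ ≠ 0 →
      Cardinal.mk {α // (r α : ℂ) = μ} = parityMultiplicity J h ((0 : ℝ) : ℂ) ε μ := by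
  set mult : ℂ → Cardinal := fun μ => parityMultiplicity J h ((0 : ℝ) : ℂ) ε μ with hmult
  set S : Set ℝ := {x | x ≠ 0 ∧ mult x ≠ 0} with hS
  have hSc : S.Countable := by
    refine (Set.countable_range fun α : Fin m → ℕ => 2 * monomial lam α).mono ?_
    rintro x ⟨hx, hx0⟩
    obtain ⟨α, hα⟩ := exists_eq_monomial_of_ne_zero hJ h ε (Complex.ofReal_ne_zero.2 hx) hx0
    exact ⟨α, (Complex.ofReal_injective hα).symm⟩
  have : Countable S := hSc.to_subtype
  -- Each real eigenvalue is repeated as often as its multiplicity; countability makes the general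
  -- listing applicable.
  let K : Type := Σ x : S, (mult (x.1 : ℂ)).out
  have hout : ∀ x : S, Countable (mult (x.1 : ℂ)).out := fun x => by
    rw [← Cardinal.mk_le_aleph0_iff, Cardinal.mk_out]
    exact parityMultiplicity_zero_le hJ h ε (Complex.ofReal_ne_zero.2 x.2.1)
  have hK : Countable K := inferInstance
  obtain ⟨r, -, -, -, hr⟩ := exists_listing (fun k : K => k.1.1) (Set.to_countable _)
    (infinite_monomial_ne_zero hne) ∅
    (fun i => absurd i.2 (Finset.notMem_empty _)) (fun i => absurd i.2 (Finset.notMem_empty _))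
  refine ⟨r, fun μ hμ => ?_⟩
  rw [hr μ hμ]
  by_cases hm : mult μ = 0
  · change _ = mult μ
    rw [hm, Cardinal.mk_eq_zero_iff]
    refine ⟨fun k => ?_⟩
    have := k.1.1.2.2
    rw [k.2] at this
    exact this hm
  · obtain ⟨α, hα⟩ := exists_eq_monomial_of_ne_zero hJ h ε hμ hm
    set x := 2 * monomial lam α
    subst hα
    have hx : x ∈ S := ⟨Complex.ofReal_ne_zero.1 hμ, hm⟩
    change _ = mult x
    rw [← Cardinal.mk_out (mult x)]
    refine Cardinal.mk_congr (Equiv.ofBijective (fun y => ⟨⟨⟨x, hx⟩, y⟩, rfl⟩ :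
      (mult x).out → {k : K // ((k.1.1 : ℝ) : ℂ) = x}) ⟨fun y y' hy => ?_, fun k => ?_⟩).symm
    · simpa [K] using hy
    · obtain ⟨⟨⟨x', hx'⟩, y⟩, hk⟩ := k
      obtain rfl : x' = x := Complex.ofReal_injective hk
      exact ⟨y, rfl⟩

end

/-! ### Choice of the labelling, leading eigenvalues and asymptotics. -/

section

variable {m : ℕ} {lam R : Fin m → ℝ}

/-- The good lists depend on `δ`. For each `B` the list is taken with the best accuracy `1 / (n +
1)`, `n ≤ ⌊B⌋`, available there, so that one family serves all `δ`. -/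
theorem exists_diagonal_choice {I : Type} {P : ℝ → (I → ℝ) → Prop} {d : I → ℝ}
    (h1 : ∀ B > 0, ∃ r, P B r)
    (h2 : ∀ δ > 0, ∀ᶠ B in atTop, ∃ r, P B r ∧ ∀ i, |r i - d i| ≤ δ) :
    ∃ r : ℝ → I → ℝ, (∀ B > 0, P B (r B)) ∧ ∀ δ > 0, ∀ᶠ B in atTop, ∀ i, |r B i - d i| ≤ δ := by
  classical
  let Q : ℝ → ℕ → Prop := fun B n => ∃ r, P B r ∧ ∀ i, |r i - d i| ≤ 1 / ((n : ℝ) + 1)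
  let k : ℝ → ℕ := fun B => Nat.findGreatest (Q B) ⌊B⌋₊
  have hex : ∀ B, ∃ r, (0 < B → P B r) ∧
      (Q B (k B) → ∀ i, |r i - d i| ≤ 1 / ((k B : ℝ) + 1)) := by
    intro B
    by_cases hQ : Q B (k B)
    · obtain ⟨r, hr1, hr2⟩ := hQ
      exact ⟨r, fun _ => hr1, fun _ => hr2⟩
    · by_cases hB : 0 < B
      · obtain ⟨r, hr⟩ := h1 B hB
        exact ⟨r, fun _ => hr, fun h => absurd h hQ⟩
      · exact ⟨0, fun h => absurd h hB, fun h => absurd h hQ⟩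
  choose r hr1 hr2 using hex
  refine ⟨r, hr1, fun δ hδ => ?_⟩
  obtain ⟨n, hn⟩ := exists_nat_one_div_lt hδ
  filter_upwards [h2 (1 / ((n : ℝ) + 1)) (by positivity),
    eventually_ge_atTop (n : ℝ)] with B hB hnB i
  have hle : n ≤ ⌊B⌋₊ := Nat.le_floor hnB
  have hk : n ≤ k B := Nat.le_findGreatest hle hB
  have hQ : Q B (k B) := Nat.findGreatest_spec (P := Q B) hle hB
  refine (hr2 B hQ i).trans (le_trans ?_ hn.le)
  have : (n : ℝ) ≤ k B := by exact_mod_cast hk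
  gcongr

theorem exists_top_subset {I : Type} [DecidableEq I] (U : Finset I) (f : I → ℝ) {N : ℕ}
    (hN : N ≤ U.card) :
    ∃ A ⊆ U, A.card = N ∧ ∀ a ∈ A, ∀ b ∈ U, b ∉ A → f b ≤ f a := by
  induction N with
  | zero => exact ⟨∅, Finset.empty_subset _, rfl, by simp⟩
  | succ N ih =>
    obtain ⟨A, hAU, hA, h⟩ := ih (by omega)
    have hne : (U \ A).Nonempty := by
      rw [← Finset.card_pos, Finset.card_sdiff_of_subset hAU]
      omega
    obtain ⟨a, ha, hmax⟩ := Finset.exists_max_image (U \ A) f hne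
    obtain ⟨haU, haA⟩ := Finset.mem_sdiff.1 ha
    refine ⟨insert a A, Finset.insert_subset haU hAU, by rw [Finset.card_insert_of_notMem haA, hA],
      fun x hx b hb hbA => ?_⟩
    rw [Finset.mem_insert, not_or] at hbA
    rcases Finset.mem_insert.1 hx with rfl | hx
    · exact hmax b (Finset.mem_sdiff.2 ⟨hb, hbA.2⟩)
    · exact h x hx b hb hbA.2

theorem finite_monomial_ge (h : Admissible lam R) {u : ℝ} (hu : 0 < u) :
    {α : Fin m → ℕ | u ≤ monomial lam α}.Finite := by
  have := (summable_monomial h.nonneg h.lt_one).tendsto_cofinite_zero.eventually_lt_const hu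
  simpa [eventually_cofinite] using this

/-- Summability leaves finitely many `λ^α` above `a / 2`, so a positive value is isolated among all
the others. -/
theorem exists_gap (h : Admissible lam R) {a : ℝ} (ha : 0 < a) :
    ∀ᶠ g in 𝓝[>] (0 : ℝ), ∀ α : Fin m → ℕ, monomial lam α ≠ a → g ≤ |monomial lam α - a| := by
  have hfin := finite_monomial_ge h (half_pos ha)
  have h1 : ∀ᶠ g in 𝓝[>] (0 : ℝ), ∀ α ∈ {α : Fin m → ℕ | a / 2 ≤ monomial lam α},
      monomial lam α ≠ a → g ≤ |monomial lam α - a| := by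
    rw [eventually_all_finite hfin]
    intro α _
    by_cases hα : monomial lam α = a
    · exact Eventually.of_forall fun _ h => absurd hα h
    · filter_upwards [nhdsWithin_le_nhds (eventually_le_nhds (abs_pos.2 (sub_ne_zero.2 hα)))]
        with g hg _ using hg
  filter_upwards [h1, nhdsWithin_le_nhds (eventually_le_nhds (half_pos ha))] with g hg hga α hα
  by_cases hm : a / 2 ≤ monomial lam α
  · exact hg α hm hα
  · rw [abs_sub_comm, abs_of_nonneg (by linarith)]
    linarith

theorem labelsLeading_of_close (h : Admissible lam R) (hne : ∃ l, lam l ≠ 0)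
    {ρ s : (Fin m → ℕ) → ℝ → ℝ} {F : Filter ℝ} {E : ℝ → ℝ} {d : (Fin m → ℕ) → ℝ}
    (hd : ∀ α, |d α| = monomial lam α)
    (hρ : ∀ᶠ β in F, ∀ α, ρ α β = Real.exp (E β) * s α β)
    (hs : ∀ δ > 0, ∀ᶠ β in F, ∀ α, |s α β - d α| ≤ δ) : LabelsLeading lam ρ F := by
  classical
  intro N
  obtain ⟨W, hW, hWN⟩ := (infinite_monomial_ne_zero hne).exists_subset_card_eq N
  have hWpos : ∀ α ∈ W, 0 < monomial lam α := fun α hα =>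
    lt_of_le_of_ne (monomial_nonneg h.nonneg α) (Ne.symm (hW hα))
  -- The finite set `U` of labels above `u` has at least `N` members, and everything outside it has
  -- strictly smaller `λ^α`.
  obtain ⟨u, hu, hu0⟩ : ∃ u, (∀ α ∈ W, u ≤ monomial lam α) ∧ 0 < u := by
    have h1 : ∀ᶠ u in 𝓝[>] (0 : ℝ), ∀ α ∈ W, u ≤ monomial lam α := by
      rw [eventually_all_finset]
      exact fun α hα => nhdsWithin_le_nhds (eventually_le_nhds (hWpos α hα))
    exact (h1.and self_mem_nhdsWithin).exists
  have hfin := finite_monomial_ge h hu0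
  set U := hfin.toFinset with hU
  have hmem : ∀ α, α ∈ U ↔ u ≤ monomial lam α := fun α => by simp [hU]
  obtain ⟨g, hg, hg0⟩ : ∃ g, (∀ α ∈ U, ∀ γ, monomial lam γ ≠ monomial lam α →
      g ≤ |monomial lam γ - monomial lam α|) ∧ 0 < g := by
    have h1 : ∀ᶠ g in 𝓝[>] (0 : ℝ), ∀ α ∈ U, ∀ γ, monomial lam γ ≠ monomial lam α →
        g ≤ |monomial lam γ - monomial lam α| := by
      rw [eventually_all_finset]
      exact fun α hα => exists_gap h (hu0.trans_le ((hmem α).1 hα))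
    exact (h1.and self_mem_nhdsWithin).exists
  have hcard : N ≤ U.card := hWN ▸ Finset.card_le_card fun α hα => (hmem α).2 (hu α hα)
  -- Errors of `g / 4` on either side cannot reverse a gap `g`, so distinct values of `λ^α` in `U`
  -- keep their order.
  filter_upwards [hρ, hs (g / 4) (by positivity)] with β hβ hsβ
  have hclose : ∀ α, |(|s α β| - monomial lam α)| ≤ g / 4 := fun α => by
    rw [← hd]
    exact (abs_abs_sub_abs_le_abs_sub _ _).trans (hsβ α)
  have hlt : ∀ α ∈ U, ∀ γ, monomial lam γ < monomial lam α → |s γ β| < |s α β| := by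
    intro α hα γ hγ
    have h1 := hg α hα γ hγ.ne
    rw [abs_sub_comm, abs_of_pos (sub_pos.2 hγ)] at h1
    have h2 := abs_le.1 (hclose α)
    have h3 := abs_le.1 (hclose γ)
    linarith [h2.1, h3.2]
  have hlt' : ∀ α ∈ U, ∀ γ, monomial lam α < monomial lam γ → |s α β| < |s γ β| := by
    intro α hα γ hγ
    have h1 := hg α hα γ hγ.ne'
    rw [abs_of_pos (sub_pos.2 hγ)] at h1
    have h2 := abs_le.1 (hclose α)
    have h3 := abs_le.1 (hclose γ)
    linarith [h2.2, h3.1]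
  -- Labels with equal `λ^α` cannot be ordered in advance, so the choice within `U` follows the
  -- actual moduli and may depend on `β`.
  obtain ⟨A, hAU, hA, htop⟩ := exists_top_subset U (fun α => |s α β|) hcard
  refine ⟨A, hA, fun α hα γ hγ => ?_⟩
  rw [hβ, hβ, abs_mul, abs_mul]
  have hE := abs_nonneg (Real.exp (E β))
  by_cases hγU : γ ∈ U
  · have hle := htop α hα γ hγU hγ
    refine ⟨?_, mul_le_mul_of_nonneg_left hle hE⟩
    by_contra! hcon
    exact absurd hle (not_le.2 (hlt' α (hAU hα) γ hcon))
  · rw [hmem, not_le] at hγU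
    have hmono := hγU.trans_le ((hmem α).1 (hAU hα))
    exact ⟨hmono.le, mul_le_mul_of_nonneg_left (hlt α (hAU hα) γ hmono).le hE⟩

/-- For `d = 0` closeness would not give equivalence; the unused labels must carry exact zeros. -/
theorem isEquivalent_of_close {ρ s E : ℝ → ℝ} {F : Filter ℝ} {d : ℝ}
    (hρ : ∀ᶠ β in F, ρ β = Real.exp (E β) * s β) (h0 : d = 0 → ∀ᶠ β in F, s β = 0)
    (hs : ∀ δ > 0, ∀ᶠ β in F, |s β - d| ≤ δ) : ρ ~[F] fun β => d * Real.exp (E β) := by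
  have h1 : (fun β => s β * Real.exp (E β)) ~[F] fun β => d * Real.exp (E β) := by
    refine IsEquivalent.mul ?_ IsEquivalent.refl
    by_cases hd : d = 0
    · subst hd
      exact isEquivalent_zero_iff_eventually_zero.2 (h0 rfl)
    · refine (isEquivalent_const_iff_tendsto hd).2 (Metric.tendsto_nhds.2 ?_)
      intro δ hδ
      filter_upwards [hs (δ / 2) (by positivity)] with β hβ
      rw [Real.dist_eq]
      linarith
  refine h1.congr_left ?_
  filter_upwards [hρ] with β hβ
  rw [hβ, mul_comm]

theorem mk_exp_mul_eq {I : Type} (c : ℝ) (r : I → ℝ) (μ : ℂ) :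
    Cardinal.mk {i // ((Real.exp c * r i : ℝ) : ℂ) = μ} =
      Cardinal.mk {i // (r i : ℂ) = Complex.exp (-(c : ℂ)) * μ} := by
  refine Cardinal.mk_congr (Equiv.subtypeEquivRight fun i => ?_)
  have h : Complex.exp (-(c : ℂ)) * Complex.exp c = 1 := by
    rw [← Complex.exp_add]; simp
  push_cast
  constructor
  · intro e
    rw [← e]
    linear_combination -(r i : ℂ) * h
  · intro e
    rw [e]
    linear_combination μ * h

theorem ListsScaled.mk_eq {J : Fin m → ℝ} {h : Admissible lam R} {β ε c : ℝ}
    {r : (Fin m → ℕ) → ℝ} (hr : ListsScaled J h β ε c r) {μ : ℂ} (hμ : μ ≠ 0) :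
    Cardinal.mk {α // ((Real.exp c * r α : ℝ) : ℂ) = μ} =
      parityMultiplicity J h (β : ℂ) ε μ := by
  rw [mk_exp_mul_eq, hr.2 _ (mul_ne_zero (Complex.exp_ne_zero _) hμ), ← mul_assoc,
    ← Complex.exp_add]
  simp

theorem exists_scaled_family (h : Admissible lam R) {J : Fin m → ℝ} (hJ : ∀ l, 0 < J l)
    (hne : ∃ l, lam l ≠ 0) {σ κ ε : ℝ} (hε : ε * ε = 1) (hσ : σ = 1 ∧ κ = 1 ∨ σ = -1 ∧ κ = ε) :
    ∃ r : ℝ → (Fin m → ℕ) → ℝ,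
      (∀ B > 0, ListsScaled J h (σ * B) ε (B * ∑ l, J l * (lam l / (1 - σ * lam l))) (r B)) ∧
      ∀ δ > 0, ∀ᶠ B in atTop, ∀ α, |r B α - model lam σ κ α| ≤ δ := by
  have h1 := activeCoupling_nonneg (lam := lam) hJ
  have h2 := activeCoupling_eq_zero_iff (lam := lam) hJ
  refine exists_diagonal_choice (fun B hB => ?_) fun δ hδ => ?_
  · obtain ⟨r, hr⟩ := exists_listsScaled h h1 h2 hne hε hσ hB
    rw [sum_activeCoupling] at hr
    exact ⟨r, listsScaled_activeCoupling hr⟩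
  · filter_upwards [exists_close_listsScaled h h1 h2 hne hε hσ hδ] with B hB
    obtain ⟨r, hr, hd⟩ := hB
    rw [sum_activeCoupling] at hr
    exact ⟨r, listsScaled_activeCoupling hr, hd⟩

/-- Labelling of the eigenvalues of parity `ε`, with its low temperature asymptotics. -/
theorem exists_labelling (h : Admissible lam R) {J : Fin m → ℝ} (hJ : ∀ l, 0 < J l)
    (hne : ∃ l, lam l ≠ 0) {ε : ℝ} (hε : ε * ε = 1) : ∃ ρ : (Fin m → ℕ) → ℝ → ℝ,
      ListsEigenvalues J h ε ρ ∧ LabelsLeading lam ρ atTop ∧ LabelsLeading lam ρ atBot ∧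
      (∀ α, ρ α ~[atTop] fun β => model lam 1 1 α * Real.exp (β * ferroExponent J lam)) ∧
      ∀ α, ρ α ~[atBot] fun β => model lam (-1) ε α * Real.exp (-β * antiferroExponent J lam) := by
  have hσp : ((1 : ℝ) = 1 ∧ (1 : ℝ) = 1 ∨ (1 : ℝ) = -1 ∧ (1 : ℝ) = ε) := Or.inl ⟨rfl, rfl⟩
  have hσn : ((-1 : ℝ) = 1 ∧ ε = 1 ∨ (-1 : ℝ) = -1 ∧ ε = ε) := Or.inr ⟨rfl, rfl⟩
  obtain ⟨p, hp, hpd⟩ := exists_scaled_family h hJ hne hε hσp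
  obtain ⟨n, hn, hnd⟩ := exists_scaled_family h hJ hne hε hσn
  obtain ⟨z, hz⟩ := exists_lists_zero (fun l => (hJ l).le) h hne (ε : ℂ)
  obtain ⟨-, hκ⟩ := sign_abs hε hσn
  have hferro : ∑ l, J l * (lam l / (1 - 1 * lam l)) = ferroExponent J lam := by
    simp [ferroExponent]
  have hanti : ∑ l, J l * (lam l / (1 - -1 * lam l)) = antiferroExponent J lam := by
    simp [antiferroExponent]
  rw [hferro] at hp
  rw [hanti] at hn
  -- The three regimes are glued: positive, negative and zero `β` use unrelated lists, since no
  -- continuity in `β` is claimed.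
  let ρ : (Fin m → ℕ) → ℝ → ℝ := fun α β =>
    if 0 < β then Real.exp (β * ferroExponent J lam) * p β α
    else if β < 0 then Real.exp (-β * antiferroExponent J lam) * n (-β) α else z α
  have hpos : ∀ β, 0 < β → ∀ α, ρ α β = Real.exp (β * ferroExponent J lam) * p β α :=
    fun β hβ α => if_pos hβ
  have hneg : ∀ β, β < 0 → ∀ α, ρ α β = Real.exp (-β * antiferroExponent J lam) * n (-β) α :=
    fun β hβ α => by simp only [ρ, if_neg hβ.le.not_gt, if_pos hβ]
  have hpos' : ∀ᶠ β in atTop, ∀ α, ρ α β = Real.exp (β * ferroExponent J lam) * p β α :=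
    (eventually_gt_atTop 0).mono hpos
  have hneg' : ∀ᶠ β in atBot, ∀ α, ρ α β = Real.exp (-β * antiferroExponent J lam) * n (-β) α :=
    (eventually_lt_atBot 0).mono hneg
  have hnd' : ∀ δ > 0, ∀ᶠ β in atBot, ∀ α, |n (-β) α - model lam (-1) ε α| ≤ δ := fun δ hδ =>
    tendsto_neg_atBot_atTop.eventually (hnd δ hδ)
  refine ⟨ρ, fun β μ hμ => ?_, ?_, ?_, fun α => ?_, fun α => ?_⟩
  · rcases lt_trichotomy β 0 with hβ | rfl | hβ
    · simp only [hneg β hβ]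
      have := (hn (-β) (neg_pos.2 hβ)).mk_eq hμ
      simpa using this
    · simpa [ρ] using hz μ hμ
    · simp only [hpos β hβ]
      have := (hp β hβ).mk_eq hμ
      simpa using this
  · exact labelsLeading_of_close h hne (s := fun α β => p β α)
      (abs_model h abs_one abs_one) hpos' hpd
  · exact labelsLeading_of_close h hne (s := fun α β => n (-β) α)
      (abs_model h (by simp) hκ) hneg' hnd'
  · refine isEquivalent_of_close (s := fun β => p β α) (hpos'.mono fun β hβ => hβ α) (fun h0 => ?_)
      fun δ hδ => (hpd δ hδ).mono fun β hβ => hβ α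
    filter_upwards [eventually_gt_atTop 0] with β hβ
    exact (hp β hβ).1 α ((model_eq_zero_iff h abs_one abs_one).1 h0)
  · refine isEquivalent_of_close (s := fun β => n (-β) α) (hneg'.mono fun β hβ => hβ α)
      (fun h0 => ?_)
      fun δ hδ => (hnd' δ hδ).mono fun β hβ => hβ α
    filter_upwards [eventually_lt_atBot 0] with β hβ
    exact (hn (-β) (neg_pos.2 hβ)).1 α ((model_eq_zero_iff h (by simp) hκ).1 h0)

/-- Powers of one active coordinate suffice; the offset `a` fixes their parity, so that the sign of
the asymptotic coefficient is positive. -/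
theorem infinite_tendsto_atTop {ρ : (Fin m → ℕ) → ℝ → ℝ} {F : Filter ℝ} {d : (Fin m → ℕ) → ℝ}
    {E : ℝ → ℝ} (hρ : ∀ α, ρ α ~[F] fun β => d α * Real.exp (E β)) (hE : Tendsto E F atTop)
    {l : Fin m} {a : ℕ} (hd : ∀ n : ℕ, 0 < d (Pi.single l (2 * n + a))) :
    {α | Tendsto (ρ α) F atTop}.Infinite := by
  refine Set.infinite_of_injective_forall_mem
    (f := fun n : ℕ => (Pi.single l (2 * n + a) : Fin m → ℕ)) (fun n k hnk => ?_) fun n => ?_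
  · have := congrFun hnk l
    simp only [Pi.single_eq_same] at this
    omega
  · exact (hρ _).symm.tendsto_atTop ((Real.tendsto_exp_atTop.comp hE).const_mul_atTop (hd n))

theorem monomial_single_pos (h : Admissible lam R) {l : Fin m} (hl : lam l ≠ 0) (n : ℕ) :
    0 < monomial lam (Pi.single l n) := by
  rw [monomial, Finset.prod_eq_single l (fun k _ hk => by simp [hk]) (by simp)]
  have := lt_of_le_of_ne (h.nonneg l) (Ne.symm hl)
  simpa using pow_pos this n

theorem degree_single (l : Fin m) (n : ℕ) : degree (Pi.single l n) = n := by
  simp [degree]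

theorem ferroExponent_pos (h : Admissible lam R) {J : Fin m → ℝ} (hJ : ∀ l, 0 < J l)
    (hne : ∃ l, lam l ≠ 0) : 0 < ferroExponent J lam := by
  obtain ⟨l, hl⟩ := hne
  refine Finset.sum_pos' (fun k _ => ?_) ⟨l, Finset.mem_univ l, ?_⟩
  · exact mul_nonneg (hJ k).le (div_nonneg (h.nonneg k) (by linarith [h.lt_one k]))
  · exact mul_pos (hJ l) (div_pos (lt_of_le_of_ne (h.nonneg l) (Ne.symm hl))
      (by linarith [h.lt_one l]))

theorem antiferroExponent_pos (h : Admissible lam R) {J : Fin m → ℝ} (hJ : ∀ l, 0 < J l)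
    (hne : ∃ l, lam l ≠ 0) : 0 < antiferroExponent J lam := by
  obtain ⟨l, hl⟩ := hne
  refine Finset.sum_pos' (fun k _ => ?_) ⟨l, Finset.mem_univ l, ?_⟩
  · exact mul_nonneg (hJ k).le (div_nonneg (h.nonneg k) (by linarith [h.nonneg k]))
  · exact mul_pos (hJ l) (div_pos (lt_of_le_of_ne (h.nonneg l) (Ne.symm hl))
      (by linarith [h.nonneg l]))

end

end KacBaker

theorem theorem2 {m : ℕ} (J lam R : Fin m → ℝ) (hJ : ∀ l, 0 < J l)
    (h : KacBaker.Admissible lam R) (hhalf : ∀ l, lam l ≤ 1 / 2) (hne : ∃ l, lam l ≠ 0) :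
    ∃ ρe ρo : (Fin m → ℕ) → ℝ → ℝ,
      KacBaker.ListsEigenvalues J h 1 ρe ∧
      KacBaker.ListsEigenvalues J h (-1) ρo ∧
      KacBaker.LabelsLeading lam ρe atTop ∧ KacBaker.LabelsLeading lam ρe atBot ∧
      KacBaker.LabelsLeading lam ρo atTop ∧ KacBaker.LabelsLeading lam ρo atBot ∧
      (∀ α, ρe α ~[atTop] fun β =>
        KacBaker.monomial lam α * Real.exp (β * KacBaker.ferroExponent J lam)) ∧
      (∀ α, ρe α ~[atBot] fun β =>
        (-1) ^ KacBaker.degree α * KacBaker.monomial lam α *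
          Real.exp (-β * KacBaker.antiferroExponent J lam)) ∧
      (∀ α, ρo α ~[atTop] fun β =>
        KacBaker.monomial lam α * Real.exp (β * KacBaker.ferroExponent J lam)) ∧
      (∀ α, ρo α ~[atBot] fun β =>
        (-1) ^ (KacBaker.degree α + 1) * KacBaker.monomial lam α *
          Real.exp (-β * KacBaker.antiferroExponent J lam)) ∧
      {α | Tendsto (ρe α) atTop atTop}.Infinite ∧ {α | Tendsto (ρe α) atBot atTop}.Infinite ∧
      {α | Tendsto (ρo α) atTop atTop}.Infinite ∧ {α | Tendsto (ρo α) atBot atTop}.Infinite := by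
  obtain ⟨ρe, e1, e2, e3, e4, e5⟩ := KacBaker.exists_labelling h hJ hne (ε := 1) (by norm_num)
  obtain ⟨ρo, o1, o2, o3, o4, o5⟩ := KacBaker.exists_labelling h hJ hne (ε := -1) (by norm_num)
  have hp := KacBaker.ferroExponent_pos h hJ hne
  have hn := KacBaker.antiferroExponent_pos h hJ hne
  have hp' : Tendsto (fun β => β * KacBaker.ferroExponent J lam) atTop atTop :=
    tendsto_id.atTop_mul_const hp
  have hn' : Tendsto (fun β => -β * KacBaker.antiferroExponent J lam) atBot atTop :=
    tendsto_neg_atBot_atTop.atTop_mul_const hn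
  have m1 : ∀ α, KacBaker.model lam 1 1 α = KacBaker.monomial lam α := fun α => by
    simp [KacBaker.model]
  have m2 : ∀ α, KacBaker.model lam (-1) 1 α =
      (-1) ^ KacBaker.degree α * KacBaker.monomial lam α := fun α => by
    simp [KacBaker.model]
  have m3 : ∀ α, KacBaker.model lam (-1) (-1) α =
      (-1) ^ (KacBaker.degree α + 1) * KacBaker.monomial lam α := fun α => by
    rw [KacBaker.model, pow_succ]; ring
  simp only [m1] at e4 o4
  simp only [m2] at e5
  simp only [m3] at o5
  rw [Complex.ofReal_one] at e1
  rw [Complex.ofReal_neg, Complex.ofReal_one] at o1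
  obtain ⟨l, hl⟩ := hne
  have hmon := KacBaker.monomial_single_pos h hl
  refine ⟨ρe, ρo, e1, o1, e2, e3, o2, o3, e4, e5, o4, o5,
    KacBaker.infinite_tendsto_atTop (a := 0) (l := l) e4 hp' fun n => hmon _,
    KacBaker.infinite_tendsto_atTop (a := 0) (l := l) e5 hn' fun n => ?_,
    KacBaker.infinite_tendsto_atTop (a := 0) (l := l) o4 hp' fun n => hmon _,
    -- For odd eigenvalues at negative `β` the sign is `(-1) ^ (|α| + 1)`, so odd exponents are
    -- taken.
    KacBaker.infinite_tendsto_atTop (a := 1) (l := l) o5 hn' fun n => ?_⟩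
  · rw [KacBaker.degree_single, add_zero, pow_mul]
    simpa using hmon (2 * n)
  · have : (-1 : ℝ) ^ (2 * n + 1 + 1) = 1 := by
      rw [show 2 * n + 1 + 1 = 2 * (n + 1) by ring, pow_mul]
      simp
    rw [KacBaker.degree_single, this, one_mul]
    exact hmon _
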